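/- Let $\{\Phi_e\}_{e\in\mathbb N}$ be an effective enumeration of all Turing functionals on Baire space $\mathbb N^{\mathbb N}$. A learner is a total computable function $\Psi:\mathbb N^{<\mathbb N}\to\mathbb N$; it identifies a partial function $\Gamma:\subseteq\mathbb N^{\mathbb N}\to\mathbb N^{\mathbb N}$ if for every $g\in\mathrm{dom}(\Gamma)$ the limit $i=\lim_n\Psi(g\restriction n)$ exists and $\Phi_i(g)=\Gamma(g)$. A partial function $\Gamma$ is called - $(1,1)$-computable if there is $e$ with $\Phi_e(g)=\Gamma(g)$ for all $g\in\mathrm{dom}(\Gamma)$; - $(1,{<}\omega)$-computable if it is identified by a learner $\Psi$ for which there is $b\in\mathbb N$ with $\#\{n:\Psi(g\restriction (n+1))\neq\Psi(g\restriction n)\}\le b$ for all $g\in\mathrm{dom}(\Gamma)$; - $(1,\omega|{<}\omega)$-computable if it is identified by a learner $\Psi$ for which there is $b\in\mathbb N$ with $\#\{\Psi(g\restriction n):n\in\mathbb N\}\le b$ for all $g\in\mathrm{dom}(\Gamma)$; - $({<}\omega,1)$-computable if there is $b\in\mathbb N$ such that for every $g\in\mathrm{dom}(\Gamma)$ there is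 $e<b$ with $\Phi_e(g)=\Gamma(g)$; - $(\omega,1)$-computable if $\Gamma(g)\le_T g$ for every $g\in\mathrm{dom}(\Gamma)$. For such a class $\mathcal F$ of partial functions and $P,Q\subseteq\mathbb N^{\mathbb N}$ write $P\le_{\mathcal F}Q$ if some $\Gamma\in\mathcal F$ is defined on all of $Q$ and maps $Q$ into $P$, and $P\equiv_{\mathcal F}Q$ if $P\le_{\mathcal F}Q$ and $Q\le_{\mathcal F}P$. Let $\mathcal D^\alpha_\beta$ be the quotient of the power set of $\mathbb N^{\mathbb N}$, and $\mathcal P^\alpha_\beta$ the quotient of the set of all nonempty $\Pi^0_1$ subsets of $2^{\mathbb N}$, by $\equiv_{\mathcal F}$, where $\mathcal F$ is the class of $(\alpha,\beta)$-computable functions, ordered by the order induced by $\le_{\mathcal F}$. Thus $\mathcal D^1_1$ and $\mathcal D^\omega_1$ are the Medvedev degrees and the Muchnik degrees. An ordered structure is Brouwerian if for all elements $p,q$ there is a least element $r$ with $p\le q\vee r$, where $\vee$ denotes the least upper bound. **Theorem.** None of the degree structures $\mathcal D^1_{<\omega}$, $\mathcal D^1_{\omega|<\omega}$, $\mathcal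 D^{<\omega}_1$, $\mathcal P^1_{<\omega}$, $\mathcal P^1_{\omega|<\omega}$, $\mathcal P^{<\omega}_1$ is Brouwerian. Moreover, none of these six structures is elementarily equivalent, in the first-order language $\{\le\}$ of partial orders, to $\mathcal D^1_1$ (the Medvedev degrees) or to $\mathcal D^\omega_1$ (the Muchnik degrees). -/

import Mathlib

namespace PiecewiseDegrees

/-- Baire space `ℕ^ℕ`. -/
abbrev Baire : Type := ℕ → ℕ

/-- The initial segment of `f` of length `n`, as a finite string. -/
def initSeg (f : Baire) (n : ℕ) : List ℕ :=
  (List.range n).map f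

/-! ### Turing functionals -/

/-- One stage of the computation of the `e`-th Turing functional on the input `n`: the `e`-th
partial recursive function is applied to `n` and to the finite oracle string `σ`.  The value `0`
means "no output yet", the value `m + 1` means "output `m`". -/
def stage (e n : ℕ) (σ : List ℕ) : Part ℕ :=
  (Denumerable.ofNat Nat.Partrec.Code e).eval (Encodable.encode (n, σ))

/-- The `e`-th Turing functional `Φ_e`, with oracle `f` and input `n`: longer and longer initial
segments of the oracle `f` are fed to the `e`-th partial recursive function, until the first
one on which an output appears; the functional diverges at `n` if a stage diverges or if no stage
gives an output.  Every Turing functional is of this form, effectively in an index of it (at stage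
`k`, run the oracle machine for `k` steps with the oracle `f↾k`), and every `Φ_e` is computed by an
oracle machine, uniformly in `e`: this is an acceptable enumeration of all Turing functionals. -/
def turingFunctional (e : ℕ) (f : Baire) (n : ℕ) : Part ℕ :=
  (Nat.rfind fun k => (stage e n (initSeg f k)).map fun v => decide (v ≠ 0)).bind fun k =>
    (stage e n (initSeg f k)).map Nat.pred

/-- `Φ_e(f) = h`, as elements of Baire space. -/
def ComputesTo (e : ℕ) (f h : Baire) : Prop :=
  ∀ n, h n ∈ turingFunctional e f n

/-! ### Learners -/

/-- The mind-change locations of the learner `Ψ` on `f`. -/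
def mindChanges (Ψ : List ℕ → ℕ) (f : Baire) : Set ℕ :=
  {n | Ψ (initSeg f (n + 1)) ≠ Ψ (initSeg f n)}

/-- The indices predicted by the learner `Ψ` on `f`. -/
def predicted (Ψ : List ℕ → ℕ) (f : Baire) : Set ℕ :=
  Set.range fun n => Ψ (initSeg f n)

/-- The partial function `Γ` is identified by the learner `Ψ`: at every `g` in the domain of `Γ`,
the guesses of `Ψ` on `g` converge to an index `i` with `Φ_i(g) = Γ(g)`. -/
def IdentifiedBy (Γ : Baire →. Baire) (Ψ : List ℕ → ℕ) : Prop :=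
  ∀ g, ∀ h ∈ Γ g, ∃ i, (∃ N, ∀ n ≥ N, Ψ (initSeg g n) = i) ∧ ComputesTo i g h

/-! ### Classes of partial functions on Baire space -/

/-- Partial computable functions: the `(1,1)`-computable functions. -/
def partialComputable : Set (Baire →. Baire) :=
  {Γ | ∃ e, ∀ g, ∀ h ∈ Γ g, ComputesTo e g h}

/-- Functions learnable with bounded mind changes: the `(1,<ω)`-computable functions. -/
def boundedMindChanges : Set (Baire →. Baire) :=
  {Γ | ∃ Ψ : List ℕ → ℕ, Computable Ψ ∧ IdentifiedBy Γ Ψ ∧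
    ∃ b : ℕ, ∀ g ∈ Γ.Dom, (mindChanges Ψ g).encard ≤ b}

/-- Functions learnable with bounded errors: the `(1,ω|<ω)`-computable functions. -/
def boundedErrors : Set (Baire →. Baire) :=
  {Γ | ∃ Ψ : List ℕ → ℕ, Computable Ψ ∧ IdentifiedBy Γ Ψ ∧
    ∃ b : ℕ, ∀ g ∈ Γ.Dom, (predicted Ψ g).encard ≤ b}

/-- Functions that are `k`-wise computable for some `k`: the `(<ω,1)`-computable functions. -/
def finitelyComputable : Set (Baire →. Baire) :=
  {Γ | ∃ b : ℕ, ∀ g, ∀ h ∈ Γ g, ∃ e < b, ComputesTo e g h}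

/-- Nonuniformly computable functions: the `(ω,1)`-computable functions. -/
def nonuniformlyComputable : Set (Baire →. Baire) :=
  {Γ | ∀ g, ∀ h ∈ Γ g, TuringReducible (h : ℕ →. ℕ) (g : ℕ →. ℕ)}

/-! ### Degree structures -/

/-- `P ≤_𝓕 Q`: some partial function in the class `𝓕` is defined on all of `Q` and maps `Q`
into `P`. -/
def Reduces (𝓕 : Set (Baire →. Baire)) (P Q : Set Baire) : Prop :=
  ∃ Γ ∈ 𝓕, ∀ g ∈ Q, ∃ h ∈ Γ g, h ∈ P

/-- The `𝓕`-degree of `P` within the collection `S` of subsets of Baire space: the set of all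
members of `S` that are `𝓕`-equivalent to `P`. -/
def degreeClass (𝓕 : Set (Baire →. Baire)) (S : Set (Set Baire)) (P : Set Baire) :
    Set (Set Baire) :=
  {Q | Q ∈ S ∧ Reduces 𝓕 P Q ∧ Reduces 𝓕 Q P}

/-- The quotient `S / ≡_𝓕` of a collection `S` of subsets of Baire space. -/
def Degrees (𝓕 : Set (Baire →. Baire)) (S : Set (Set Baire)) : Type :=
  {c : Set (Set Baire) // ∃ P ∈ S, c = degreeClass 𝓕 S P}

/-- The order on degrees that is induced by `≤_𝓕`. -/
instance (𝓕 : Set (Baire →. Baire)) (S : Set (Set Baire)) : LE (Degrees 𝓕 S) :=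
  ⟨fun c d => ∃ P ∈ c.1, ∃ Q ∈ d.1, Reduces 𝓕 P Q⟩

/-- Degrees as a structure in the first-order language `{≤}` of partial orders. -/
instance (𝓕 : Set (Baire →. Baire)) (S : Set (Set Baire)) :
    FirstOrder.Language.order.Structure (Degrees 𝓕 S) :=
  FirstOrder.Language.orderStructure _

/-- `P` is a `Π⁰₁` subset of Cantor space `2^ℕ` (regarded as a subset of Baire space): the set of
all `f ∈ 2^ℕ` whose initial segments all satisfy one computable condition on finite strings. -/
def IsPi01Cantor (P : Set Baire) : Prop :=
  ∃ T : List ℕ → Prop, ComputablePred T ∧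
    P = {f | (∀ n, f n < 2) ∧ ∀ n, T (initSeg f n)}

/-- The collection of all nonempty `Π⁰₁` subsets of Cantor space. -/
def pi01Sets : Set (Set Baire) :=
  {P | P.Nonempty ∧ IsPi01Cantor P}

/-- `𝓓/𝓕`: the `𝓕`-degrees of all subsets of Baire space. -/
abbrev AllDegrees (𝓕 : Set (Baire →. Baire)) : Type :=
  Degrees 𝓕 Set.univ

/-- `𝓟/𝓕`: the `𝓕`-degrees of the nonempty `Π⁰₁` subsets of Cantor space. -/
abbrev Pi01Degrees (𝓕 : Set (Baire →. Baire)) : Type :=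
  Degrees 𝓕 pi01Sets

/-- The Medvedev degrees. -/
abbrev MedvedevDegrees : Type := AllDegrees partialComputable

/-- The Muchnik degrees. -/
abbrev MuchnikDegrees : Type := AllDegrees nonuniformlyComputable

/-! ### Brouwerian structures -/

/-- `p ≤ q ∨ r`, where the join is the least upper bound. -/
def LEJoin {α : Type*} [LE α] (p q r : α) : Prop :=
  ∃ u, IsLUB {q, r} u ∧ p ≤ u

/-- An ordered structure is Brouwerian if for all `p`, `q` there is a least `r` such that
`p ≤ q ∨ r`. -/
def IsBrouwerian (α : Type*) [LE α] : Prop :=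
  ∀ p q : α, ∃ r : α, IsLeast {s | LEJoin p q s} r

end PiecewiseDegrees

namespace PiecewiseDegrees
open Nat.Partrec (Code)

/-! ### Initial segments -/

/-! Write P for `tagSeparating`, Q for `tagAvoiding` and R_n for `tagOnly n`; all are nonempty Π⁰₁
classes. A sequence of bits is read as a sequence of letters, one for each block x. The block number
x carries a tag and the code of a program, and that program may kill fewer than `budget x` of the
`alphabet x` letters available in the block.

Upper bound (`tagSeparating_reduces`): from g in Q and r in R_n one obtains an element of P by
pairing r with a column (n, l) of g, l ≤ n, in which no letter with tag n is killed. A learner tries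
l = 0, 1, … and moves on when a column is refuted, so it changes its mind at most n times. Hence P ≤
Q ∨ R_n for each n, but the bound grows with n.

If the structure were Brouwerian, the least R with P ≤ Q ∨ R would satisfy R ≤ R_n for all n. All
three reducibilities lie between learnability with bounded mind changes and piecewise computability
by finitely many functionals. So there would be a single c such that c functionals reduce P to Q ∨
R, and for every n some d such that d functionals reduce R to R_n. This is refuted by
`exists_forall_escapes`: for a suitable n that depends only on c, and for every d, some r in R_n is
such that for each e < d, if Φ_e(r) is total, then some g in Q has no Φ_i(g ⊕ Φ_e(r)), i < c, in P.

That r is built by bushy tree forcing, one stage for each e (`exists_stage`). The state is a string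
together with a set of strings that is not big above it. At a stage a fresh block k with tag n is
chosen whose program knows the c simulated functionals. Among the numbers j of functionals whose
output at block k can be guessed correctly on a big set of oracles, one takes the last. Pigeonholing
fixes the guesses, `exists_search` makes the program find them, and it kills the guessed letters in
both halves of the output. A functional with a guess thus outputs two killed letters with the same
tag, which P forbids. A functional without a guess cannot be total on the chosen oracle, since its
output would be one more guess. The first component r may contain killed letters with tag n, and g
survives because its n + 1 columns (n, l) carry independent letters at k, so not all of them need be
killed.

For the second claim, being Brouwerian is expressed by one sentence (`realize_brouwerianSentence`),
and the Medvedev and Muchnik degrees satisfy it: the residual of P by Q consists of the oracles that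
turn every element of Q into one of P, preceded by an index in the uniform case. -/

@[simp] theorem length_initSeg (f : Baire) (n : ℕ) : (initSeg f n).length = n := by
  simp [initSeg]

theorem getElem?_initSeg_of_lt (f : Baire) {n i : ℕ} (h : i < n) :
    (initSeg f n)[i]? = some (f i) := by
  simp [initSeg, h]

theorem getElem?_initSeg (f : Baire) (n i : ℕ) :
    (initSeg f n)[i]? = if i < n then some (f i) else none := by
  by_cases h : i < n <;> simp [initSeg, h]

theorem take_initSeg (f : Baire) {k n : ℕ} (h : k ≤ n) :
    (initSeg f n).take k = initSeg f k := by
  simp [initSeg, ← List.map_take, List.take_range, h]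

theorem initSeg_prefix (f : Baire) {k n : ℕ} (h : k ≤ n) : initSeg f k <+: initSeg f n := by
  rw [← take_initSeg f h]; exact List.take_prefix _ _

theorem initSeg_congr {f g : Baire} {n : ℕ} (h : ∀ i < n, f i = g i) :
    initSeg f n = initSeg g n :=
  List.map_congr_left fun i hi => h i (List.mem_range.1 hi)

theorem eq_initSeg_of_prefix {σ : List ℕ} {f : Baire} {n : ℕ} (h : σ <+: initSeg f n) :
    σ = initSeg f σ.length := by
  rw [← take_initSeg f (by simpa using h.length_le)]
  exact List.prefix_iff_eq_take.1 h

/-! ### A uniform approximation of all Turing functionals -/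

/-- The part of `Φ_e(f)(n)` that is computed within `|σ|` steps from the initial segment `σ`
of `f`. -/
def approx (e n : ℕ) (σ : List ℕ) : Option ℕ :=
  ((((List.range (σ.length + 1)).map fun k =>
    Code.evaln σ.length (Denumerable.ofNat Code e) (Encodable.encode (n, σ.take k))).dropWhile
      fun o => o == some 0).head?.bind id).map Nat.pred

/-- `dropWhile` passes over stages that are known to answer 0 and stops at the first other one. If
that stage has not halted within the time bound, there is no value, so a later stage can never
overtake a slower one. This is what makes `approx` monotone and faithful to `turingFunctional`. -/
theorem approx_eq_some {e n v : ℕ} {σ : List ℕ} :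
    approx e n σ = some v ↔ ∃ k ≤ σ.length,
      Code.evaln σ.length (Denumerable.ofNat Code e) (Encodable.encode (n, σ.take k))
        = some (v + 1) ∧
      ∀ j < k, Code.evaln σ.length (Denumerable.ofNat Code e) (Encodable.encode (n, σ.take j))
        = some 0 := by
  set g : ℕ → Option ℕ := fun k =>
    Code.evaln σ.length (Denumerable.ofNat Code e) (Encodable.encode (n, σ.take k)) with hg
  have key : approx e n σ =
      ((((List.range (σ.length + 1)).find? fun k => !(g k == some 0)).map g).bind id).map
        (fun m => m - 1) := by
    unfold approx
    rw [← List.find?_not_eq_head?_dropWhile, List.find?_map]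
    rfl
  rw [key]
  simp only [Option.map_eq_some_iff, Option.bind_eq_some_iff, id, List.find?_range_eq_some]
  constructor
  · rintro ⟨a, ⟨b, ⟨k, ⟨h1, h2, h3⟩, rfl⟩, hb⟩, rfl⟩
    refine ⟨k, by simpa [Nat.lt_succ_iff] using h2, ?_, fun j hj => by simpa [hg] using h3 j hj⟩
    change g k = _
    rw [hb] at h1 ⊢
    cases a with
    | zero => simp at h1
    | succ a => simp
  · rintro ⟨k, hk, h1, h2⟩
    refine ⟨v + 1, ⟨_, ⟨k, ⟨?_, by simpa [Nat.lt_succ_iff] using hk, fun j hj => ?_⟩, rfl⟩, h1⟩, by simp⟩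
    · rw [show g k = _ from h1]; simp
    · rw [show g j = _ from h2 j hj]; simp

theorem primrec_approx : Primrec fun p : ℕ × ℕ × List ℕ => approx p.1 p.2.1 p.2.2 := by
  have h1 : Primrec₂ fun (p : ℕ × ℕ × List ℕ) (k : ℕ) =>
      Code.evaln p.2.2.length (Denumerable.ofNat Code p.1)
        (Encodable.encode (p.2.1, p.2.2.take k)) := by
    refine Code.primrec_evaln.comp (Primrec.pair (Primrec.pair ?_ ?_) ?_)
    · exact Primrec.list_length.comp (Primrec.snd.comp (Primrec.snd.comp Primrec.fst))
    · exact (Primrec.ofNat Code).comp (Primrec.fst.comp Primrec.fst)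
    · exact Primrec.encode.comp (Primrec.pair (Primrec.fst.comp (Primrec.snd.comp Primrec.fst))
        (Primrec.list_take.comp Primrec.snd (Primrec.snd.comp (Primrec.snd.comp Primrec.fst))))
  have h2 : Primrec fun p : ℕ × ℕ × List ℕ => (List.range (p.2.2.length + 1)).map fun k =>
      Code.evaln p.2.2.length (Denumerable.ofNat Code p.1)
        (Encodable.encode (p.2.1, p.2.2.take k)) :=
    Primrec.list_map (Primrec.list_range.comp (Primrec.succ.comp
      (Primrec.list_length.comp (Primrec.snd.comp Primrec.snd)))) h1
  have h3 : Primrec fun o : Option ℕ => o == some 0 :=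
    (Primrec.eq.decide.comp Primrec.id (Primrec.const (some 0))).of_eq fun o => by
      by_cases h : o = some 0 <;> simp [h]
  have h4 := Primrec.list_head?.comp ((Primrec.list_dropWhile h3).comp h2)
  exact Primrec.option_map (Primrec.option_bind h4 Primrec.snd.to₂)
    (Primrec.pred.comp Primrec.snd).to₂

theorem approx_mono {e n v : ℕ} {σ τ : List ℕ} (h : σ <+: τ) (hv : approx e n σ = some v) :
    approx e n τ = some v := by
  rw [approx_eq_some] at hv ⊢
  obtain ⟨k, hk, h1, h2⟩ := hv
  have hl := h.length_le
  have htake : ∀ j ≤ σ.length, τ.take j = σ.take j := by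
    intro j hj
    obtain ⟨u, rfl⟩ := h
    rw [List.take_append_of_le_length hj]
  refine ⟨k, hk.trans hl, ?_, fun j hj => ?_⟩
  · rw [htake k hk]; exact Code.evaln_mono hl h1
  · rw [htake j (hj.le.trans hk)]; exact Code.evaln_mono hl (h2 j hj)

theorem mem_turingFunctional {e n v : ℕ} {f : Baire} :
    v ∈ turingFunctional e f n ↔ ∃ k, v + 1 ∈ stage e n (initSeg f k) ∧
      ∀ j < k, 0 ∈ stage e n (initSeg f j) := by
  unfold turingFunctional
  simp only [Part.mem_bind_iff, Part.mem_map_iff]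
  constructor
  · rintro ⟨k, hk, b, hb, rfl⟩
    obtain ⟨h1, h2⟩ := Nat.mem_rfind.1 hk
    obtain ⟨a, ha, ha0⟩ := (Part.mem_map_iff _).1 h1
    obtain rfl := Part.mem_unique ha hb
    refine ⟨k, ?_, fun j hj => ?_⟩
    · rw [Nat.pred_eq_sub_one, Nat.sub_add_cancel (Nat.pos_of_ne_zero (by simpa using ha0))]
      exact ha
    · obtain ⟨c, hc, hc0⟩ := (Part.mem_map_iff _).1 (h2 hj)
      have : c = 0 := by simpa using hc0
      exact this ▸ hc
  · rintro ⟨k, h1, h2⟩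
    exact ⟨k, Nat.mem_rfind.2 ⟨(Part.mem_map_iff _).2 ⟨_, h1, by simp⟩,
      fun hj => (Part.mem_map_iff _).2 ⟨0, h2 _ hj, by simp⟩⟩, _, h1, rfl⟩

theorem mem_turingFunctional_of_approx {e n v N : ℕ} {f : Baire}
    (h : approx e n (initSeg f N) = some v) : v ∈ turingFunctional e f n := by
  rw [approx_eq_some, length_initSeg] at h
  obtain ⟨k, hk, h1, h2⟩ := h
  rw [mem_turingFunctional]
  refine ⟨k, ?_, fun j hj => ?_⟩
  · rw [take_initSeg f hk] at h1; exact Code.evaln_sound h1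
  · have := h2 j hj
    rw [take_initSeg f (hj.le.trans hk)] at this; exact Code.evaln_sound this

theorem exists_approx_of_mem {e n v : ℕ} {f : Baire} (h : v ∈ turingFunctional e f n) :
    ∃ N, approx e n (initSeg f N) = some v := by
  rw [mem_turingFunctional] at h
  obtain ⟨k, h1, h2⟩ := h
  obtain ⟨s, hs⟩ := Code.evaln_complete.1 h1
  have : ∀ j, ∃ t, j < k → 0 ∈ Code.evaln t (Denumerable.ofNat Code e)
      (Encodable.encode (n, initSeg f j)) := by
    intro j
    by_cases hj : j < k
    · obtain ⟨t, ht⟩ := Code.evaln_complete.1 (h2 j hj)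
      exact ⟨t, fun _ => ht⟩
    · exact ⟨0, fun h => absurd h hj⟩
  choose t ht using this
  set N := max (max s k) ((Finset.range k).sup t)
  have hsN : s ≤ N := (le_max_left _ _).trans (le_max_left _ _)
  have hkN : k ≤ N := (le_max_right _ _).trans (le_max_left _ _)
  refine ⟨N, approx_eq_some.2 ⟨k, by simpa using hkN, ?_, fun j hj => ?_⟩⟩
  · rw [take_initSeg f hkN, length_initSeg]; exact Code.evaln_mono hsN hs
  · rw [take_initSeg f (hj.le.trans hkN), length_initSeg]
    exact Code.evaln_mono ((Finset.le_sup (Finset.mem_range.2 hj)).trans (le_max_right _ _))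
      (ht j hj)

theorem ComputesTo.exists_approx {e : ℕ} {f h : Baire} (H : ComputesTo e f h) (n : ℕ) :
    ∃ N, ∀ M ≥ N, approx e n (initSeg f M) = some (h n) := by
  obtain ⟨N, hN⟩ := exists_approx_of_mem (H n)
  exact ⟨N, fun M hM => approx_mono (initSeg_prefix f hM) hN⟩

theorem ComputesTo.eq_of_approx {e : ℕ} {f h : Baire} (H : ComputesTo e f h) {n N v : ℕ}
    (hv : approx e n (initSeg f N) = some v) : v = h n :=
  Part.mem_unique (mem_turingFunctional_of_approx hv) (H n)

/-! ### Indices of Turing functionals given by computable approximations -/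

/-- `A` is a sound and complete approximation of `h` along the initial segments of `f`. -/
structure Approximates (A : List ℕ → ℕ → Option ℕ) (f h : Baire) : Prop where
  sound : ∀ k n v, A (initSeg f k) n = some v → v = h n
  complete : ∀ n, ∃ k, A (initSeg f k) n = some (h n)

/-- Recode `none` as 0 and `some v` as v + 1: the stages become total, and the first nonzero one is
the output. Currying absorbs the parameter. Nothing is assumed about `A` along other oracles, so
later constructions need only be correct on the inputs of interest. -/
theorem exists_index {A : ℕ → List ℕ → ℕ → Option ℕ}
    (hA : Computable fun p : ℕ × List ℕ × ℕ => A p.1 p.2.1 p.2.2) :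
    ∃ ι : ℕ → ℕ, Computable ι ∧ ∀ a f h, Approximates (A a) f h → ComputesTo (ι a) f h := by
  have h0 : Computable fun x : ℕ => (Option.casesOn
      (A x.unpair.1 (Denumerable.ofNat (ℕ × List ℕ) x.unpair.2).2
        (Denumerable.ofNat (ℕ × List ℕ) x.unpair.2).1) 0 (fun v => v + 1) : ℕ) := by
    have hy : Computable fun x : ℕ => Denumerable.ofNat (ℕ × List ℕ) x.unpair.2 :=
      (Computable.ofNat _).comp (Computable.snd.comp Computable.unpair)
    refine Computable.option_casesOn (hA.comp (Computable.pair
      (Computable.fst.comp Computable.unpair)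
      (Computable.pair (Computable.snd.comp hy) (Computable.fst.comp hy))))
      (Computable.const 0) (Computable.succ.comp Computable.snd).to₂
  obtain ⟨c, hc⟩ := Code.exists_code.1 (Partrec.nat_iff.1 h0.partrec)
  refine ⟨fun a => Encodable.encode (Code.curry c a), ?_, ?_⟩
  · exact Computable.encode.comp
      (Code.primrec₂_curry.to_comp.comp (Computable.const c) Computable.id)
  · intro a f h H n
    have hst : ∀ σ, stage (Encodable.encode (Code.curry c a)) n σ =
        Part.some (Option.casesOn (A a σ n) 0 (fun v => v + 1) : ℕ) := by
      intro σ
      simp [stage, Code.eval_curry, hc]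
    rw [mem_turingFunctional]
    have hex := H.complete n
    classical
    refine ⟨Nat.find hex, ?_, fun j hj => ?_⟩
    · rw [hst, Nat.find_spec hex]; simp
    · have := Nat.find_min hex hj
      rw [hst]
      cases hv : A a (initSeg f j) n with
      | none => simp
      | some v => exact absurd (H.sound j n v hv ▸ hv) this

theorem exists_index_const {A : List ℕ → ℕ → Option ℕ}
    (hA : Computable fun p : List ℕ × ℕ => A p.1 p.2) :
    ∃ e, ∀ f h, Approximates A f h → ComputesTo e f h := by
  obtain ⟨ι, -, hι⟩ := exists_index (A := fun _ => A) (hA.comp Computable.snd)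
  exact ⟨ι 0, hι 0⟩

/-! ### Collecting the values of a finite approximation -/

/-- The longest initial segment, of length at most `N`, of the values of `F` before the first
missing value. -/
def takeSome (F : ℕ → Option ℕ) (N : ℕ) : List ℕ :=
  ((List.range N).map F).takeWhile Option.isSome |>.filterMap id

theorem primrec_takeSome {α : Type*} [Primcodable α] {F : α → ℕ → Option ℕ} (hF : Primrec₂ F) :
    Primrec₂ fun a N => takeSome (F a) N := by
  have h1 : Primrec fun p : α × ℕ => (List.range p.2).map (F p.1) :=
    Primrec.list_map (Primrec.list_range.comp Primrec.snd)
      (hF.comp (Primrec.fst.comp Primrec.fst) Primrec.snd).to₂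
  have h2 : Primrec (Option.isSome : Option ℕ → Bool) := Primrec.option_isSome
  exact Primrec.listFilterMap ((Primrec.list_takeWhile h2).comp h1) Primrec.snd.to₂

/-- A normal form from which the other facts on `takeSome` are read off: m is the first index with a
missing value, or N if there is none. -/
theorem takeSome_eq_initSeg (F : ℕ → Option ℕ) (N : ℕ) :
    ∃ m ≤ N, (∀ i < m, (F i).isSome) ∧ (m < N → F m = none) ∧
      takeSome F N = initSeg (fun i => (F i).getD 0) m := by
  classical
  by_cases hex : ∃ m < N, F m = none
  · have hs := Nat.find_spec hex
    set m := Nat.find hex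
    have hmin : ∀ i < m, (F i).isSome := by
      intro i hi
      rw [Option.isSome_iff_ne_none]
      exact fun h => Nat.find_min hex hi ⟨hi.trans hs.1, h⟩
    refine ⟨m, hs.1.le, hmin, fun _ => hs.2, ?_⟩
    have hr : List.range N = List.range m ++ m :: ((List.range (N - m - 1)).map Nat.succ).map (m + ·) := by
      conv_lhs => rw [show N = m + (N - m - 1 + 1) by omega]
      rw [List.range_add, List.range_succ_eq_map (n := N - m - 1), List.map_cons, Nat.add_zero]
    unfold takeSome
    rw [hr, List.map_append, List.takeWhile_append_of_pos (by simpa using hmin)]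
    simp only [List.map_cons, hs.2, Option.isSome_none, Bool.false_eq_true, not_false_eq_true,
      List.takeWhile_cons_of_neg, List.append_nil, initSeg, List.filterMap_map]
    refine List.filterMap_eq_map_iff_forall_eq_some.2 fun i hi => ?_
    obtain ⟨v, hv⟩ := Option.isSome_iff_exists.1 (hmin i (by simpa using hi))
    simp [hv]
  · push Not at hex
    have hall : ∀ i < N, (F i).isSome := fun i hi => Option.isSome_iff_ne_none.2 (hex i hi)
    refine ⟨N, le_rfl, hall, fun h => absurd h (lt_irrefl _), ?_⟩
    unfold takeSome
    rw [List.takeWhile_eq_self_iff.2 (by simpa using hall), initSeg, List.filterMap_map]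
    refine List.filterMap_eq_map_iff_forall_eq_some.2 fun i hi => ?_
    obtain ⟨v, hv⟩ := Option.isSome_iff_exists.1 (hall i (by simpa using hi))
    simp [hv]

theorem takeSome_eq_of_sound {F : ℕ → Option ℕ} {f : Baire} (hF : ∀ i v, F i = some v → v = f i)
    (N : ℕ) : takeSome F N = initSeg f (takeSome F N).length := by
  obtain ⟨m, -, h1, -, h2⟩ := takeSome_eq_initSeg F N
  rw [h2, length_initSeg]
  refine initSeg_congr fun i hi => ?_
  obtain ⟨v, hv⟩ := Option.isSome_iff_exists.1 (h1 i hi)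
  simp [hv, hF i v hv]

theorem le_length_takeSome {F : ℕ → Option ℕ} {M N : ℕ} (hMN : M ≤ N)
    (hF : ∀ i < M, (F i).isSome) : M ≤ (takeSome F N).length := by
  obtain ⟨m, -, h1, h3, h2⟩ := takeSome_eq_initSeg F N
  rw [h2, length_initSeg]
  by_contra h
  push Not at h
  have := hF m h
  rw [h3 (by omega)] at this
  simp at this

theorem takeSome_prefix {F G : ℕ → Option ℕ} (hFG : ∀ i v, F i = some v → G i = some v)
    {M N : ℕ} (hMN : M ≤ N) : takeSome F M <+: takeSome G N := by
  obtain ⟨m, hm, h1, -, h2⟩ := takeSome_eq_initSeg F M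
  obtain ⟨k, -, k1, k3, k2⟩ := takeSome_eq_initSeg G N
  have hG : ∀ i < m, G i = F i := by
    intro i hi
    obtain ⟨v, hv⟩ := Option.isSome_iff_exists.1 (h1 i hi)
    rw [hv, hFG i v hv]
  have hmk : m ≤ k := by
    by_contra h
    push Not at h
    have := h1 k h
    rw [← hG k h, k3 (by omega)] at this
    simp at this
  rw [h2, k2, initSeg_congr (g := fun i => (G i).getD 0) fun i hi => by simp [hG i hi]]
  exact initSeg_prefix _ hmk

/-! ### Operations on Turing functionals -/

/-- The output computed by `Φ_e` from the finite oracle `σ`. -/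
def outPrefix (e : ℕ) (σ : List ℕ) : List ℕ :=
  takeSome (fun x => approx e x σ) σ.length

theorem primrec_outPrefix : Primrec₂ outPrefix := by
  have h : Primrec₂ fun (p : ℕ × List ℕ) (x : ℕ) => approx p.1 x p.2 :=
    primrec_approx.comp (Primrec.pair (Primrec.fst.comp Primrec.fst)
      (Primrec.pair Primrec.snd (Primrec.snd.comp Primrec.fst)))
  exact (primrec_takeSome h).comp Primrec.id (Primrec.list_length.comp Primrec.snd)

theorem outPrefix_mono {e : ℕ} {σ τ : List ℕ} (h : σ <+: τ) : outPrefix e σ <+: outPrefix e τ :=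
  takeSome_prefix (fun _ _ hv => approx_mono h hv) h.length_le

theorem ComputesTo.outPrefix_eq {e : ℕ} {f g : Baire} (H : ComputesTo e f g) (n : ℕ) :
    outPrefix e (initSeg f n) = initSeg g (outPrefix e (initSeg f n)).length :=
  takeSome_eq_of_sound (fun _ _ hv => H.eq_of_approx hv) _

theorem ComputesTo.exists_le_length_outPrefix {e : ℕ} {f g : Baire} (H : ComputesTo e f g)
    (m : ℕ) : ∃ N, ∀ n ≥ N, m ≤ (outPrefix e (initSeg f n)).length := by
  choose N hN using H.exists_approx
  refine ⟨max m ((Finset.range m).sup N), fun n hn => le_length_takeSome ?_ fun i hi => ?_⟩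
  · simpa using (le_max_left _ _).trans hn
  · rw [hN i n ((Finset.le_sup (Finset.mem_range.2 hi)).trans ((le_max_right _ _).trans hn))]
    rfl

/-- Φ_a is run on the finite output of Φ_b, which is an initial segment of g. The combined index has
to be computable in both indices, because learners compose guesses. -/
theorem exists_comp_index : ∃ κ : ℕ → ℕ → ℕ, Computable₂ κ ∧ ∀ a b f g h,
    ComputesTo b f g → ComputesTo a g h → ComputesTo (κ a b) f h := by
  obtain ⟨ι, hι, H⟩ := exists_index (A := fun p σ n => approx p.unpair.1 n (outPrefix p.unpair.2 σ))
    (by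
      refine Primrec.to_comp (primrec_approx.comp (Primrec.pair
        (Primrec.fst.comp (Primrec.unpair.comp Primrec.fst)) (Primrec.pair
          (Primrec.snd.comp Primrec.snd) (primrec_outPrefix.comp
            (Primrec.snd.comp (Primrec.unpair.comp Primrec.fst)) (Primrec.fst.comp Primrec.snd)))))
      )
  refine ⟨fun a b => ι (Nat.pair a b), hι.comp (Primrec₂.natPair.to_comp), ?_⟩
  intro a b f g h hb ha
  refine H _ _ _ ⟨fun k n v hv => ?_, fun n => ?_⟩
  · simp only [Nat.unpair_pair] at hv
    rw [hb.outPrefix_eq] at hv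
    exact ha.eq_of_approx hv
  · obtain ⟨M, hM⟩ := ha.exists_approx n
    obtain ⟨N, hN⟩ := hb.exists_le_length_outPrefix M
    refine ⟨N, ?_⟩
    simp only [Nat.unpair_pair]
    rw [hb.outPrefix_eq]
    exact hM _ (hN N le_rfl)

theorem exists_reindex_index {φ : ℕ → ℕ} (hφ : Computable φ) :
    ∃ e, ∀ f : Baire, ComputesTo e f (fun n => f (φ n)) := by
  obtain ⟨e, he⟩ := exists_index_const (A := fun σ n => σ[φ n]?)
    (Computable.list_getElem?.comp Computable.fst (hφ.comp Computable.snd))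
  refine ⟨e, fun f => he _ _ ⟨fun k n v hv => ?_, fun n => ⟨φ n + 1, ?_⟩⟩⟩
  · rw [getElem?_initSeg] at hv
    split_ifs at hv
    exact (Option.some.inj hv).symm
  · exact getElem?_initSeg_of_lt f (Nat.lt_succ_self _)

theorem exists_id_index : ∃ e, ∀ f, ComputesTo e f f :=
  exists_reindex_index Computable.id

/-- The join `f ⊕ g` of two elements of Baire space. -/
def joinSeq (f g : Baire) : Baire :=
  fun n => if n % 2 = 0 then f (n / 2) else g (n / 2)

/-- The part of a sequence at even places. -/
def evenPart (f : Baire) : Baire := fun n => f (2 * n)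

/-- The part of a sequence at odd places. -/
def oddPart (f : Baire) : Baire := fun n => f (2 * n + 1)

@[simp] theorem evenPart_joinSeq (f g : Baire) : evenPart (joinSeq f g) = f := by
  funext n; simp [evenPart, joinSeq]

@[simp] theorem oddPart_joinSeq (f g : Baire) : oddPart (joinSeq f g) = g := by
  funext n
  have h1 : (2 * n + 1) % 2 = 1 := by omega
  have h2 : (2 * n + 1) / 2 = n := by omega
  simp [oddPart, joinSeq, h2]

@[simp] theorem joinSeq_evenPart_oddPart (f : Baire) : joinSeq (evenPart f) (oddPart f) = f := by
  funext n
  unfold joinSeq evenPart oddPart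
  split_ifs with h
  · congr 1; omega
  · congr 1; omega

theorem primrec_double : Primrec fun n : ℕ => 2 * n :=
  Primrec.nat_mul.comp (Primrec.const 2) Primrec.id

theorem exists_evenPart_index : ∃ e, ∀ f, ComputesTo e f (evenPart f) :=
  exists_reindex_index primrec_double.to_comp

theorem exists_oddPart_index : ∃ e, ∀ f, ComputesTo e f (oddPart f) :=
  exists_reindex_index (Primrec.succ.comp primrec_double).to_comp

theorem exists_join_index : ∃ κ : ℕ → ℕ → ℕ, Computable₂ κ ∧ ∀ a b f g h,
    ComputesTo a f g → ComputesTo b f h → ComputesTo (κ a b) f (joinSeq g h) := by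
  obtain ⟨ι, hι, H⟩ := exists_index (A := fun p σ n =>
      approx (if n % 2 = 0 then p.unpair.1 else p.unpair.2) (n / 2) σ)
    (by
      have hn : Primrec fun p : ℕ × List ℕ × ℕ => p.2.2 := Primrec.snd.comp Primrec.snd
      refine Primrec.to_comp (primrec_approx.comp (Primrec.pair (Primrec.ite
        (Primrec.eq.comp (Primrec.nat_mod.comp hn (Primrec.const 2)) (Primrec.const 0))
        (Primrec.fst.comp (Primrec.unpair.comp Primrec.fst))
        (Primrec.snd.comp (Primrec.unpair.comp Primrec.fst))) (Primrec.pair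
          (Primrec.nat_div.comp hn (Primrec.const 2)) (Primrec.fst.comp Primrec.snd)))))
  refine ⟨fun a b => ι (Nat.pair a b), hι.comp (Primrec₂.natPair.to_comp), ?_⟩
  intro a b f g h ha hb
  refine H _ _ _ ⟨fun k n v hv => ?_, fun n => ?_⟩
  · simp only [Nat.unpair_pair] at hv
    unfold joinSeq
    split_ifs at hv ⊢ with h0
    · exact ha.eq_of_approx hv
    · exact hb.eq_of_approx hv
  · simp only [Nat.unpair_pair]
    unfold joinSeq
    split_ifs with h0
    · exact (ha.exists_approx _).imp fun N hN => hN N le_rfl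
    · exact (hb.exists_approx _).imp fun N hN => hN N le_rfl

/-- A universal functional: the index to be used is read off the oracle. -/
theorem exists_eval_index {φ : ℕ → ℕ} (hφ : Primrec φ) (i : ℕ) :
    ∃ e, ∀ f h : Baire, ComputesTo (f i) (fun n => f (φ n)) h → ComputesTo e f h := by
  obtain ⟨e, he⟩ := exists_index_const (A := fun σ n =>
      (σ[i]?).bind fun c => approx c n (takeSome (fun x => σ[φ x]?) σ.length))
    (by
      have h1 : Primrec₂ fun (σ : List ℕ) (x : ℕ) => σ[φ x]? :=
        Primrec.list_getElem?.comp Primrec.fst (hφ.comp Primrec.snd)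
      have h2 : Primrec fun σ : List ℕ => takeSome (fun x => σ[φ x]?) σ.length :=
        (primrec_takeSome h1).comp Primrec.id Primrec.list_length
      refine Primrec.to_comp (Primrec.option_bind
        (Primrec.list_getElem?.comp Primrec.fst (Primrec.const i))
        (primrec_approx.comp (Primrec.pair Primrec.snd (Primrec.pair
          (Primrec.snd.comp Primrec.fst) (h2.comp (Primrec.fst.comp Primrec.fst))))).to₂))
  refine ⟨e, fun f h H => he _ _ ?_⟩
  have hsound : ∀ k x v, (initSeg f k)[φ x]? = some v → v = f (φ x) := by
    intro k x v hv
    rw [getElem?_initSeg] at hv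
    split_ifs at hv
    exact (Option.some.inj hv).symm
  refine ⟨fun k n v hv => ?_, fun n => ?_⟩
  · obtain ⟨c, hc, hv⟩ := Option.bind_eq_some_iff.1 hv
    rw [getElem?_initSeg] at hc
    split_ifs at hc
    obtain rfl := Option.some.inj hc
    rw [takeSome_eq_of_sound (f := fun n => f (φ n)) (hsound k)] at hv
    exact H.eq_of_approx hv
  · obtain ⟨N, hN⟩ := H.exists_approx n
    set k := max (max (i + 1) N) ((Finset.range N).sup fun x => φ x + 1)
    have hk1 : i < k := (le_max_left (i + 1) N).trans (le_max_left _ _)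
    have hk2 : N ≤ k := (le_max_right (i + 1) N).trans (le_max_left _ _)
    refine ⟨k, Option.bind_eq_some_iff.2 ⟨f i, getElem?_initSeg_of_lt f hk1, ?_⟩⟩
    rw [takeSome_eq_of_sound (f := fun n => f (φ n)) (hsound k)]
    refine hN _ (le_length_takeSome (by simpa using hk2) fun x hx => ?_)
    have : φ x < k := (Finset.le_sup (f := fun x => φ x + 1)
      (Finset.mem_range.2 hx)).trans (le_max_right _ _)
    rw [getElem?_initSeg_of_lt f this]; rfl

/-! ### Reducibilities without partial functions -/

/-- The partial function with domain `Q` that picks a value according to `R`. -/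
theorem exists_partialFun {Q : Set Baire} {R : Baire → Baire → Prop} (h : ∀ g ∈ Q, ∃ h, R g h) :
    ∃ Γ : Baire →. Baire, Γ.Dom = Q ∧ ∀ g, ∀ h ∈ Γ g, R g h := by
  classical
  refine ⟨fun g => ⟨g ∈ Q, fun hg => (h g hg).choose⟩, rfl, ?_⟩
  rintro g _ ⟨hg, rfl⟩
  exact (h g hg).choose_spec

theorem PFun.exists_mem_of_dom {Γ : Baire →. Baire} {Q : Set Baire} (h : Γ.Dom = Q) {g : Baire}
    (hg : g ∈ Q) : ∃ x, x ∈ Γ g := by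
  subst h; exact Part.dom_iff_mem.1 hg

theorem reduces_partialComputable {P Q : Set Baire} :
    Reduces partialComputable P Q ↔ ∃ e, ∀ g ∈ Q, ∃ h ∈ P, ComputesTo e g h := by
  constructor
  · rintro ⟨Γ, ⟨e, he⟩, H⟩
    exact ⟨e, fun g hg => let ⟨h, h1, h2⟩ := H g hg; ⟨h, h2, he g h h1⟩⟩
  · rintro ⟨e, he⟩
    obtain ⟨Γ, hΓ, H⟩ := exists_partialFun (R := fun g h => h ∈ P ∧ ComputesTo e g h) he
    exact ⟨Γ, ⟨e, fun g h hh => (H g h hh).2⟩, fun g hg =>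
      let ⟨h, hh⟩ := PFun.exists_mem_of_dom hΓ hg; ⟨h, hh, (H g h hh).1⟩⟩

theorem reduces_finitelyComputable {P Q : Set Baire} :
    Reduces finitelyComputable P Q ↔ ∃ b, ∀ g ∈ Q, ∃ h ∈ P, ∃ e < b, ComputesTo e g h := by
  constructor
  · rintro ⟨Γ, ⟨b, hb⟩, H⟩
    exact ⟨b, fun g hg => let ⟨h, h1, h2⟩ := H g hg; ⟨h, h2, hb g h h1⟩⟩
  · rintro ⟨b, hb⟩
    obtain ⟨Γ, hΓ, H⟩ := exists_partialFun (R := fun g h => h ∈ P ∧ ∃ e < b, ComputesTo e g h) hb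
    exact ⟨Γ, ⟨b, fun g h hh => (H g h hh).2⟩, fun g hg =>
      let ⟨h, hh⟩ := PFun.exists_mem_of_dom hΓ hg; ⟨h, hh, (H g h hh).1⟩⟩

theorem reduces_nonuniformlyComputable {P Q : Set Baire} :
    Reduces nonuniformlyComputable P Q ↔
      ∀ g ∈ Q, ∃ h ∈ P, TuringReducible (h : ℕ →. ℕ) (g : ℕ →. ℕ) := by
  constructor
  · rintro ⟨Γ, hΓ, H⟩ g hg
    obtain ⟨h, h1, h2⟩ := H g hg
    exact ⟨h, h2, hΓ g h h1⟩
  · intro H0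
    obtain ⟨Γ, hΓ, H⟩ := exists_partialFun
      (R := fun g h => h ∈ P ∧ TuringReducible (h : ℕ →. ℕ) (g : ℕ →. ℕ)) H0
    exact ⟨Γ, fun g h hh => (H g h hh).2, fun g hg =>
      let ⟨h, hh⟩ := PFun.exists_mem_of_dom hΓ hg; ⟨h, hh, (H g h hh).1⟩⟩

/-- The guesses of the learner `Ψ` on `g`. -/
def guesses (Ψ : List ℕ → ℕ) (g : Baire) : ℕ → ℕ := fun n => Ψ (initSeg g n)

/-- The functions that are learnable with a bounded cost, the cost of a sequence of guesses being
the number of elements of a set. -/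
def learnable (c : (ℕ → ℕ) → Set ℕ) : Set (Baire →. Baire) :=
  {Γ | ∃ Ψ : List ℕ → ℕ, Computable Ψ ∧ IdentifiedBy Γ Ψ ∧
    ∃ b : ℕ, ∀ g ∈ Γ.Dom, (c (guesses Ψ g)).encard ≤ b}

/-- The places at which a sequence changes. -/
def changes (s : ℕ → ℕ) : Set ℕ := {n | s (n + 1) ≠ s n}

/-- `Ψ` converges on `g` to an index of a functional that maps `g` into `P`. -/
def LearnsInto (Ψ : List ℕ → ℕ) (P : Set Baire) (g : Baire) : Prop :=
  ∃ h ∈ P, ∃ i, (∃ N, ∀ n ≥ N, Ψ (initSeg g n) = i) ∧ ComputesTo i g h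

theorem reduces_learnable {c : (ℕ → ℕ) → Set ℕ} {P Q : Set Baire} :
    Reduces (learnable c) P Q ↔ ∃ Ψ, Computable Ψ ∧ ∃ b : ℕ, ∀ g ∈ Q,
      (c (guesses Ψ g)).encard ≤ b ∧ LearnsInto Ψ P g := by
  constructor
  · rintro ⟨Γ, ⟨Ψ, h1, h2, b, hb⟩, H⟩
    refine ⟨Ψ, h1, b, fun g hg => ?_⟩
    obtain ⟨h, hh, hP⟩ := H g hg
    exact ⟨hb g (Part.dom_iff_mem.2 ⟨h, hh⟩), h, hP, h2 g h hh⟩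
  · rintro ⟨Ψ, h1, b, H0⟩
    obtain ⟨Γ, hΓ, H⟩ := exists_partialFun (Q := Q) (R := fun g h => h ∈ P ∧
      ∃ i, (∃ N, ∀ n ≥ N, Ψ (initSeg g n) = i) ∧ ComputesTo i g h) fun g hg => (H0 g hg).2
    exact ⟨Γ, ⟨Ψ, h1, fun g h hh => (H g h hh).2, b, fun g hg => (H0 g (hΓ ▸ hg)).1⟩,
      fun g hg => let ⟨h, hh⟩ := PFun.exists_mem_of_dom hΓ hg; ⟨h, hh, (H g h hh).1⟩⟩

/-! ### Counting in sequences -/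

/-- A finite bound on a possibly infinite set is tested on finite stages, which is all that a
computable counter can see. -/
theorem encard_setOf_le_iff {p : ℕ → Prop} [DecidablePred p] {b : ℕ} :
    {i | p i}.encard ≤ b ↔ ∀ n, ((List.range n).filter p).length ≤ b := by
  have key : ∀ n, (((List.range n).filter p).length : ℕ∞) = {i | i < n ∧ p i}.encard := by
    intro n
    rw [← List.countP_eq_length_filter]
    have : {i | i < n ∧ p i} = ((Finset.range n).filter p : Set ℕ) := by ext; simp
    rw [this, Set.encard_coe_eq_coe_finsetCard, ← Nat.count_eq_card_filter_range]
    simp [Nat.count]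
  constructor
  · intro h n
    have h1 : {i | i < n ∧ p i}.encard ≤ b := (Set.encard_le_encard fun i hi => hi.2).trans h
    rw [← key] at h1
    exact_mod_cast h1
  · intro h
    by_contra hlt
    push Not at hlt
    obtain ⟨t, ht, htc⟩ := Set.exists_subset_encard_eq (Order.add_one_le_of_lt hlt)
    have hfin : t.Finite := Set.finite_of_encard_eq_coe (k := b + 1) (by simpa using htc)
    obtain ⟨N, hN⟩ := hfin.bddAbove
    have h2 : t.encard ≤ {i | i < N + 1 ∧ p i}.encard :=
      Set.encard_le_encard fun i hi => ⟨Nat.lt_succ_of_le (hN hi), ht hi⟩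
    rw [← key, htc] at h2
    have h3 : b + 1 ≤ ((List.range (N + 1)).filter p).length := by exact_mod_cast h2
    exact absurd (h (N + 1)) (by omega)

theorem encard_biUnion_le (F : Finset ℕ) (A : ℕ → Set ℕ) (b : ℕ) (h : ∀ i, (A i).encard ≤ b) :
    (⋃ i ∈ F, A i).encard ≤ (F.card * b : ℕ) := by
  classical
  induction F using Finset.induction_on with
  | empty => simp
  | insert a F ha ih =>
    rw [Finset.set_biUnion_insert, Finset.card_insert_of_notMem ha, Nat.add_mul, Nat.one_mul,
      Nat.add_comm, Nat.cast_add]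
    exact (Set.encard_union_le _ _).trans (add_le_add (h a) ih)

/-- Every value other than `s 0` occurs for the first time right after a change. -/
theorem encard_range_le_changes (s : ℕ → ℕ) :
    (Set.range s).encard ≤ (changes s).encard + 1 := by
  classical
  have : Set.range s ⊆ (fun n => s (n + 1)) '' changes s ∪ {s 0} := by
    rintro v ⟨n, hn⟩
    have hex : ∃ n, s n = v := ⟨n, hn⟩
    have hs := Nat.find_spec hex
    rcases hk : Nat.find hex with _ | k
    · rw [hk] at hs; exact Or.inr hs.symm
    · rw [hk] at hs
      exact Or.inl ⟨k, fun h => Nat.find_min hex (m := k) (by omega) (h ▸ hs), hs⟩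
  refine (Set.encard_le_encard this).trans ((Set.encard_union_le _ _).trans ?_)
  rw [Set.encard_singleton]
  exact add_le_add (Set.encard_image_le _ _) le_rfl

/-- The places at which a value occurs for the first time. -/
def firstOccurrences (s : ℕ → ℕ) : Set ℕ := {i | ∀ j < i, s j ≠ s i}

theorem exists_mem_firstOccurrences (s : ℕ → ℕ) (n : ℕ) :
    ∃ i ≤ n, i ∈ firstOccurrences s ∧ s i = s n := by
  classical
  have hex : ∃ i, s i = s n := ⟨n, rfl⟩
  refine ⟨Nat.find hex, Nat.find_min' hex rfl, fun j hj h => ?_, Nat.find_spec hex⟩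
  exact Nat.find_min hex hj (h.trans (Nat.find_spec hex))

theorem injOn_firstOccurrences (s : ℕ → ℕ) : Set.InjOn s (firstOccurrences s) := by
  intro i hi j hj h
  rcases lt_trichotomy i j with hij | hij | hij
  · exact absurd h (hj i hij)
  · exact hij
  · exact absurd h.symm (hi j hij)

theorem encard_range_eq (s : ℕ → ℕ) : (Set.range s).encard = (firstOccurrences s).encard := by
  rw [← (injOn_firstOccurrences s).encard_image]
  congr 1
  ext v
  constructor
  · rintro ⟨n, rfl⟩
    obtain ⟨i, -, hi, h⟩ := exists_mem_firstOccurrences s n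
    exact ⟨i, hi, h⟩
  · rintro ⟨i, -, rfl⟩
    exact ⟨i, rfl⟩

/-! ### Costs of sequences of guesses -/

/-- The properties of a way to count the errors in a sequence of guesses that make the
corresponding class of learnable functions a reducibility. -/
structure IsLearningCost (c : (ℕ → ℕ) → Set ℕ) : Prop where
  const : ∀ a, (c fun _ => a).encard ≤ 1
  reparam : ∀ (s m : ℕ → ℕ), Monotone m → (c (s ∘ m)).encard ≤ (c s).encard
  -- The composition of two learners: `s` is the guess of the inner one, and `t i` is what the outer
  -- one would guess if the inner guess were `i` throughout.
  comp : ∀ b b' : ℕ, ∃ B : ℕ, ∀ (s : ℕ → ℕ) (t : ℕ → ℕ → ℕ) (κ : ℕ → ℕ → ℕ),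
    (c s).encard ≤ b → (∀ i, (c (t i)).encard ≤ b') →
      (c fun n => κ (t (s n) n) (s n)).encard ≤ B
  -- A computable counter that allows a learner to be switched to the constant guess 0 when it
  -- exceeds its bound; the switch costs at most one more.
  count : ∃ cnt : List ℕ → ℕ, Primrec cnt ∧
    (∀ s, ∀ b : ℕ, (c s).encard ≤ b → ∀ n, cnt (initSeg s n) ≤ b) ∧
    ∀ s, ∀ b : ℕ, (c fun n => if cnt (initSeg s (n + 1)) ≤ b then s n else 0).encard ≤ (b + 1 : ℕ)

theorem primrec_filter_range {α : Type*} [Primcodable α] {R : ℕ → α → Prop} [DecidableRel R]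
    (hR : PrimrecRel R) {N : α → ℕ} (hN : Primrec N) :
    Primrec fun a => (List.range (N a)).filter fun i => R i a :=
  hR.listFilter.comp (Primrec.list_range.comp hN) Primrec.id

theorem primrecPred_forall_lt {α : Type*} [Primcodable α] {R : ℕ → α → Prop}
    (hR : PrimrecRel R) {N : α → ℕ} (hN : Primrec N) :
    PrimrecPred fun a => ∀ i < N a, R i a :=
  (hR.forall_mem_list.comp (Primrec.list_range.comp hN) Primrec.id).of_eq (by simp)

theorem primrecPred_exists_lt {α : Type*} [Primcodable α] {R : ℕ → α → Prop}
    (hR : PrimrecRel R) {N : α → ℕ} (hN : Primrec N) :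
    PrimrecPred fun a => ∃ i < N a, R i a :=
  (hR.exists_mem_list.comp (Primrec.list_range.comp hN) Primrec.id).of_eq (by simp)

theorem length_filter_range_mono (p : ℕ → Prop) [DecidablePred p] {m n : ℕ} (h : m ≤ n) :
    ((List.range m).filter p).length ≤ ((List.range n).filter p).length := by
  obtain ⟨k, rfl⟩ := Nat.exists_eq_add_of_le h
  rw [List.range_add, List.filter_append, List.length_append]
  exact Nat.le_add_right _ _

/-- The initial segment of a sequence before a bound is exceeded. -/
theorem exists_cutoff {φ : ℕ → ℕ} (hφ : Monotone φ) {b : ℕ} :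
    (∀ n, φ n ≤ b) ∨ ∃ K, ∀ n, φ n ≤ b ↔ n < K := by
  classical
  by_cases h : ∀ n, φ n ≤ b
  · exact Or.inl h
  · push Not at h
    refine Or.inr ⟨Nat.find h, fun n => ⟨fun hn => ?_, fun hn => ?_⟩⟩
    · by_contra hlt
      push Not at hlt
      exact absurd ((Nat.find_spec h).trans_le (hφ hlt)) (not_lt.2 hn)
    · exact not_lt.1 (Nat.find_min h hn)

/-- For `reparam`, changes of s ∘ m select changes of s in the disjoint intervals from m n to m (n +
1). For `comp`, a change of the composite is a change of s or of t i for one of at most b + 1 values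
i of s. Cutting off creates one change, at the cutoff. -/
theorem isLearningCost_changes : IsLearningCost changes := by
  classical
  refine ⟨fun a => by simp [changes], fun s m hm => ?_, fun b b' => ⟨b + (b + 1) * b', ?_⟩, ?_⟩
  · have hex : ∀ n ∈ changes (s ∘ m), ∃ k ∈ changes s, m n ≤ k ∧ k < m (n + 1) := by
      intro n hn
      by_contra hno
      push Not at hno
      have : ∀ k, m n ≤ k → k ≤ m (n + 1) → s k = s (m n) := by
        intro k hk
        induction k, hk using Nat.le_induction with
        | base => intro _; rfl
        | succ k hk ih =>
          intro hk'
          by_contra hne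
          refine absurd (hno k (fun h => hne ?_) hk) (by omega)
          rw [h, ih (by omega)]
      exact hn (this _ (hm (Nat.le_succ n)) le_rfl)
    choose! k hk1 hk2 hk3 using hex
    refine Set.encard_le_encard_of_injOn hk1 fun i hi j hj hij => ?_
    rcases lt_trichotomy i j with h | h | h
    · have := hm (Nat.succ_le_of_lt h); have := hk3 i hi; have := hk2 j hj
      simp only [Nat.succ_eq_add_one] at *; omega
    · exact h
    · have := hm (Nat.succ_le_of_lt h); have := hk3 j hj; have := hk2 i hi
      simp only [Nat.succ_eq_add_one] at *; omega
  · intro s t κ hs ht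
    have hr : (Set.range s).encard ≤ (b + 1 : ℕ) :=
      (encard_range_le_changes s).trans (by push_cast; gcongr)
    have hfin : (Set.range s).Finite := Set.finite_of_encard_le_coe hr
    have hsub : changes (fun n => κ (t (s n) n) (s n)) ⊆
        changes s ∪ ⋃ i ∈ hfin.toFinset, changes (t i) := by
      intro n hn
      by_cases h : s (n + 1) = s n
      · refine Or.inr (Set.mem_biUnion (x := s n) (by simp) fun h' => hn ?_)
        simp only [h, h']
      · exact Or.inl h
    refine (Set.encard_le_encard hsub).trans ((Set.encard_union_le _ _).trans ?_)
    rw [Nat.cast_add]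
    refine add_le_add hs ((encard_biUnion_le _ _ _ ht).trans ?_)
    have : hfin.toFinset.card ≤ b + 1 := by
      rw [hfin.encard_eq_coe_toFinset_card] at hr; exact_mod_cast hr
    exact_mod_cast Nat.mul_le_mul_right b' this
  · let cnt : List ℕ → ℕ := fun L =>
      ((List.range (L.length - 1)).filter fun i => L.getD (i + 1) 0 ≠ L.getD i 0).length
    have hcnt : ∀ s n, cnt (initSeg s n) =
        ((List.range (n - 1)).filter fun i => s (i + 1) ≠ s i).length := by
      intro s n
      simp only [cnt, length_initSeg]
      congr 1
      refine List.filter_congr fun i hi => ?_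
      have hi : i < n - 1 := List.mem_range.1 hi
      simp [getElem?_initSeg_of_lt s (show i < n by omega),
        getElem?_initSeg_of_lt s (show i + 1 < n by omega)]
    refine ⟨cnt, ?_, ?_, ?_⟩
    · have hR : PrimrecRel fun (i : ℕ) (L : List ℕ) => L.getD (i + 1) 0 ≠ L.getD i 0 :=
        (Primrec.eq.comp ((Primrec.list_getD 0).comp Primrec.snd (Primrec.succ.comp Primrec.fst))
          ((Primrec.list_getD 0).comp Primrec.snd Primrec.fst)).not
      exact Primrec.list_length.comp (primrec_filter_range hR
        (Primrec.nat_sub.comp Primrec.list_length (Primrec.const 1)))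
    · intro s b h n
      rw [hcnt]
      exact encard_setOf_le_iff.1 h _
    · intro s b
      have hmono : Monotone fun n => cnt (initSeg s (n + 1)) := fun m n h => by
        simp only [hcnt]
        exact length_filter_range_mono _ (by omega)
      rcases exists_cutoff hmono (b := b) with h | ⟨K, hK⟩
      · simp only [h, if_true]
        refine (encard_setOf_le_iff.2 fun n => ?_ : (changes s).encard ≤ b).trans (by simp)
        simpa [hcnt] using h n
      · simp only [hK]
        have hsub : changes (fun n => if n < K then s n else 0) ⊆
            {i | i < K - 1 ∧ s (i + 1) ≠ s i} ∪ {K - 1} := by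
          intro n hn
          simp only [changes, Set.mem_ofPred_eq] at hn
          by_cases h1 : n + 1 < K
          · rw [if_pos h1, if_pos (by omega)] at hn
            exact Or.inl ⟨by omega, hn⟩
          · by_cases h2 : n < K
            · right; simp; omega
            · rw [if_neg h1, if_neg h2] at hn; exact absurd rfl hn
        refine (Set.encard_le_encard hsub).trans ((Set.encard_union_le _ _).trans ?_)
        rw [Set.encard_singleton, Nat.cast_add, Nat.cast_one]
        gcongr
        refine encard_setOf_le_iff.2 fun n => ?_
        rcases Nat.eq_zero_or_pos K with rfl | hpos
        · simp
        · have h1 := (hK (K - 1)).2 (by omega)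
          rw [hcnt, show K - 1 + 1 - 1 = K - 1 by omega] at h1
          refine le_trans ?_ h1
          have key : ∀ n, ((List.range n).filter fun i => i < K - 1 ∧ s (i + 1) ≠ s i).length ≤
              ((List.range (K - 1)).filter fun i => s (i + 1) ≠ s i).length := by
            intro n
            rw [← List.toFinset_card_of_nodup (List.nodup_range.filter _),
              ← List.toFinset_card_of_nodup (List.nodup_range.filter _)]
            refine Finset.card_le_card fun i hi => ?_
            simp only [List.mem_toFinset, List.mem_filter, List.mem_range, decide_eq_true_eq] at hi ⊢
            exact hi.2
          exact key n

/-- The places at which an entry of a list occurs for the first time. -/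
def firstOccList (L : List ℕ) : List ℕ :=
  (List.range L.length).filter fun i => ∀ j < i, L.getD j 0 ≠ L.getD i 0

theorem primrec_firstOccList : Primrec firstOccList := by
  have hR : PrimrecRel fun (j : ℕ) (p : ℕ × List ℕ) => p.2.getD j 0 ≠ p.2.getD p.1 0 :=
    (Primrec.eq.comp ((Primrec.list_getD 0).comp (Primrec.snd.comp Primrec.snd) Primrec.fst)
      ((Primrec.list_getD 0).comp (Primrec.snd.comp Primrec.snd)
        (Primrec.fst.comp Primrec.snd))).not
  have hR' : PrimrecRel fun (i : ℕ) (L : List ℕ) => ∀ j < i, L.getD j 0 ≠ L.getD i 0 :=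
    primrecPred_forall_lt hR Primrec.fst
  exact primrec_filter_range hR' Primrec.list_length

open Classical in
theorem firstOccList_initSeg (s : ℕ → ℕ) (n : ℕ) : firstOccList (initSeg s n) =
    (List.range n).filter fun i => i ∈ firstOccurrences s := by
  simp only [firstOccList, length_initSeg]
  refine List.filter_congr fun i hi => ?_
  have hi : i < n := List.mem_range.1 hi
  refine decide_eq_decide.2 (forall₂_congr fun j hj => ?_)
  simp [getElem?_initSeg_of_lt s hi, getElem?_initSeg_of_lt s (hj.trans hi)]

/-- A composite guess is determined by the inner guess i and a value of t i, hence b * b'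
possibilities. Values are counted by their first occurrences, and cutting off adds at most the value
0. -/
theorem isLearningCost_range : IsLearningCost (Set.range : (ℕ → ℕ) → Set ℕ) := by
  classical
  refine ⟨fun a => by simp, fun s m _ => Set.encard_le_encard (Set.range_comp_subset_range m s),
    fun b b' => ⟨b * b', ?_⟩, ?_⟩
  · intro s t κ hs ht
    have hfin : (Set.range s).Finite := Set.finite_of_encard_le_coe hs
    have hsub : Set.range (fun n => κ (t (s n) n) (s n)) ⊆
        ⋃ i ∈ hfin.toFinset, (fun a => κ a i) '' Set.range (t i) := by
      rintro _ ⟨n, rfl⟩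
      exact Set.mem_biUnion (x := s n) (by simp) ⟨t (s n) n, ⟨n, rfl⟩, rfl⟩
    refine (Set.encard_le_encard hsub).trans ((encard_biUnion_le _ _ b'
      fun i => (Set.encard_image_le _ _).trans (ht i)).trans ?_)
    have : hfin.toFinset.card ≤ b := by
      rw [hfin.encard_eq_coe_toFinset_card] at hs; exact_mod_cast hs
    exact_mod_cast Nat.mul_le_mul_right b' this
  · have hcnt : ∀ s n, (firstOccList (initSeg s n)).length =
        ((List.range n).filter fun i => i ∈ firstOccurrences s).length :=
      fun s n => congrArg _ (firstOccList_initSeg s n)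
    refine ⟨fun L => (firstOccList L).length, Primrec.list_length.comp primrec_firstOccList, ?_, ?_⟩
    · intro s b h n
      beta_reduce
      rw [hcnt]
      rw [encard_range_eq] at h
      exact (encard_setOf_le_iff (p := fun i => i ∈ firstOccurrences s)).1 h _
    · intro s b
      have hmono : Monotone fun n => (firstOccList (initSeg s (n + 1))).length := fun m n h => by
        simp only [hcnt]
        exact length_filter_range_mono _ (by omega)
      rcases exists_cutoff hmono (b := b) with h | ⟨K, hK⟩
      · simp only [h, if_true]
        refine (?_ : (Set.range s).encard ≤ b).trans (by simp)
        rw [encard_range_eq]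
        refine (encard_setOf_le_iff (p := fun i => i ∈ firstOccurrences s)).2 fun n => ?_
        rcases n with _ | n
        · simp
        · simpa [hcnt] using h n
      · simp only [hK]
        have hsub : Set.range (fun n => if n < K then s n else 0) ⊆
            s '' {i | i < K ∧ i ∈ firstOccurrences s} ∪ {0} := by
          rintro _ ⟨n, rfl⟩
          by_cases h : n < K
          · obtain ⟨i, hi, h1, h2⟩ := exists_mem_firstOccurrences s n
            exact Or.inl ⟨i, ⟨hi.trans_lt h, h1⟩, by simp [h, h2]⟩
          · simp [h]
        refine (Set.encard_le_encard hsub).trans ((Set.encard_union_le _ _).trans ?_)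
        rw [Set.encard_singleton, Nat.cast_add, Nat.cast_one]
        gcongr
        refine (Set.encard_image_le _ _).trans (encard_setOf_le_iff.2 fun n => ?_)
        rcases Nat.eq_zero_or_pos K with rfl | hpos
        · simp
        · have h1 := (hK (K - 1)).2 (by omega)
          rw [hcnt, show K - 1 + 1 = K by omega] at h1
          refine le_trans ?_ h1
          rw [← List.toFinset_card_of_nodup (List.nodup_range.filter _),
            ← List.toFinset_card_of_nodup (List.nodup_range.filter _)]
          refine Finset.card_le_card fun i hi => ?_
          simp only [List.mem_toFinset, List.mem_filter, List.mem_range, decide_eq_true_eq] at hi ⊢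
          exact hi.2

/-! ### Reducibilities with joins -/

/-- The join of two subsets of Baire space. -/
def joinSet (Q R : Set Baire) : Set Baire := {x | evenPart x ∈ Q ∧ oddPart x ∈ R}

theorem joinSeq_mem_joinSet {Q R : Set Baire} {f g : Baire} :
    joinSeq f g ∈ joinSet Q R ↔ f ∈ Q ∧ g ∈ R := by
  simp [joinSet]

/-- `≤_𝓕` is a preorder in which `joinSet` gives least upper bounds. -/
structure IsReducibility (𝓕 : Set (Baire →. Baire)) : Prop where
  refl : ∀ P, Reduces 𝓕 P P
  trans : ∀ {P Q R}, Reduces 𝓕 P Q → Reduces 𝓕 Q R → Reduces 𝓕 P R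
  left : ∀ Q R, Reduces 𝓕 Q (joinSet Q R)
  right : ∀ Q R, Reduces 𝓕 R (joinSet Q R)
  join : ∀ {Q R U}, Reduces 𝓕 Q U → Reduces 𝓕 R U → Reduces 𝓕 (joinSet Q R) U

theorem isReducibility_of_computable {𝓕 : Set (Baire →. Baire)}
    (h : ∀ {P Q}, Reduces partialComputable P Q → Reduces 𝓕 P Q)
    (htrans : ∀ {P Q R}, Reduces 𝓕 P Q → Reduces 𝓕 Q R → Reduces 𝓕 P R)
    (hjoin : ∀ {Q R U}, Reduces 𝓕 Q U → Reduces 𝓕 R U → Reduces 𝓕 (joinSet Q R) U) :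
    IsReducibility 𝓕 where
  refl P := by
    obtain ⟨e, he⟩ := exists_id_index
    exact h (reduces_partialComputable.2 ⟨e, fun g hg => ⟨g, hg, he g⟩⟩)
  trans := htrans
  left Q R := by
    obtain ⟨e, he⟩ := exists_evenPart_index
    exact h (reduces_partialComputable.2 ⟨e, fun g hg => ⟨_, hg.1, he g⟩⟩)
  right Q R := by
    obtain ⟨e, he⟩ := exists_oddPart_index
    exact h (reduces_partialComputable.2 ⟨e, fun g hg => ⟨_, hg.2, he g⟩⟩)
  join := hjoin

theorem isReducibility_partialComputable : IsReducibility partialComputable := by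
  refine isReducibility_of_computable id ?_ ?_
  · intro P Q R h1 h2
    rw [reduces_partialComputable] at *
    obtain ⟨κ, -, hκ⟩ := exists_comp_index
    obtain ⟨a, ha⟩ := h1
    obtain ⟨b, hb⟩ := h2
    refine ⟨κ a b, fun f hf => ?_⟩
    obtain ⟨g, hg, h1⟩ := hb f hf
    obtain ⟨h, hh, h2⟩ := ha g hg
    exact ⟨h, hh, hκ _ _ _ _ _ h1 h2⟩
  · intro Q R U h1 h2
    rw [reduces_partialComputable] at *
    obtain ⟨κ, -, hκ⟩ := exists_join_index
    obtain ⟨a, ha⟩ := h1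
    obtain ⟨b, hb⟩ := h2
    refine ⟨κ a b, fun f hf => ?_⟩
    obtain ⟨g, hg, h1⟩ := ha f hf
    obtain ⟨h, hh, h2⟩ := hb f hf
    exact ⟨_, joinSeq_mem_joinSet.2 ⟨hg, hh⟩, hκ _ _ _ _ _ h1 h2⟩

theorem exists_bound₂ (κ : ℕ → ℕ → ℕ) (b b' : ℕ) : ∃ B, ∀ i < b, ∀ j < b', κ i j < B := by
  refine ⟨((Finset.range b).sup fun i => (Finset.range b').sup fun j => κ i j) + 1,
    fun i hi j hj => Nat.lt_succ_of_le ?_⟩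
  exact (Finset.le_sup (f := fun j => κ i j) (Finset.mem_range.2 hj)).trans
    (Finset.le_sup (f := fun i => (Finset.range b').sup fun j => κ i j) (Finset.mem_range.2 hi))

theorem isReducibility_finitelyComputable : IsReducibility finitelyComputable := by
  refine isReducibility_of_computable ?_ ?_ ?_
  · intro P Q h
    rw [reduces_partialComputable] at h
    rw [reduces_finitelyComputable]
    obtain ⟨e, he⟩ := h
    exact ⟨e + 1, fun g hg => let ⟨h, h1, h2⟩ := he g hg; ⟨h, h1, e, Nat.lt_succ_self e, h2⟩⟩
  · intro P Q R h1 h2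
    rw [reduces_finitelyComputable] at *
    obtain ⟨κ, -, hκ⟩ := exists_comp_index
    obtain ⟨a, ha⟩ := h1
    obtain ⟨b, hb⟩ := h2
    obtain ⟨B, hB⟩ := exists_bound₂ κ a b
    refine ⟨B, fun f hf => ?_⟩
    obtain ⟨g, hg, j, hj, h1⟩ := hb f hf
    obtain ⟨h, hh, i, hi, h2⟩ := ha g hg
    exact ⟨h, hh, _, hB i hi j hj, hκ _ _ _ _ _ h1 h2⟩
  · intro Q R U h1 h2
    rw [reduces_finitelyComputable] at *
    obtain ⟨κ, -, hκ⟩ := exists_join_index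
    obtain ⟨a, ha⟩ := h1
    obtain ⟨b, hb⟩ := h2
    obtain ⟨B, hB⟩ := exists_bound₂ κ a b
    refine ⟨B, fun f hf => ?_⟩
    obtain ⟨g, hg, i, hi, h1⟩ := ha f hf
    obtain ⟨h, hh, j, hj, h2⟩ := hb f hf
    exact ⟨_, joinSeq_mem_joinSet.2 ⟨hg, hh⟩, _, hB i hi j hj, hκ _ _ _ _ _ h1 h2⟩

theorem computable_map_range {α β : Type*} [Primcodable α] [Primcodable β] {F : α → ℕ → β}
    (hF : Computable₂ F) {N : α → ℕ} (hN : Computable N) :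
    Computable fun a => (List.range (N a)).map (F a) := by
  have h : Computable fun a => (Nat.rec [] (fun n l => l ++ [F a n]) (N a) : List β) := by
    refine Computable.nat_rec hN (Computable.const []) (h := fun a p => p.2 ++ [F a p.1]) ?_
    exact (Computable.list_concat.comp (Computable.snd.comp Computable.snd)
      (hF.comp Computable.fst (Computable.fst.comp Computable.snd))).to₂
  refine h.of_eq fun a => ?_
  induction N a with
  | zero => rfl
  | succ n ih => rw [List.range_succ, List.map_append, ← ih]; rfl

/-- The guesses of `Ψ` along the initial segments of `σ`. -/
def guessesAlong (Ψ : List ℕ → ℕ) (σ : List ℕ) : List ℕ :=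
  (List.range (σ.length + 1)).map fun m => Ψ (σ.take m)

theorem computable_guessesAlong {Ψ : List ℕ → ℕ} (hΨ : Computable Ψ) :
    Computable (guessesAlong Ψ) := by
  have h : Computable₂ fun (σ : List ℕ) (m : ℕ) => Ψ (σ.take m) :=
    hΨ.comp (Primrec.list_take.to_comp.comp Computable.snd Computable.fst)
  exact computable_map_range h (Computable.succ.comp Computable.list_length)

theorem guessesAlong_initSeg (Ψ : List ℕ → ℕ) (g : Baire) (n : ℕ) :
    guessesAlong Ψ (initSeg g n) = initSeg (guesses Ψ g) (n + 1) := by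
  simp only [guessesAlong, length_initSeg]
  refine List.map_congr_left fun m hm => ?_
  rw [take_initSeg g (Nat.lt_succ_iff.1 (List.mem_range.1 hm))]
  rfl

/-- Every learner can be made to obey a bound on the cost, without changing it where it obeys
the bound already. -/
theorem IsLearningCost.exists_capped {c : (ℕ → ℕ) → Set ℕ} (hc : IsLearningCost c)
    {Ψ : List ℕ → ℕ} (hΨ : Computable Ψ) (b : ℕ) :
    ∃ Ψ' : List ℕ → ℕ, Computable Ψ' ∧ (∀ g, (c (guesses Ψ' g)).encard ≤ (b + 1 : ℕ)) ∧
      ∀ g, (c (guesses Ψ g)).encard ≤ b → ∀ n, Ψ' (initSeg g n) = Ψ (initSeg g n) := by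
  obtain ⟨cnt, hcnt, h1, h2⟩ := hc.count
  refine ⟨fun σ => if cnt (guessesAlong Ψ σ) ≤ b then Ψ σ else 0, ?_, fun g => ?_, fun g hg n => ?_⟩
  · have hd : Computable fun σ => decide (cnt (guessesAlong Ψ σ) ≤ b) :=
      (Primrec.nat_le.decide.to_comp.comp (hcnt.to_comp.comp (computable_guessesAlong hΨ))
        (Computable.const b))
    refine (Computable.cond hd hΨ (Computable.const 0)).of_eq fun σ => ?_
    by_cases h : cnt (guessesAlong Ψ σ) ≤ b <;> simp [h]
  · have := h2 (guesses Ψ g) b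
    simp only [← guessesAlong_initSeg] at this
    exact this
  · simp only
    rw [guessesAlong_initSeg, if_pos (h1 _ b hg _)]

theorem exists_limit_of_prefix_chain {L : ℕ → List ℕ} (hL : ∀ m n, m ≤ n → L m <+: L n) :
    ∃ g : Baire, ∀ n, L n = initSeg g (L n).length := by
  classical
  refine ⟨fun x => if h : ∃ N, x < (L N).length then ((L h.choose)[x]?).getD 0 else 0,
    fun n => ?_⟩
  apply List.ext_getElem?
  intro i
  rw [getElem?_initSeg]
  by_cases hi : i < (L n).length
  · have hex : ∃ N, i < (L N).length := ⟨n, hi⟩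
    rw [if_pos hi, dif_pos hex]
    have hs := hex.choose_spec
    have : (L hex.choose)[i]? = (L n)[i]? := by
      rcases le_total hex.choose n with h | h
      · obtain ⟨u, hu⟩ := hL _ _ h
        rw [← hu, List.getElem?_append_left hs]
      · obtain ⟨u, hu⟩ := hL _ _ h
        rw [← hu, List.getElem?_append_left hi]
    rw [this, List.getElem?_eq_getElem hi]
    rfl
  · rw [if_neg hi, List.getElem?_eq_none (by omega)]

theorem IsLearningCost.isReducibility {c : (ℕ → ℕ) → Set ℕ} (hc : IsLearningCost c) :
    IsReducibility (learnable c) := by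
  refine isReducibility_of_computable ?_ ?_ ?_
  · intro P Q h
    rw [reduces_partialComputable] at h
    rw [reduces_learnable]
    obtain ⟨e, he⟩ := h
    refine ⟨fun _ => e, Computable.const e, 1, fun g hg => ⟨?_, ?_⟩⟩
    · exact_mod_cast hc.const e
    · obtain ⟨h, hh, hh'⟩ := he g hg
      exact ⟨h, hh, e, ⟨0, fun _ _ => rfl⟩, hh'⟩
  · intro P Q R h1 h2
    rw [reduces_learnable] at *
    obtain ⟨κ, hκc, hκ⟩ := exists_comp_index
    obtain ⟨Ψ₁, hΨ₁, b₁, H₁⟩ := h1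
    obtain ⟨Ψ₂, hΨ₂, b₂, H₂⟩ := h2
    -- While the guess of Ψ₂ is still wrong, Ψ₁ is fed the output of a wrong functional, about which
    -- its hypothesis says nothing. The capped version obeys a bound on all sequences.
    obtain ⟨Ψ, hΨ, hbound, heq⟩ := hc.exists_capped hΨ₁ b₁
    obtain ⟨B, hB⟩ := hc.comp b₂ (b₁ + 1)
    refine ⟨fun σ => κ (Ψ (outPrefix (Ψ₂ σ) σ)) (Ψ₂ σ), ?_, B, fun f hf => ⟨?_, ?_⟩⟩
    · exact hκc.comp (hΨ.comp (primrec_outPrefix.to_comp.comp hΨ₂ Computable.id)) hΨ₂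
    · refine hB (guesses Ψ₂ f) (fun i n => Ψ (outPrefix i (initSeg f n))) κ (H₂ f hf).1
        fun i => ?_
      -- For fixed i the finite outputs form a chain even if Φ_i(f) is not total; any sequence
      -- through the chain serves for the bound.
      obtain ⟨g, hg⟩ := exists_limit_of_prefix_chain
        (L := fun n => outPrefix i (initSeg f n)) fun m n h => outPrefix_mono (initSeg_prefix f h)
      have hm : Monotone fun n => (outPrefix i (initSeg f n)).length := fun m n h =>
        (outPrefix_mono (initSeg_prefix f h)).length_le
      refine le_trans (le_of_eq ?_) ((hc.reparam (guesses Ψ g) _ hm).trans (hbound g))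
      congr 2
      funext n
      change Ψ _ = Ψ _
      rw [← hg n]
    · obtain ⟨g, hg, i, ⟨N, hN⟩, hi⟩ := (H₂ f hf).2
      obtain ⟨hb, h, hh, j, ⟨M, hM⟩, hj⟩ := H₁ g hg
      obtain ⟨K, hK⟩ := hi.exists_le_length_outPrefix M
      refine ⟨h, hh, κ j i, ⟨max N K, fun n hn => ?_⟩, hκ _ _ _ _ _ hi hj⟩
      beta_reduce
      rw [hN n ((le_max_left _ _).trans hn), hi.outPrefix_eq, heq g hb,
        hM _ (hK n ((le_max_right _ _).trans hn))]
  · intro Q R U h1 h2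
    rw [reduces_learnable] at *
    obtain ⟨κ, hκc, hκ⟩ := exists_join_index
    obtain ⟨Ψ₁, hΨ₁, b₁, H₁⟩ := h1
    obtain ⟨Ψ₂, hΨ₂, b₂, H₂⟩ := h2
    obtain ⟨B, hB⟩ := hc.comp b₂ b₁
    refine ⟨fun σ => κ (Ψ₁ σ) (Ψ₂ σ), hκc.comp hΨ₁ hΨ₂, B, fun f hf => ⟨?_, ?_⟩⟩
    · exact hB (guesses Ψ₂ f) (fun _ => guesses Ψ₁ f) κ (H₂ f hf).1 fun _ => (H₁ f hf).1
    · obtain ⟨g, hg, i, ⟨N, hN⟩, hi⟩ := (H₁ f hf).2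
      obtain ⟨h, hh, j, ⟨M, hM⟩, hj⟩ := (H₂ f hf).2
      refine ⟨_, joinSeq_mem_joinSet.2 ⟨hg, hh⟩, κ i j, ⟨max N M, fun n hn => ?_⟩,
        hκ _ _ _ _ _ hi hj⟩
      beta_reduce
      rw [hN n ((le_max_left _ _).trans hn), hM n ((le_max_right _ _).trans hn)]

/-! ### Comparison of the classes -/

theorem Reduces.changes_to_range {P Q : Set Baire} (h : Reduces (learnable changes) P Q) :
    Reduces (learnable Set.range) P Q := by
  rw [reduces_learnable] at *
  obtain ⟨Ψ, hΨ, b, H⟩ := h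
  refine ⟨Ψ, hΨ, b + 1, fun g hg => ⟨(encard_range_le_changes _).trans ?_, (H g hg).2⟩⟩
  push_cast
  gcongr
  exact (H g hg).1

/-- The `j`-th different guess of a learner is used as an index. -/
theorem exists_index_nth_guess {Ψ : List ℕ → ℕ} (hΨ : Computable Ψ) :
    ∃ ι : ℕ → ℕ, ∀ j f h, Approximates (fun σ n =>
      ((firstOccList (guessesAlong Ψ σ))[j]?).bind fun p => ((guessesAlong Ψ σ)[p]?).bind fun i =>
        approx i n σ) f h → ComputesTo (ι j) f h := by
  have hL : Computable fun p : ℕ × List ℕ × ℕ => guessesAlong Ψ p.2.1 :=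
    (computable_guessesAlong hΨ).comp (Computable.fst.comp Computable.snd)
  have h1 : Computable fun p : ℕ × List ℕ × ℕ => (firstOccList (guessesAlong Ψ p.2.1))[p.1]? :=
    Computable.list_getElem?.comp (primrec_firstOccList.to_comp.comp hL) Computable.fst
  have h2 : Computable fun q : (ℕ × List ℕ × ℕ) × ℕ => (guessesAlong Ψ q.1.2.1)[q.2]? :=
    Computable.list_getElem?.comp (hL.comp Computable.fst) Computable.snd
  have h3 : Computable fun q : ((ℕ × List ℕ × ℕ) × ℕ) × ℕ =>
      approx q.2 q.1.1.2.2 q.1.1.2.1 := by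
    have h4 : Primrec fun q : ((ℕ × List ℕ × ℕ) × ℕ) × ℕ => q.1.1.2 :=
      Primrec.snd.comp (Primrec.fst.comp Primrec.fst)
    exact (primrec_approx.comp (Primrec.pair Primrec.snd
      (Primrec.pair (Primrec.snd.comp h4) (Primrec.fst.comp h4)))).to_comp
  have h5 : Computable fun q : (ℕ × List ℕ × ℕ) × ℕ =>
      ((guessesAlong Ψ q.1.2.1)[q.2]?).bind fun i => approx i q.1.2.2 q.1.2.1 :=
    Computable.option_bind h2 h3.to₂
  have h6 : Computable₂ fun (p : ℕ × List ℕ × ℕ) (m : ℕ) =>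
      ((guessesAlong Ψ p.2.1)[m]?).bind fun i => approx i p.2.2 p.2.1 := h5
  have h7 := Computable.option_bind h1 h6
  obtain ⟨ι, -, hι⟩ := exists_index (A := fun j σ n =>
    ((firstOccList (guessesAlong Ψ σ))[j]?).bind fun p => ((guessesAlong Ψ σ)[p]?).bind fun i =>
      approx i n σ) h7
  exact ⟨ι, hι⟩

/-- If at most b different guesses occur, the final one is the j-th different guess for some j < b.
The functional for j waits for that guess and then follows it; which j is right may depend on the
input, as is allowed here. -/
theorem Reduces.range_to_finitely {P Q : Set Baire} (h : Reduces (learnable Set.range) P Q) :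
    Reduces finitelyComputable P Q := by
  classical
  rw [reduces_learnable] at h
  rw [reduces_finitelyComputable]
  obtain ⟨Ψ, hΨ, b, H⟩ := h
  obtain ⟨ι, hι⟩ := exists_index_nth_guess hΨ
  obtain ⟨B, hB⟩ := exists_bound₂ (fun j _ => ι j) b 1
  refine ⟨B, fun g hg => ?_⟩
  obtain ⟨hb, h, hh, i, ⟨N, hN⟩, hi⟩ := H g hg
  refine ⟨h, hh, ?_⟩
  set s := guesses Ψ g with hs
  obtain ⟨p, hpN, hp, hpi⟩ := exists_mem_firstOccurrences s N
  have hsp : s p = i := by rw [hpi]; exact hN N le_rfl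
  -- The rank of p among the first occurrences. Later guesses cannot alter the entry with rank j, so
  -- that entry is either missing or p.
  set j := ((List.range p).filter fun i => i ∈ firstOccurrences s).length with hj
  have hstable : ∀ n, p < n → ((List.range n).filter fun i => i ∈ firstOccurrences s)[j]?
      = some p := by
    intro n hn
    obtain ⟨k, rfl⟩ := Nat.exists_eq_add_of_le (Nat.succ_le_of_lt hn)
    rw [List.range_add, List.filter_append, List.range_succ, List.filter_append,
      List.append_assoc, List.getElem?_append_right (by rw [hj]), ← hj, Nat.sub_self]
    simp [hp]
  have hjb : j < b := by
    rw [encard_range_eq] at hb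
    have := (encard_setOf_le_iff (p := fun i => i ∈ firstOccurrences s)).1 hb (p + 1)
    rw [List.range_succ, List.filter_append, List.length_append] at this
    simp only [hp, decide_true, List.filter_cons_of_pos, List.filter_nil, List.length_singleton]
      at this
    omega
  refine ⟨ι j, hB j hjb 0 one_pos, hι j g h ⟨fun k n v hv => ?_, fun n => ?_⟩⟩
  · obtain ⟨q, hq, hv⟩ := Option.bind_eq_some_iff.1 hv
    obtain ⟨i', hi', hv⟩ := Option.bind_eq_some_iff.1 hv
    rw [guessesAlong_initSeg, ← hs, firstOccList_initSeg] at hq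
    rw [guessesAlong_initSeg, ← hs] at hi'
    have hqp : q = p := by
      by_cases hpk : p < k + 1
      · rw [hstable _ hpk] at hq; exact (Option.some.inj hq).symm
      · have hlen : ((List.range (k + 1)).filter fun i => i ∈ firstOccurrences s).length ≤ j :=
          length_filter_range_mono _ (by omega)
        rw [List.getElem?_eq_none hlen] at hq
        simp at hq
    subst hqp
    rw [getElem?_initSeg] at hi'
    split_ifs at hi'
    obtain rfl := Option.some.inj hi'
    rw [hsp] at hv
    exact hi.eq_of_approx hv
  · obtain ⟨M, hM⟩ := hi.exists_approx n
    refine ⟨max M p, Option.bind_eq_some_iff.2 ⟨p, ?_, Option.bind_eq_some_iff.2 ⟨i, ?_,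
      hM _ (le_max_left _ _)⟩⟩⟩
    · rw [guessesAlong_initSeg, ← hs, firstOccList_initSeg]
      exact hstable _ (Nat.lt_succ_of_le (le_max_right _ _))
    · rw [guessesAlong_initSeg, ← hs,
        getElem?_initSeg_of_lt _ (Nat.lt_succ_of_le (le_max_right _ _)), hsp]

/-! ### The order on degrees -/

section

variable {𝓕 : Set (Baire →. Baire)} {S : Set (Set Baire)}

/-- The degree of a set. -/
def degreeOf (𝓕 : Set (Baire →. Baire)) (S : Set (Set Baire)) (P : S) : Degrees 𝓕 S :=
  ⟨degreeClass 𝓕 S P, P, P.2, rfl⟩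

theorem exists_degreeOf (c : Degrees 𝓕 S) : ∃ P, c = degreeOf 𝓕 S P := by
  obtain ⟨c, P, hP, rfl⟩ := c
  exact ⟨⟨P, hP⟩, rfl⟩

theorem degreeOf_le (h𝓕 : IsReducibility 𝓕) {P Q : S} :
    degreeOf 𝓕 S P ≤ degreeOf 𝓕 S Q ↔ Reduces 𝓕 P Q := by
  constructor
  · rintro ⟨P', hP', Q', hQ', h⟩
    exact h𝓕.trans hP'.2.1 (h𝓕.trans h hQ'.2.2)
  · intro h
    exact ⟨P, ⟨P.2, h𝓕.refl _, h𝓕.refl _⟩, Q, ⟨Q.2, h𝓕.refl _, h𝓕.refl _⟩, h⟩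

theorem isLUB_degreeOf (h𝓕 : IsReducibility 𝓕) {Q R J : S} (hJ : (J : Set Baire) = joinSet Q R) :
    IsLUB {degreeOf 𝓕 S Q, degreeOf 𝓕 S R} (degreeOf 𝓕 S J) := by
  constructor
  · rintro c (rfl | rfl)
    · exact (degreeOf_le h𝓕).2 (hJ ▸ h𝓕.left _ _)
    · exact (degreeOf_le h𝓕).2 (hJ ▸ h𝓕.right _ _)
  · intro c hc
    obtain ⟨U, rfl⟩ := exists_degreeOf c
    refine (degreeOf_le h𝓕).2 (hJ ▸ h𝓕.join ?_ ?_)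
    · exact (degreeOf_le h𝓕).1 (hc (Or.inl rfl))
    · exact (degreeOf_le h𝓕).1 (hc (Or.inr rfl))

theorem leJoin_degreeOf (h𝓕 : IsReducibility 𝓕)
    (hS : ∀ Q ∈ S, ∀ R ∈ S, joinSet Q R ∈ S) {P Q R : S} :
    LEJoin (degreeOf 𝓕 S P) (degreeOf 𝓕 S Q) (degreeOf 𝓕 S R) ↔
      Reduces 𝓕 P (joinSet Q R) := by
  have hlub := isLUB_degreeOf (J := ⟨_, hS Q Q.2 R R.2⟩) h𝓕 rfl
  constructor
  · rintro ⟨u, hu, hle⟩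
    obtain ⟨U, rfl⟩ := exists_degreeOf u
    exact h𝓕.trans ((degreeOf_le h𝓕).1 hle) ((degreeOf_le h𝓕).1 (hu.2 hlub.1))
  · intro h
    exact ⟨_, hlub, (degreeOf_le h𝓕).2 h⟩

theorem isBrouwerian_degrees_iff (h𝓕 : IsReducibility 𝓕)
    (hS : ∀ Q ∈ S, ∀ R ∈ S, joinSet Q R ∈ S) :
    IsBrouwerian (Degrees 𝓕 S) ↔ ∀ P ∈ S, ∀ Q ∈ S, ∃ R ∈ S, Reduces 𝓕 P (joinSet Q R) ∧
      ∀ R' ∈ S, Reduces 𝓕 P (joinSet Q R') → Reduces 𝓕 R R' := by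
  constructor
  · intro h P hP Q hQ
    obtain ⟨r, hr, hmin⟩ := h (degreeOf 𝓕 S ⟨P, hP⟩) (degreeOf 𝓕 S ⟨Q, hQ⟩)
    obtain ⟨R, rfl⟩ := exists_degreeOf r
    refine ⟨R, R.2, (leJoin_degreeOf h𝓕 hS).1 hr, fun R' hR' h' => ?_⟩
    exact (degreeOf_le (Q := ⟨R', hR'⟩) h𝓕).1
      (hmin ((leJoin_degreeOf (R := ⟨R', hR'⟩) h𝓕 hS).2 h'))
  · intro h p q
    obtain ⟨P, rfl⟩ := exists_degreeOf p
    obtain ⟨Q, rfl⟩ := exists_degreeOf q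
    obtain ⟨R, hR, h1, h2⟩ := h P P.2 Q Q.2
    refine ⟨degreeOf 𝓕 S ⟨R, hR⟩, (leJoin_degreeOf h𝓕 hS).2 h1, fun r hr => ?_⟩
    obtain ⟨R', rfl⟩ := exists_degreeOf r
    exact (degreeOf_le h𝓕).2 (h2 R' R'.2 ((leJoin_degreeOf h𝓕 hS).1 hr))

end

/-! ### The Medvedev degrees and the Muchnik degrees are Brouwerian -/

/-- The sequence `c, f 0, f 1, …`. -/
def consSeq (c : ℕ) (f : Baire) : Baire := fun n => if n = 0 then c else f (n - 1)

theorem exists_cons_index (c : ℕ) : ∃ e, ∀ f, ComputesTo e f (consSeq c f) := by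
  obtain ⟨e, he⟩ := exists_index_const (A := fun σ n => if n = 0 then some c else σ[n - 1]?)
    (Primrec.to_comp (Primrec.ite (Primrec.eq.comp Primrec.snd (Primrec.const 0))
      (Primrec.const _) (Primrec.list_getElem?.comp Primrec.fst
        (Primrec.pred.comp Primrec.snd))))
  refine ⟨e, fun f => he _ _ ⟨fun k n v hv => ?_, fun n => ⟨n, ?_⟩⟩⟩
  · unfold consSeq
    split_ifs at hv ⊢ with h
    · exact (Option.some.inj hv).symm
    · rw [getElem?_initSeg] at hv
      split_ifs at hv
      exact (Option.some.inj hv).symm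
  · unfold consSeq
    split_ifs with h
    · rfl
    · exact getElem?_initSeg_of_lt f (by omega)

/-- The residual consists of an index followed by an oracle that, joined with any element of Q, is
mapped into P by that index. Storing the index in the oracle makes one functional work throughout,
and a fixed reduction from R' is turned into an element of the residual by prepending its index. -/
theorem isBrouwerian_medvedevDegrees : IsBrouwerian MedvedevDegrees := by
  refine (isBrouwerian_degrees_iff (S := Set.univ) isReducibility_partialComputable
    fun _ _ _ _ => trivial).2 ?_
  intro P _ Q _
  refine ⟨{x | ∀ f ∈ Q, ∃ h ∈ P, ComputesTo (x 0) (joinSeq f fun n => x (n + 1)) h}, trivial,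
    ?_, fun R' _ h' => ?_⟩
  -- The index sits at place 1 of F, the first odd place. This substitution removes it, shifting the
  -- odd part by one and leaving the even part alone.
  · have hφ : Primrec fun i : ℕ => if i % 2 = 0 then i else i + 2 :=
      Primrec.ite (Primrec.eq.comp (Primrec.nat_mod.comp Primrec.id (Primrec.const 2))
        (Primrec.const 0)) Primrec.id (Primrec.nat_add.comp Primrec.id (Primrec.const 2))
    obtain ⟨e, he⟩ := exists_eval_index hφ 1
    refine reduces_partialComputable.2 ⟨e, fun F hF => ?_⟩
    obtain ⟨h, hh, H⟩ := hF.2 _ hF.1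
    refine ⟨h, hh, he F h ?_⟩
    have heq : (fun i => F (if i % 2 = 0 then i else i + 2)) =
        joinSeq (evenPart F) fun n => oddPart F (n + 1) := by
      funext i
      unfold joinSeq evenPart oddPart
      split_ifs with h0
      · congr 1; omega
      · congr 1; omega
    rw [heq]
    exact H
  · rw [reduces_partialComputable] at h' ⊢
    obtain ⟨e, he⟩ := h'
    obtain ⟨e', he'⟩ := exists_cons_index e
    refine ⟨e', fun g hg => ⟨consSeq e g, fun f hf => ?_, he' g⟩⟩
    obtain ⟨h, hh, H⟩ := he (joinSeq f g) (joinSeq_mem_joinSet.2 ⟨hf, hg⟩)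
    refine ⟨h, hh, ?_⟩
    simpa [consSeq] using H

theorem turingReducible_comp {f : ℕ → ℕ} (hf : Primrec f) (g : Baire) :
    TuringReducible ((fun n => g (f n) : Baire) : ℕ →. ℕ) (g : ℕ →. ℕ) := by
  rw [TuringReducible, RecursiveIn.iff_nat]
  exact ((Nat.RecursiveIn.oracle (O := {(g : ℕ →. ℕ)}) _ rfl).comp
    ((Primrec.nat_iff.1 hf).recursiveIn)).of_eq fun n => Part.bind_some _ _

theorem turingReducible_joinSeq {f g h : Baire} (hf : TuringReducible (f : ℕ →. ℕ) (h : ℕ →. ℕ))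
    (hg : TuringReducible (g : ℕ →. ℕ) (h : ℕ →. ℕ)) :
    TuringReducible (joinSeq f g : ℕ →. ℕ) (h : ℕ →. ℕ) := by
  rw [TuringReducible, RecursiveIn.iff_nat] at *
  have hhalf : Primrec fun n : ℕ => n / 2 := Primrec.nat_div.comp Primrec.id (Primrec.const 2)
  have hid : Nat.RecursiveIn {(h : ℕ →. ℕ)} ((fun n => n : ℕ → ℕ) : ℕ →. ℕ) :=
    (Primrec.nat_iff.1 Primrec.id).recursiveIn
  have hsel : Primrec fun p : ℕ => if p.unpair.2.unpair.2 % 2 = 0 then p.unpair.1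
      else p.unpair.2.unpair.1 := by
    have h2 : Primrec fun p : ℕ => p.unpair.2.unpair := Primrec.unpair.comp
      (Primrec.snd.comp Primrec.unpair)
    exact Primrec.ite (Primrec.eq.comp (Primrec.nat_mod.comp (Primrec.snd.comp h2)
      (Primrec.const 2)) (Primrec.const 0)) (Primrec.fst.comp Primrec.unpair) (Primrec.fst.comp h2)
  have h1 : Nat.RecursiveIn {(h : ℕ →. ℕ)} fun n => Part.some (f (n / 2)) :=
    (hf.comp (Primrec.nat_iff.1 hhalf).recursiveIn).of_eq fun n => Part.bind_some _ _
  have h2 : Nat.RecursiveIn {(h : ℕ →. ℕ)} fun n => Part.some (g (n / 2)) :=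
    (hg.comp (Primrec.nat_iff.1 hhalf).recursiveIn).of_eq fun n => Part.bind_some _ _
  refine (((Primrec.nat_iff.1 hsel).recursiveIn).comp (h1.pair (h2.pair hid))).of_eq fun n => ?_
  simp [Seq.seq, joinSeq]

theorem isReducibility_nonuniformlyComputable : IsReducibility nonuniformlyComputable where
  refl P := reduces_nonuniformlyComputable.2 fun g hg => ⟨g, hg, TuringReducible.refl _⟩
  trans h1 h2 := by
    rw [reduces_nonuniformlyComputable] at *
    intro f hf
    obtain ⟨g, hg, h3⟩ := h2 f hf
    obtain ⟨h, hh, h4⟩ := h1 g hg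
    exact ⟨h, hh, h4.trans h3⟩
  left Q R := reduces_nonuniformlyComputable.2 fun g hg =>
    ⟨_, hg.1, turingReducible_comp primrec_double g⟩
  right Q R := reduces_nonuniformlyComputable.2 fun g hg =>
    ⟨_, hg.2, turingReducible_comp (Primrec.succ.comp primrec_double) g⟩
  join h1 h2 := by
    rw [reduces_nonuniformlyComputable] at *
    intro f hf
    obtain ⟨g, hg, h3⟩ := h1 f hf
    obtain ⟨h, hh, h4⟩ := h2 f hf
    exact ⟨_, joinSeq_mem_joinSet.2 ⟨hg, hh⟩, turingReducible_joinSeq h3 h4⟩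

/-- Without uniformity no index has to be stored: elements of R' belong to the residual as they are.
-/
theorem isBrouwerian_muchnikDegrees : IsBrouwerian MuchnikDegrees := by
  refine (isBrouwerian_degrees_iff (S := Set.univ) isReducibility_nonuniformlyComputable
    fun _ _ _ _ => trivial).2 ?_
  intro P _ Q _
  refine ⟨{x | ∀ f ∈ Q, ∃ h ∈ P, TuringReducible (h : ℕ →. ℕ) (joinSeq f x : ℕ →. ℕ)}, trivial,
    ?_, fun R' _ h' => ?_⟩
  · refine reduces_nonuniformlyComputable.2 fun F hF => ?_
    obtain ⟨h, hh, H⟩ := hF.2 _ hF.1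
    rw [joinSeq_evenPart_oddPart] at H
    exact ⟨h, hh, H⟩
  · rw [reduces_nonuniformlyComputable] at h' ⊢
    refine fun g hg => ⟨g, fun f hf => ?_, TuringReducible.refl _⟩
    exact h' (joinSeq f g) (joinSeq_mem_joinSet.2 ⟨hf, hg⟩)

/-! ### Being Brouwerian is a first-order property -/

open FirstOrder FirstOrder.Language in
/-- The first-order sentence that expresses that an order is Brouwerian. -/
def brouwerianSentence : Language.order.Sentence :=
  -- The variables 0, 1, 2 are p, q, r. In the first conjunct 3 is the join of q and r, with 4
  -- ranging over upper bounds; in the second, 3 is a competitor of r, 4 is its join with q, and 5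
  -- ranges over upper bounds.
  ∀' ∀' ∃' (
    (∃' (((&1).le &3 ⊓ (&2).le &3) ⊓ (∀' (((&1).le &4 ⊓ (&2).le &4) ⟹ (&3).le &4)) ⊓
      (&0).le &3)) ⊓
    (∀' ((∃' (((&1).le &4 ⊓ (&3).le &4) ⊓ (∀' (((&1).le &5 ⊓ (&3).le &5) ⟹ (&4).le &5)) ⊓
      (&0).le &4)) ⟹ (&2).le &3)))

open FirstOrder FirstOrder.Language in
theorem realize_brouwerianSentence (M : Type*) [LE M] [Language.order.Structure M]
    [Language.order.OrderedStructure M] : M ⊨ brouwerianSentence ↔ IsBrouwerian M := by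
  simp only [brouwerianSentence, Sentence.Realize, Formula.Realize, BoundedFormula.realize_all,
    BoundedFormula.realize_ex, BoundedFormula.realize_inf, BoundedFormula.realize_imp,
    Term.realize_le, IsBrouwerian, IsLeast, LEJoin, IsLUB, upperBounds, lowerBounds]
  simp [Fin.snoc, and_assoc]

open FirstOrder FirstOrder.Language in
theorem IsBrouwerian.of_elementarilyEquivalent {M N : Type*} [LE M] [LE N]
    [Language.order.Structure M] [Language.order.Structure N]
    [Language.order.OrderedStructure M] [Language.order.OrderedStructure N]
    (h : M ≅[Language.order] N) (hN : IsBrouwerian N) : IsBrouwerian M := by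
  rw [← realize_brouwerianSentence] at hN ⊢
  exact (elementarilyEquivalent_iff.1 h _).2 hN

instance (𝓕 : Set (Baire →. Baire)) (S : Set (Set Baire)) :
    FirstOrder.Language.order.OrderedStructure (Degrees 𝓕 S) := ⟨fun _ => Iff.rfl⟩

/-! ### Joins of `Π⁰₁` sets -/

theorem evenPart_initSeg (f : Baire) (n : ℕ) :
    (List.range ((initSeg f n).length / 2)).map (fun i => (initSeg f n).getD (2 * i) 0) =
      initSeg (evenPart f) (n / 2) := by
  rw [length_initSeg]
  refine List.map_congr_left fun i hi => ?_
  have := List.mem_range.1 hi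
  rw [List.getD_eq_getElem?_getD, getElem?_initSeg_of_lt f (by omega)]
  rfl

theorem oddPart_initSeg (f : Baire) (n : ℕ) :
    (List.range ((initSeg f n).length / 2)).map (fun i => (initSeg f n).getD (2 * i + 1) 0) =
      initSeg (oddPart f) (n / 2) := by
  rw [length_initSeg]
  refine List.map_congr_left fun i hi => ?_
  have := List.mem_range.1 hi
  rw [List.getD_eq_getElem?_getD, getElem?_initSeg_of_lt f (by omega)]
  rfl

theorem primrec_map_getD_half {φ : ℕ → ℕ} (hφ : Primrec φ) :
    Primrec fun σ : List ℕ => (List.range (σ.length / 2)).map fun i => σ.getD (φ i) 0 :=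
  Primrec.list_map (Primrec.list_range.comp
    (Primrec.nat_div.comp Primrec.list_length (Primrec.const 2)))
    ((Primrec.list_getD 0).comp Primrec.fst (hφ.comp Primrec.snd)).to₂

theorem joinSet_mem_pi01Sets : ∀ Q ∈ pi01Sets, ∀ R ∈ pi01Sets, joinSet Q R ∈ pi01Sets := by
  rintro Q ⟨⟨f, hf⟩, T, hT, rfl⟩ R ⟨⟨g, hg⟩, U, hU, rfl⟩
  refine ⟨⟨joinSeq f g, joinSeq_mem_joinSet.2 ⟨hf, hg⟩⟩,
    fun σ => T ((List.range (σ.length / 2)).map fun i => σ.getD (2 * i) 0) ∧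
      U ((List.range (σ.length / 2)).map fun i => σ.getD (2 * i + 1) 0), ?_, ?_⟩
  · obtain ⟨t, ht, rfl⟩ := ComputablePred.computable_iff.1 hT
    obtain ⟨u, hu, rfl⟩ := ComputablePred.computable_iff.1 hU
    have h1 := ht.comp (primrec_map_getD_half primrec_double).to_comp
    have h2 := hu.comp (primrec_map_getD_half (Primrec.succ.comp primrec_double)).to_comp
    refine ComputablePred.computable_iff.2 ⟨_, (Primrec.and.to_comp.comp h1 h2), ?_⟩
    funext σ
    simp
  · ext x
    simp only [joinSet, Set.mem_ofPred_eq, evenPart_initSeg, oddPart_initSeg]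
    constructor
    · rintro ⟨⟨h1, h2⟩, h3, h4⟩
      refine ⟨fun n => ?_, fun n => ⟨h2 _, h4 _⟩⟩
      rcases Nat.even_or_odd' n with ⟨k, rfl | rfl⟩
      · exact h1 k
      · exact h3 k
    · rintro ⟨h1, h2⟩
      refine ⟨⟨fun n => h1 _, fun n => ?_⟩, fun n => h1 _, fun n => ?_⟩
      · have := (h2 (2 * n)).1
        rwa [Nat.mul_div_cancel_left _ two_pos] at this
      · have := (h2 (2 * n)).2
        rwa [Nat.mul_div_cancel_left _ two_pos] at this

/-! ### Bushy trees -/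

/-- There is a finite tree above `σ` with leaves in `A`, in which every node of length `x` that is
not a leaf has at least `β x` children, obtained by appending letters below `α x`. -/
inductive Big (α β : ℕ → ℕ) (A : Set (List ℕ)) : List ℕ → Prop
  | base {σ : List ℕ} : σ ∈ A → Big α β A σ
  | step {σ : List ℕ} (S : Finset ℕ) : (∀ v ∈ S, v < α σ.length) → β σ.length ≤ S.card →
      (∀ v ∈ S, Big α β A (σ ++ [v])) → Big α β A σ

/-- The letter of `σ` at position `i` is less than `α i`, for every `i`. -/
def LettersBelow (α : ℕ → ℕ) (σ : List ℕ) : Prop :=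
  ∀ i v, σ[i]? = some v → v < α i

theorem getElem?_concat_eq_some {σ : List ℕ} {v i w : ℕ} (h : (σ ++ [v])[i]? = some w) :
    σ[i]? = some w ∨ i = σ.length ∧ w = v := by
  rw [List.getElem?_append] at h
  split_ifs at h with hi
  · exact .inl h
  · rw [List.getElem?_singleton] at h
    split_ifs at h with h0
    exact .inr ⟨by omega, (Option.some.inj h).symm⟩

theorem LettersBelow.append {α : ℕ → ℕ} {σ : List ℕ} (h : LettersBelow α σ) {v : ℕ}
    (hv : v < α σ.length) : LettersBelow α (σ ++ [v]) := by
  intro i w hw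
  rcases getElem?_concat_eq_some hw with hw | ⟨rfl, rfl⟩
  · exact h i w hw
  · exact hv

theorem lettersBelow_initSeg {α f : ℕ → ℕ} (h : ∀ x, f x < α x) (n : ℕ) :
    LettersBelow α (initSeg f n) := by
  intro i v hv
  rw [getElem?_initSeg] at hv
  split_ifs at hv
  exact Option.some.inj hv ▸ h i

/-! ### Combinatorics of big sets: pigeonhole, selection of nodes and paths, compactness,
certificates -/

namespace Big

variable {α β β' : ℕ → ℕ} {A M : Set (List ℕ)} {σ : List ℕ}

theorem mono {A' : Set (List ℕ)} (h : Big α β A σ) (hA : A ⊆ A')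
    (hβ : ∀ x ≥ σ.length, β' x ≤ β x) : Big α β' A' σ := by
  induction h with
  | base h => exact .base (hA h)
  | @step σ S h1 h2 _ ih =>
    refine .step S h1 ((hβ _ le_rfl).trans h2) fun v hv => ih v hv fun x hx => hβ x ?_
    rw [List.length_append] at hx
    omega

theorem not_empty (hβ : ∀ x, 0 < β x) : ¬ Big α β ∅ σ := by
  intro h
  induction h with
  | base h => exact h
  | @step σ S h1 h2 _ ih =>
    obtain ⟨v, hv⟩ := Finset.card_pos.1 ((hβ σ.length).trans_le h2)
    exact ih v hv

/-- Colour nodes by some w for which `A w` is big there, from the leaves downwards. At each node the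
pigeonhole principle leaves at least β' children of one colour. -/
theorem exists_of_biUnion {ι : Type*} [DecidableEq ι] {W : Finset ι} {A : ι → Set (List ℕ)}
    (h : Big α β (⋃ w ∈ W, A w) σ) (hβ : ∀ x ≥ σ.length, W.card * (β' x - 1) < β x) :
    ∃ w ∈ W, Big α β' (A w) σ := by
  induction h with
  | base h =>
    obtain ⟨w, hw, h⟩ := Set.mem_iUnion₂.1 h
    exact ⟨w, hw, .base h⟩
  | @step σ S h1 h2 _ ih =>
    have ih' : ∀ v : S, ∃ w ∈ W, Big α β' (A w) (σ ++ [v.1]) := fun v =>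
      ih v.1 v.2 fun x hx => hβ x (by rw [List.length_append] at hx; omega)
    choose c hc hbig using ih'
    obtain ⟨w, hw, hcard⟩ := Finset.exists_lt_card_fiber_of_mul_lt_card_of_maps_to
      (s := S.attach) (t := W) (f := c) (n := β' σ.length - 1) (fun v _ => hc v)
      (by rw [Finset.card_attach]; exact (hβ _ le_rfl).trans_le h2)
    refine ⟨w, hw, .step ((S.attach.filter fun v => c v = w).map ⟨_, Subtype.val_injective⟩)
      ?_ ?_ ?_⟩
    · intro v hv
      obtain ⟨u, _, rfl⟩ := Finset.mem_map.1 hv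
      exact h1 _ u.2
    · rw [Finset.card_map]
      omega
    · intro v hv
      obtain ⟨u, hu, rfl⟩ := Finset.mem_map.1 hv
      obtain rfl := (Finset.mem_filter.1 hu).2
      exact hbig u

theorem or_of_union {A' : Set (List ℕ)} (h : Big α β (A ∪ A') σ)
    (hβ : ∀ x ≥ σ.length, 2 * (β' x - 1) < β x) : Big α β' A σ ∨ Big α β' A' σ := by
  obtain ⟨w, -, hw⟩ := exists_of_biUnion (W := (Finset.univ : Finset Bool))
    (A := fun w => cond w A A') (β' := β') (σ := σ) (α := α) (β := β)
    (h.mono (by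
      rintro τ (hτ | hτ)
      · exact Set.mem_iUnion₂.2 ⟨true, Finset.mem_univ _, hτ⟩
      · exact Set.mem_iUnion₂.2 ⟨false, Finset.mem_univ _, hτ⟩) fun _ _ => le_rfl)
    (by simpa using hβ)
  cases w
  · exact .inr hw
  · exact .inl hw

/-- Climb the tree that shows M to be big, keeping A not big: if A were big at all children in S,
then S itself would show that A is big at the node. -/
theorem exists_mem_not (h : Big α β M σ) (hA : ¬ Big α β A σ) (hσ : LettersBelow α σ) :
    ∃ τ ∈ M, σ <+: τ ∧ LettersBelow α τ ∧ ¬ Big α β A τ := by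
  induction h with
  | @base σ h => exact ⟨σ, h, List.prefix_rfl, hσ, hA⟩
  | @step σ S h1 h2 _ ih =>
    obtain ⟨v, hv, hvA⟩ : ∃ v ∈ S, ¬ Big α β A (σ ++ [v]) := by
      by_contra! H
      exact hA (.step S h1 h2 H)
    obtain ⟨τ, hτ, hpre, h3, h4⟩ := ih v hv hvA (hσ.append (h1 v hv))
    exact ⟨τ, hτ, (List.prefix_append _ _).trans hpre, h3, h4⟩

/-- As β ≤ α, the set of all allowed letters counts as many children; so a node at which A is not
big has an allowed child with the same property. Repeating this gives the path. -/
theorem exists_path (hA : ¬ Big α β A σ) (hσ : LettersBelow α σ)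
    (hβ : ∀ x ≥ σ.length, β x ≤ α x) :
    ∃ f : Baire, initSeg f σ.length = σ ∧ (∀ x, f x < α x) ∧
      ∀ m ≥ σ.length, ¬ Big α β A (initSeg f m) := by
  have hchild : ∀ τ : {τ // σ <+: τ ∧ LettersBelow α τ ∧ ¬ Big α β A τ},
      ∃ v, LettersBelow α (τ.1 ++ [v]) ∧ ¬ Big α β A (τ.1 ++ [v]) := by
    rintro ⟨τ, h1, h2, h3⟩
    by_contra! H
    refine h3 (.step (Finset.range (α τ.length)) (fun v hv => Finset.mem_range.1 hv) ?_
      fun v hv => H v (h2.append (Finset.mem_range.1 hv)))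
    rw [Finset.card_range]
    exact hβ _ h1.length_le
  choose c hc using hchild
  obtain ⟨L, hL0, hL⟩ : ∃ L : ℕ → {τ // σ <+: τ ∧ LettersBelow α τ ∧ ¬Big α β A τ},
      (L 0).1 = σ ∧ ∀ n, (L (n + 1)).1 = (L n).1 ++ [c (L n)] :=
    ⟨fun n => Nat.rec ⟨σ, List.prefix_rfl, hσ, hA⟩ (fun _ τ => ⟨τ.1 ++ [c τ],
      τ.2.1.trans (List.prefix_append _ _), hc τ⟩) n, rfl, fun _ => rfl⟩
  have hlen : ∀ n, (L n).1.length = σ.length + n := by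
    intro n
    induction n with
    | zero => rw [hL0]; rfl
    | succ n ih => rw [hL, List.length_append, ih]; rfl
  have hchain : ∀ m n, m ≤ n → (L m).1 <+: (L n).1 := by
    intro m n h
    induction n, h using Nat.le_induction with
    | base => exact List.prefix_rfl
    | succ n _ ih => exact ih.trans (hL n ▸ List.prefix_append _ _)
  obtain ⟨f, hf⟩ := exists_limit_of_prefix_chain hchain
  refine ⟨f, ?_, fun x => ?_, fun m hm => ?_⟩
  · have := hf 0
    rw [hlen 0, hL0] at this
    exact this.symm
  · have := (L (x + 1)).2.2.1 x (f x)
    rw [hf (x + 1), getElem?_initSeg_of_lt _ (by rw [hlen]; omega)] at this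
    exact this rfl
  · have h1 := (L (m - σ.length)).2.2.2
    rw [hf (m - σ.length), hlen, Nat.add_sub_cancel' hm] at h1
    exact h1

/-- The strings with a letter that is marked as dead. -/
def deadStrings (dead : ℕ → ℕ → Prop) : Set (List ℕ) :=
  {τ | ∃ x v, τ[x]? = some v ∧ dead x v}

/-- If σ has no dead letter, then in the induction step every new letter in S must be dead, and
fewer than β letters are. -/
theorem mem_deadStrings {dead : ℕ → ℕ → Prop} (h : Big α β (deadStrings dead) σ)
    (hd : ∀ x ≥ σ.length, ∀ S : Finset ℕ, (∀ v ∈ S, v < α x ∧ dead x v) → S.card < β x) :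
    σ ∈ deadStrings dead := by
  induction h with
  | base h => exact h
  | @step σ S h1 h2 _ ih =>
    by_contra hσ
    refine absurd h2 (not_le.2 (hd _ le_rfl S fun v hv => ⟨h1 v hv, ?_⟩))
    obtain ⟨x, w, hx, hw⟩ := ih v hv fun x hx => hd x (by rw [List.length_append] at hx; omega)
    rcases getElem?_concat_eq_some hx with hx | ⟨rfl, rfl⟩
    · exact absurd ⟨x, w, hx, hw⟩ hσ
    · exact hw

/-- Compactness: the witnessing tree has finitely many leaves, and the sets increase. -/
theorem exists_of_iUnion {A : ℕ → Set (List ℕ)} (hA : Monotone A) (h : Big α β (⋃ m, A m) σ) :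
    ∃ m, Big α β (A m) σ := by
  induction h with
  | base h =>
    obtain ⟨m, h⟩ := Set.mem_iUnion.1 h
    exact ⟨m, .base h⟩
  | @step σ S h1 h2 _ ih =>
    choose! m hm using ih
    refine ⟨S.sup m, .step S h1 h2 fun v hv => (hm v hv).mono (hA (Finset.le_sup hv)) ?_⟩
    exact fun _ _ => le_rfl

/-- Certificates for `Big`: a finite set of strings in which every string is either in `A` or has
sufficiently many children. -/
theorem iff_exists_list {chk : List ℕ → ℕ → Prop} :
    Big α β {τ | ∃ C, chk τ C} σ ↔ ∃ L : List (List ℕ × ℕ), (∃ p ∈ L, p.1 = σ) ∧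
      ∀ p ∈ L, chk p.1 p.2 ∨ ∃ S : Finset ℕ, (∀ v ∈ S, v < α p.1.length) ∧
        β p.1.length ≤ S.card ∧ ∀ v ∈ S, ∃ q ∈ L, q.1 = p.1 ++ [v] := by
  constructor
  · intro h
    induction h with
    | @base σ h =>
      obtain ⟨C, hC⟩ := h
      exact ⟨[(σ, C)], ⟨_, List.mem_singleton_self _, rfl⟩, by simpa using .inl hC⟩
    | @step σ S h1 h2 _ ih =>
      choose! L hL1 hL2 using ih
      refine ⟨(σ, 0) :: S.toList.flatMap L, ⟨_, List.mem_cons_self, rfl⟩, fun p hp => ?_⟩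
      have hsub : ∀ v ∈ S, L v ⊆ (σ, 0) :: S.toList.flatMap L := fun v hv q hq =>
        List.mem_cons_of_mem _ (List.mem_flatMap.2 ⟨v, Finset.mem_toList.2 hv, hq⟩)
      rcases List.mem_cons.1 hp with rfl | hp
      · refine .inr ⟨S, h1, h2, fun v hv => ?_⟩
        obtain ⟨q, hq, e⟩ := hL1 v hv
        exact ⟨q, hsub v hv hq, e⟩
      · obtain ⟨v, hv, hp⟩ := List.mem_flatMap.1 hp
        rw [Finset.mem_toList] at hv
        refine (hL2 v hv p hp).imp_right ?_
        rintro ⟨S', h3, h4, h5⟩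
        refine ⟨S', h3, h4, fun u hu => ?_⟩
        obtain ⟨q, hq, e⟩ := h5 u hu
        exact ⟨q, hsub v hv hq, e⟩
  · rintro ⟨L, ⟨p, hp, rfl⟩, hL⟩
    obtain ⟨N, hN⟩ : ∃ N, ∀ q ∈ L, q.1.length ≤ N :=
      ⟨(L.map fun q => q.1.length).sum, fun q hq =>
        List.single_le_sum (fun _ _ => Nat.zero_le _) _ (List.mem_map_of_mem hq)⟩
    -- Induction from the longest strings downwards: children are longer, and N bounds all lengths
    -- in the list.
    have H : ∀ m, ∀ q ∈ L, N < q.1.length + m → Big α β {τ | ∃ C, chk τ C} q.1 := by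
      intro m
      induction m with
      | zero => exact fun q hq h => absurd (hN q hq) (by omega)
      | succ m ih =>
        intro q hq h
        rcases hL q hq with h1 | ⟨S, h1, h2, h3⟩
        · exact .base ⟨_, h1⟩
        · refine .step S h1 h2 fun v hv => ?_
          obtain ⟨q', hq', e⟩ := h3 v hv
          rw [← e]
          exact ih q' hq' (by rw [e, List.length_append, List.length_singleton]; omega)
    exact H (N + 1) p hp (by omega)

end Big

/-! ### Semidecidable predicates -/

/-- The predicate `R` is the projection of a primitive recursive relation. -/
def IsSigma1 {γ : Type*} [Primcodable γ] (R : γ → Prop) : Prop :=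
  ∃ chk : γ → ℕ → Prop, PrimrecRel chk ∧ ∀ x, R x ↔ ∃ C, chk x C

namespace IsSigma1

variable {γ δ : Type*} [Primcodable γ] [Primcodable δ]

theorem of_primrecPred {R : γ → Prop} (h : PrimrecPred R) : IsSigma1 R :=
  ⟨fun x _ => R x, h.comp Primrec.fst, fun _ => ⟨fun hx => ⟨0, hx⟩, fun ⟨_, hx⟩ => hx⟩⟩

theorem comp {R : γ → Prop} (h : IsSigma1 R) {f : δ → γ} (hf : Primrec f) :
    IsSigma1 fun x => R (f x) := by
  obtain ⟨chk, h1, h2⟩ := h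
  exact ⟨fun x C => chk (f x) C, PrimrecRel.comp h1 (hf.comp Primrec.fst) Primrec.snd,
    fun x => h2 (f x)⟩

/-- The certificate is a finite list of strings, each with a possible witness for R. Instead of
guessing the sets of children, it suffices to count all one-letter extensions that occur in the
list. -/
theorem big {α β : γ → ℕ → ℕ} (hα : Primrec₂ α) (hβ : Primrec₂ β) {R : γ → List ℕ → Prop}
    (hR : IsSigma1 fun p : γ × List ℕ => R p.1 p.2) :
    IsSigma1 fun p : γ × List ℕ => Big (α p.1) (β p.1) {σ | R p.1 σ} p.2 := by
  classical
  obtain ⟨chk, h1, h2⟩ := hR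
  let kids : γ → List ℕ → List (List ℕ × ℕ) → List ℕ := fun x τ L =>
    (List.range (α x τ.length)).filter fun v => ∃ q ∈ L, q.1 = τ ++ [v]
  let ok : γ × List ℕ → List (List ℕ × ℕ) → Prop := fun p L => (∃ q ∈ L, q.1 = p.2) ∧
    ∀ q ∈ L, chk (p.1, q.1) q.2 ∨ β p.1 q.1.length ≤ (kids p.1 q.1 L).length
  have hkids : Primrec fun t : γ × List ℕ × List (List ℕ × ℕ) => kids t.1 t.2.1 t.2.2 := by
    have hmem : PrimrecRel fun (L : List (List ℕ × ℕ)) (b : List ℕ) => ∃ q ∈ L, q.1 = b :=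
      PrimrecRel.exists_mem_list (R := fun (q : List ℕ × ℕ) (b : List ℕ) => q.1 = b)
        (Primrec.eq.comp (Primrec.fst.comp Primrec.fst) Primrec.snd)
    refine primrec_filter_range (R := fun v (t : γ × List ℕ × List (List ℕ × ℕ)) =>
      ∃ q ∈ t.2.2, q.1 = t.2.1 ++ [v]) ?_ (hα.comp Primrec.fst
        (Primrec.list_length.comp (Primrec.fst.comp Primrec.snd)))
    exact PrimrecRel.comp hmem (Primrec.snd.comp (Primrec.snd.comp Primrec.snd))
      (Primrec.list_concat.comp (Primrec.fst.comp (Primrec.snd.comp Primrec.snd)) Primrec.fst)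
  have hok : PrimrecRel ok := by
    refine PrimrecPred.and ?_ ?_
    · exact PrimrecRel.comp (PrimrecRel.exists_mem_list
        (R := fun (q : List ℕ × ℕ) (b : List ℕ) => q.1 = b)
        (Primrec.eq.comp (Primrec.fst.comp Primrec.fst) Primrec.snd)) Primrec.snd
        (Primrec.snd.comp Primrec.fst)
    · have hR : PrimrecRel fun (q : List ℕ × ℕ) (t : (γ × List ℕ) × List (List ℕ × ℕ)) =>
          chk (t.1.1, q.1) q.2 ∨ β t.1.1 q.1.length ≤ (kids t.1.1 q.1 t.2).length := by
        have hx : Primrec fun u : (List ℕ × ℕ) × (γ × List ℕ) × List (List ℕ × ℕ) => u.2.1.1 :=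
          Primrec.fst.comp (Primrec.fst.comp Primrec.snd)
        have hq : Primrec fun u : (List ℕ × ℕ) × (γ × List ℕ) × List (List ℕ × ℕ) => u.1.1 :=
          Primrec.fst.comp Primrec.fst
        refine PrimrecPred.or (PrimrecRel.comp h1 (hx.pair hq) (Primrec.snd.comp Primrec.fst)) ?_
        exact Primrec.nat_le.comp (hβ.comp hx (Primrec.list_length.comp hq))
          (Primrec.list_length.comp (hkids.comp (hx.pair (hq.pair
            (Primrec.snd.comp Primrec.snd)))))
      exact PrimrecRel.comp (PrimrecRel.forall_mem_list hR) Primrec.snd Primrec.id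
  refine ⟨fun p C => ok p ((Encodable.decode (α := List (List ℕ × ℕ)) C).getD []),
    PrimrecRel.comp hok Primrec.fst (Primrec.option_getD.comp (Primrec.decode.comp Primrec.snd)
      (Primrec.const [])), fun p => ?_⟩
  have hset : {σ | R p.1 σ} = {σ | ∃ C, chk (p.1, σ) C} := by
    ext σ
    exact h2 (p.1, σ)
  beta_reduce
  rw [hset, Big.iff_exists_list]
  have hL : ∀ L : List (List ℕ × ℕ), ((∃ q ∈ L, q.1 = p.2) ∧
      ∀ q ∈ L, chk (p.1, q.1) q.2 ∨ ∃ S : Finset ℕ, (∀ v ∈ S, v < α p.1 q.1.length) ∧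
        β p.1 q.1.length ≤ S.card ∧ ∀ v ∈ S, ∃ q' ∈ L, q'.1 = q.1 ++ [v]) ↔ ok p L := by
    intro L
    refine and_congr_right fun _ => forall₂_congr fun q _ => or_congr_right ?_
    have hnd : (kids p.1 q.1 L).Nodup := List.nodup_range.filter _
    constructor
    · rintro ⟨S, h3, h4, h5⟩
      refine h4.trans ((Finset.card_le_card fun v hv => ?_).trans (List.toFinset_card_le _))
      rw [List.mem_toFinset, List.mem_filter, List.mem_range]
      exact ⟨h3 v hv, decide_eq_true (h5 v hv)⟩
    · intro h
      refine ⟨(kids p.1 q.1 L).toFinset, fun v hv => ?_, ?_, fun v hv => ?_⟩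
      · exact List.mem_range.1 (List.mem_filter.1 (List.mem_toFinset.1 hv)).1
      · rwa [List.toFinset_card_of_nodup hnd]
      · exact of_decide_eq_true (List.mem_filter.1 (List.mem_toFinset.1 hv)).2
  simp only [hL]
  constructor
  · rintro ⟨L, h⟩
    exact ⟨Encodable.encode L, by simpa using h⟩
  · rintro ⟨C, h⟩
    exact ⟨_, h⟩

/-- Uniformization of a semidecidable relation by a partial recursive function. -/
theorem exists_partrec {R : γ → ℕ → Prop} (hR : IsSigma1 fun p : γ × ℕ => R p.1 p.2) :
    ∃ f : γ →. ℕ, Partrec f ∧ ∀ x, (∃ w, R x w) → ∃ w, R x w ∧ w ∈ f x := by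
  classical
  obtain ⟨chk, h1, h2⟩ := hR
  let test : γ → ℕ → Bool := fun x m => decide (chk (x, m.unpair.1) m.unpair.2)
  have htest : Computable₂ test := by
    refine Primrec₂.to_comp ?_
    have hp : PrimrecRel fun (x : γ) (m : ℕ) => chk (x, m.unpair.1) m.unpair.2 :=
      PrimrecRel.comp h1 (Primrec.fst.pair (Primrec.fst.comp (Primrec.unpair.comp Primrec.snd)))
        (Primrec.snd.comp (Primrec.unpair.comp Primrec.snd))
    exact hp.decide
  refine ⟨fun x => (Nat.rfind fun m => Part.some (test x m)).map fun m => m.unpair.1,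
    (Partrec.rfind htest.partrec₂).map
      (Computable.fst.comp (Computable.unpair.comp Computable.snd)).to₂, fun x => ?_⟩
  rintro ⟨w, hw⟩
  obtain ⟨C, hC⟩ := (h2 (x, w)).1 hw
  have hdom : (Nat.rfind fun m => Part.some (test x m)).Dom := by
    refine (Nat.rfind_dom (p := fun m => Part.some (test x m))).2 ⟨Nat.pair w C, by simpa [test] using hC, fun _ => trivial⟩
  obtain ⟨m, hm⟩ := Part.dom_iff_mem.1 hdom
  have hm' : chk (x, m.unpair.1) m.unpair.2 := by
    have := Nat.rfind_spec hm
    simpa [test] using this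
  exact ⟨m.unpair.1, (h2 (x, _)).2 ⟨_, hm'⟩, (Part.mem_map_iff _).2 ⟨m, hm, rfl⟩⟩

end IsSigma1

/-! ### Closure properties and stagewise approximation -/

namespace IsSigma1

variable {γ δ : Type*} [Primcodable γ] [Primcodable δ]

theorem and {R R' : γ → Prop} (h : IsSigma1 R) (h' : IsSigma1 R') :
    IsSigma1 fun x => R x ∧ R' x := by
  obtain ⟨chk, h1, h2⟩ := h
  obtain ⟨chk', h1', h2'⟩ := h'
  refine ⟨fun x C => chk x C.unpair.1 ∧ chk' x C.unpair.2, PrimrecPred.and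
    (PrimrecRel.comp h1 Primrec.fst (Primrec.fst.comp (Primrec.unpair.comp Primrec.snd)))
    (PrimrecRel.comp h1' Primrec.fst (Primrec.snd.comp (Primrec.unpair.comp Primrec.snd))),
    fun x => ?_⟩
  beta_reduce
  rw [h2, h2']
  constructor
  · rintro ⟨⟨C, hC⟩, C', hC'⟩
    exact ⟨Nat.pair C C', by simpa using ⟨hC, hC'⟩⟩
  · rintro ⟨C, hC, hC'⟩
    exact ⟨⟨_, hC⟩, _, hC'⟩

theorem or {R R' : γ → Prop} (h : IsSigma1 R) (h' : IsSigma1 R') :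
    IsSigma1 fun x => R x ∨ R' x := by
  obtain ⟨chk, h1, h2⟩ := h
  obtain ⟨chk', h1', h2'⟩ := h'
  refine ⟨fun x C => chk x C ∨ chk' x C, PrimrecPred.or h1 h1', fun x => ?_⟩
  beta_reduce
  rw [h2, h2', ← exists_or]

theorem exists_nat {R : γ → ℕ → Prop} (h : IsSigma1 fun p : γ × ℕ => R p.1 p.2) :
    IsSigma1 fun x => ∃ w, R x w := by
  obtain ⟨chk, h1, h2⟩ := h
  refine ⟨fun x C => chk (x, C.unpair.1) C.unpair.2, PrimrecRel.comp h1
    (Primrec.fst.pair (Primrec.fst.comp (Primrec.unpair.comp Primrec.snd)))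
    (Primrec.snd.comp (Primrec.unpair.comp Primrec.snd)), fun x => ?_⟩
  constructor
  · rintro ⟨w, hw⟩
    obtain ⟨C, hC⟩ := (h2 (x, w)).1 hw
    exact ⟨Nat.pair w C, by simpa using hC⟩
  · rintro ⟨C, hC⟩
    exact ⟨_, (h2 (x, _)).2 ⟨_, hC⟩⟩

theorem forall_lt {R : γ → ℕ → Prop} (h : IsSigma1 fun p : γ × ℕ => R p.1 p.2) {N : γ → ℕ}
    (hN : Primrec N) : IsSigma1 fun x => ∀ i < N x, R x i := by
  obtain ⟨chk, h1, h2⟩ := h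
  let cert : ℕ → ℕ → ℕ := fun C i => ((Encodable.decode (α := List ℕ) C).getD []).getD i 0
  have hcert : Primrec₂ cert := (Primrec.list_getD 0).comp
    (Primrec.option_getD.comp (Primrec.decode.comp Primrec.fst) (Primrec.const []))
    Primrec.snd
  refine ⟨fun x C => ∀ i < N x, chk (x, i) (cert C i), ?_, fun x => ?_⟩
  · exact primrecPred_forall_lt (R := fun i (p : γ × ℕ) => chk (p.1, i) (cert p.2 i))
      (PrimrecRel.comp h1 ((Primrec.fst.comp Primrec.snd).pair Primrec.fst)
        (hcert.comp (Primrec.snd.comp Primrec.snd) Primrec.fst)) (hN.comp Primrec.fst)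
  · constructor
    · intro H
      have H' : ∀ i, ∃ C, i < N x → chk (x, i) C := by
        intro i
        by_cases hi : i < N x
        · obtain ⟨C, hC⟩ := (h2 (x, i)).1 (H i hi)
          exact ⟨C, fun _ => hC⟩
        · exact ⟨0, fun h => absurd h hi⟩
      choose C hC using H'
      refine ⟨Encodable.encode (initSeg C (N x)), fun i hi => ?_⟩
      have : cert (Encodable.encode (initSeg C (N x))) i = C i := by
        simp [cert, List.getD_eq_getElem?_getD, getElem?_initSeg_of_lt C hi]
      rw [this]
      exact hC i hi
    · rintro ⟨C, hC⟩ i hi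
      exact (h2 (x, i)).2 ⟨_, hC i hi⟩

/-- A semidecidable condition on initial segments can be replaced by a decidable one that is
inherited by extensions. -/
theorem exists_stages {R : γ → List ℕ → Prop}
    (h : IsSigma1 fun p : γ × List ℕ => R p.1 p.2) :
    ∃ R' : γ → List ℕ → Prop, PrimrecRel R' ∧ (∀ x σ τ, σ <+: τ → R' x σ → R' x τ) ∧
      ∀ x f, (∃ n, R' x (initSeg f n)) ↔ ∃ n, R x (initSeg f n) := by
  obtain ⟨chk, h1, h2⟩ := h
  have htake : Primrec₂ fun (σ : List ℕ) (i : ℕ) => σ.take i := by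
    have : Primrec₂ fun (σ : List ℕ) (i : ℕ) =>
        (List.range i).filterMap fun j => σ[j]? :=
      Primrec.listFilterMap (Primrec.list_range.comp Primrec.snd)
        (Primrec.list_getElem?.comp (Primrec.fst.comp Primrec.fst) Primrec.snd).to₂
    refine this.of_eq fun σ i => ?_
    induction i with
    | zero => simp
    | succ i ih =>
      rw [List.range_succ, List.filterMap_append, ih, List.take_add_one]
      cases h : σ[i]? <;> simp [h]
  -- The length of σ bounds the search for a witness, and all initial segments of σ are tested, so
  -- the relation persists under extension.
  refine ⟨fun x σ => ∃ i < σ.length + 1, ∃ C < σ.length, chk (x, σ.take i) C, ?_, ?_, ?_⟩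
  · have hC : PrimrecRel fun (C : ℕ) (p : ℕ × γ × List ℕ) => chk (p.2.1, p.2.2.take p.1) C :=
      PrimrecRel.comp h1 ((Primrec.fst.comp (Primrec.snd.comp Primrec.snd)).pair
        (htake.comp (Primrec.snd.comp (Primrec.snd.comp Primrec.snd))
          (Primrec.fst.comp Primrec.snd))) Primrec.fst
    have hi : PrimrecRel fun (i : ℕ) (p : γ × List ℕ) =>
        ∃ C < p.2.length, chk (p.1, p.2.take i) C :=
      (primrecPred_exists_lt hC (N := fun p : ℕ × γ × List ℕ => p.2.2.length)
        (Primrec.list_length.comp (Primrec.snd.comp Primrec.snd)))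
    exact primrecPred_exists_lt hi (Primrec.succ.comp (Primrec.list_length.comp Primrec.snd))
  · rintro x σ τ hστ ⟨i, hi, C, hC, H⟩
    have hle := hστ.length_le
    refine ⟨i, by omega, C, by omega, ?_⟩
    obtain ⟨ρ, rfl⟩ := hστ
    rwa [List.take_append_of_le_length (by omega)]
  · intro x f
    constructor
    · rintro ⟨n, i, hi, C, hC, H⟩
      rw [length_initSeg] at hi
      rw [take_initSeg f (by omega)] at H
      exact ⟨i, (h2 (x, _)).2 ⟨C, H⟩⟩
    · rintro ⟨n, H⟩
      obtain ⟨C, hC⟩ := (h2 (x, _)).1 H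
      refine ⟨n + C + 1, n, ?_, C, ?_, ?_⟩
      · rw [length_initSeg]; omega
      · rw [length_initSeg]; omega
      · rwa [take_initSeg f (by omega)]

end IsSigma1

theorem isPi01Cantor_of_isSigma1 {R : List ℕ → Prop} (hR : IsSigma1 R) :
    IsPi01Cantor {f | (∀ n, f n < 2) ∧ ∀ n, ¬ R (initSeg f n)} := by
  obtain ⟨R', h1, -, h3⟩ := IsSigma1.exists_stages (γ := Unit) (R := fun _ => R)
    (hR.comp Primrec.snd)
  have hp : PrimrecPred fun σ => ¬ R' () σ :=
    (PrimrecRel.comp h1 (Primrec.const ()) Primrec.id).not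
  classical
  refine ⟨fun σ => ¬ R' () σ, ?_, ?_⟩
  · exact ComputablePred.computable_iff.2 ⟨_, hp.decide.to_comp, by funext σ; simp⟩
  · ext f
    refine and_congr_right fun _ => ?_
    rw [← not_exists, ← not_exists, ← h3 () f]

/-! ### Numbers written in binary -/

/-- The number whose binary digits are the parities of `φ 0, …, φ (L - 1)`. -/
def bitSum (φ : ℕ → ℕ) : ℕ → ℕ
  | 0 => 0
  | L + 1 => bitSum φ L + φ L % 2 * 2 ^ L

theorem bitSum_congr {φ ψ : ℕ → ℕ} {L : ℕ} (h : ∀ i < L, φ i % 2 = ψ i % 2) :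
    bitSum φ L = bitSum ψ L := by
  induction L with
  | zero => rfl
  | succ L ih => rw [bitSum, bitSum, ih fun i hi => h i (by omega), h L (by omega)]

theorem bitSum_lt (φ : ℕ → ℕ) (L : ℕ) : bitSum φ L < 2 ^ L := by
  induction L with
  | zero => simp [bitSum]
  | succ L ih =>
    rw [bitSum, pow_succ]
    have : φ L % 2 * 2 ^ L ≤ 1 * 2 ^ L := Nat.mul_le_mul_right _ (by omega)
    omega

theorem bitSum_bits {v L : ℕ} (h : v < 2 ^ L) : bitSum (fun i => v / 2 ^ i) L = v := by
  have H : ∀ L, bitSum (fun i => v / 2 ^ i) L = v % 2 ^ L := by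
    intro L
    induction L with
    | zero => simp [bitSum, Nat.mod_one]
    | succ L ih => rw [bitSum, ih, Nat.mod_pow_succ, mul_comm]
  rw [H, Nat.mod_eq_of_lt h]

theorem primrec_pow : Primrec₂ fun m n : ℕ => m ^ n := Primrec₂.unpaired'.1 Nat.Primrec.pow

theorem primrec_two_pow : Primrec fun n : ℕ => 2 ^ n := primrec_pow.comp (Primrec.const 2) Primrec.id

theorem primrec_bitSum {γ : Type*} [Primcodable γ] {φ : γ → ℕ → ℕ} (hφ : Primrec₂ φ)
    {N : γ → ℕ} (hN : Primrec N) : Primrec fun x => bitSum (φ x) (N x) := by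
  have hstep : Primrec₂ fun (x : γ) (p : ℕ × ℕ) => p.2 + φ x p.1 % 2 * 2 ^ p.1 := by
    have hi : Primrec fun t : γ × ℕ × ℕ => t.2.1 := Primrec.fst.comp Primrec.snd
    exact Primrec.nat_add.comp (Primrec.snd.comp Primrec.snd) (Primrec.nat_mul.comp
      (Primrec.nat_mod.comp (hφ.comp Primrec.fst hi) (Primrec.const 2))
      (primrec_two_pow.comp hi))
  refine (Primrec.nat_rec' hN (Primrec.const 0) (hstep.comp₂ Primrec₂.left Primrec₂.right)).of_eq
    fun x => ?_
  induction N x with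
  | zero => rfl
  | succ n ih => simp only [bitSum, ← ih]

/-! ### Blocks of bits -/

/-- The sum of the widths of the blocks before the block with index `x`. -/
def offset : ℕ → ℕ
  | 0 => 0
  | x + 1 => offset x + (x + 1) * (4 * offset x + 2 * x + 1)

/-- The binary logarithm of `budget x`. -/
def budgetLog (x : ℕ) : ℕ := 4 * offset x + 2 * x + 1

/-- The number of bits of the block with index `x`. -/
def width (x : ℕ) : ℕ := (x + 1) * budgetLog x

/-- A strict bound for the number of letters that can be killed in the block with index `x`. -/
def budget (x : ℕ) : ℕ := 2 ^ budgetLog x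

/-- The number of possible letters in the block with index `x`. -/
def alphabet (x : ℕ) : ℕ := 2 ^ width x

/-- The exponent x + 1 is the reserve of a block: any threshold `budget x ^ s` with s ≤ x + 1 can be
met, so in late blocks exponents can grow from stage to stage. -/
theorem alphabet_eq (x : ℕ) : alphabet x = budget x ^ (x + 1) := by
  rw [alphabet, width, budget, ← pow_mul, mul_comm]

theorem two_le_budget (x : ℕ) : 2 ≤ budget x :=
  Nat.le_self_pow (by unfold budgetLog; omega) 2

theorem budget_le_alphabet (x : ℕ) : budget x ≤ alphabet x :=
  alphabet_eq x ▸ Nat.le_self_pow (by omega) _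

theorem offset_succ (x : ℕ) : offset (x + 1) = offset x + width x := rfl

theorem offset_mono : Monotone offset :=
  monotone_nat_of_le_succ fun x => offset_succ x ▸ Nat.le_add_right _ _

/-- The offset of y already contains the width of x. Hence any number of cases bounded by a power of
`alphabet x` is absorbed, in later blocks, by raising the exponent of the budget. -/
theorem alphabet_le_budget {x y : ℕ} (h : x < y) : alphabet x ≤ budget y := by
  refine Nat.pow_le_pow_right two_pos ?_
  have := offset_mono (Nat.succ_le_of_lt h)
  rw [Nat.succ_eq_add_one, offset_succ] at this
  unfold budgetLog
  omega

theorem primrec_offset : Primrec offset := by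
  have hstep : Primrec₂ fun x o : ℕ => o + (x + 1) * (4 * o + 2 * x + 1) :=
    Primrec.nat_add.comp Primrec.snd (Primrec.nat_mul.comp (Primrec.succ.comp Primrec.fst)
      (Primrec.succ.comp (Primrec.nat_add.comp
        (Primrec.nat_mul.comp (Primrec.const 4) Primrec.snd)
        (Primrec.nat_mul.comp (Primrec.const 2) Primrec.fst))))
  refine (Primrec.nat_rec₁ 0 hstep).of_eq fun x => ?_
  induction x with
  | zero => rfl
  | succ x ih => simp only [offset, ← ih]

theorem primrec_budgetLog : Primrec budgetLog :=
  Primrec.succ.comp (Primrec.nat_add.comp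
    (Primrec.nat_mul.comp (Primrec.const 4) primrec_offset)
    (Primrec.nat_mul.comp (Primrec.const 2) Primrec.id))

theorem primrec_width : Primrec width := Primrec.nat_mul.comp Primrec.succ primrec_budgetLog

theorem primrec_budget : Primrec budget := primrec_two_pow.comp primrec_budgetLog

theorem primrec_alphabet : Primrec alphabet := primrec_two_pow.comp primrec_width

/-! ### Tags, killed letters, and the letters of a sequence of bits -/

/-- The colour of the block with index `x`. -/
def tag (x : ℕ) : ℕ := x.unpair.2.unpair.1

theorem primrec_tag : Primrec tag :=
  Primrec.fst.comp (Primrec.unpair.comp (Primrec.snd.comp Primrec.unpair))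

/-- The letters of the block with index `x` that are killed: the values of the partial recursive
function that is coded in `x` at fewer than `budget x` arguments. -/
def killed (x : ℕ) : Set ℕ :=
  {v | ∃ z, z + 1 < budget x ∧
    v ∈ (Denumerable.ofNat Code x.unpair.1).eval (Nat.pair x z)}

/-- Different killed letters come from different arguments z, and only `budget x - 1` arguments are
admitted. -/
theorem card_lt_budget {x : ℕ} {S : Finset ℕ} (h : ∀ v ∈ S, v ∈ killed x) :
    S.card < budget x := by
  choose! z hz hv using h
  have h2 := two_le_budget x
  have hinj : Set.InjOn z S := fun v hvS w hwS hvw =>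
    Part.mem_unique (hv v hvS) (hvw ▸ hv w hwS)
  have := Finset.card_le_card_of_injOn (t := Finset.range (budget x - 1)) z
    (fun v hvS => Finset.mem_coe.2 (Finset.mem_range.2 (by have := hz v hvS; omega))) hinj
  rw [Finset.card_range] at this
  omega

theorem exists_not_mem_killed (x : ℕ) : ∃ v < alphabet x, v ∉ killed x := by
  by_contra! H
  have := card_lt_budget (S := Finset.range (alphabet x)) fun v hv => H v (Finset.mem_range.1 hv)
  rw [Finset.card_range] at this
  exact absurd (budget_le_alphabet x) (not_le.2 this)

theorem isSigma1_killed : IsSigma1 fun p : ℕ × ℕ => p.2 ∈ killed p.1 := by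
  have hz : Primrec fun t : (ℕ × ℕ) × ℕ => t.2.unpair.1 :=
    Primrec.fst.comp (Primrec.unpair.comp Primrec.snd)
  have hs : Primrec fun t : (ℕ × ℕ) × ℕ => t.2.unpair.2 :=
    Primrec.snd.comp (Primrec.unpair.comp Primrec.snd)
  have hx : Primrec fun t : (ℕ × ℕ) × ℕ => t.1.1 := Primrec.fst.comp Primrec.fst
  refine ⟨fun p C => C.unpair.1 + 1 < budget p.1 ∧ Code.evaln C.unpair.2
    (Denumerable.ofNat Code p.1.unpair.1) (Nat.pair p.1 C.unpair.1) = some p.2, ?_, fun p => ?_⟩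
  · refine PrimrecPred.and (Primrec.nat_lt.comp (Primrec.succ.comp hz)
      (primrec_budget.comp hx)) ?_
    refine Primrec.eq.comp (Code.primrec_evaln.comp ((hs.pair ((Primrec.ofNat Code).comp
      (Primrec.fst.comp (Primrec.unpair.comp hx)))).pair (Primrec₂.natPair.comp hx hz)))
      (Primrec.option_some.comp (Primrec.snd.comp Primrec.fst))
  · constructor
    · rintro ⟨z, hz, hv⟩
      obtain ⟨s, hs⟩ := Code.evaln_complete.1 hv
      exact ⟨Nat.pair z s, by simpa using hz, by simpa using hs⟩
    · rintro ⟨C, hC, hv⟩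
      exact ⟨_, hC, Code.evaln_sound hv⟩

/-- The letter in the block with index `x`, for a sequence of bits. -/
def letter (f : Baire) (x : ℕ) : ℕ := bitSum (fun i => f (Nat.pair x i)) (width x)

/-- The sequence of bits with given letters. -/
def bitSeq (r : ℕ → ℕ) : Baire := fun y => r y.unpair.1 / 2 ^ y.unpair.2 % 2

theorem bitSeq_lt (r : ℕ → ℕ) (y : ℕ) : bitSeq r y < 2 := Nat.mod_lt _ two_pos

theorem letter_bitSeq {r : ℕ → ℕ} {x : ℕ} (h : r x < alphabet x) : letter (bitSeq r) x = r x := by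
  rw [letter, ← bitSum_bits (v := r x) (L := width x) h]
  exact bitSum_congr fun i _ => by simp [bitSeq]

/-! ### Three families of `Π⁰₁` sets -/

/-- The positions below `length σ` show that the letter at `x` of the sequence of bits
`y ↦ f (φ y)` is killed, for `f` extending `σ`. -/
def Hit (σ : List ℕ) (φ : ℕ → ℕ) (x : ℕ) : Prop :=
  (∀ i < width x, φ (Nat.pair x i) < σ.length) ∧
    bitSum (fun i => σ.getD (φ (Nat.pair x i)) 0) (width x) ∈ killed x

theorem hit_initSeg {f : Baire} {n : ℕ} {φ : ℕ → ℕ} {x : ℕ} :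
    Hit (initSeg f n) φ x ↔ (∀ i < width x, φ (Nat.pair x i) < n) ∧
      letter (fun y => f (φ y)) x ∈ killed x := by
  unfold Hit
  rw [length_initSeg]
  refine and_congr_right fun h => ?_
  have : bitSum (fun i => (initSeg f n).getD (φ (Nat.pair x i)) 0) (width x) =
      letter (fun y => f (φ y)) x := by
    refine bitSum_congr fun i hi => ?_
    rw [List.getD_eq_getElem?_getD, getElem?_initSeg_of_lt f (h i hi)]
    rfl
  rw [this]

theorem exists_hit {f : Baire} {φ : ℕ → ℕ} {x : ℕ}
    (h : letter (fun y => f (φ y)) x ∈ killed x) : ∃ N, ∀ n ≥ N, Hit (initSeg f n) φ x := by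
  refine ⟨(Finset.range (width x)).sup fun i => φ (Nat.pair x i) + 1, fun n hn =>
    hit_initSeg.2 ⟨fun i hi => ?_, h⟩⟩
  exact (Finset.le_sup (f := fun i => φ (Nat.pair x i) + 1) (Finset.mem_range.2 hi)).trans hn

theorem isSigma1_hit {γ : Type*} [Primcodable γ] {σ : γ → List ℕ} (hσ : Primrec σ)
    {φ : γ → ℕ → ℕ} (hφ : Primrec₂ φ) {x : γ → ℕ} (hx : Primrec x) :
    IsSigma1 fun a => Hit (σ a) (φ a) (x a) := by
  have hidx : Primrec₂ fun (a : γ) (i : ℕ) => φ a (Nat.pair (x a) i) :=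
    hφ.comp Primrec.fst (Primrec₂.natPair.comp (hx.comp Primrec.fst) Primrec.snd)
  have hw : Primrec fun a => width (x a) := primrec_width.comp hx
  refine (IsSigma1.of_primrecPred ?_).and (isSigma1_killed.comp (hx.pair (primrec_bitSum
    (φ := fun a i => (σ a).getD (φ a (Nat.pair (x a) i)) 0) ?_ hw)))
  · refine primrecPred_forall_lt (R := fun i a => φ a (Nat.pair (x a) i) < (σ a).length) ?_ hw
    exact Primrec.nat_lt.comp (hidx.comp Primrec.snd Primrec.fst)
      (Primrec.list_length.comp (hσ.comp Primrec.snd))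
  · exact (Primrec.list_getD 0).comp (hσ.comp Primrec.fst) hidx

/-- The sequences of bits all killed letters of which have the tag `m`. -/
def tagOnly (m : ℕ) : Set Baire :=
  {f | (∀ y, f y < 2) ∧ ∀ x, letter f x ∈ killed x → tag x = m}

/-- The column with index `(m, l)` of a sequence. -/
def column (m l : ℕ) (g : Baire) : Baire := fun y => g (Nat.pair (Nat.pair m l) y)

/-- The sequences of bits such that for every `m`, one of the columns `(m, 0), …, (m, m)` has no
killed letter with tag `m`. -/
def tagAvoiding : Set Baire :=
  {g | (∀ y, g y < 2) ∧ ∀ m, ∃ l ≤ m, ∀ x, letter (column m l g) x ∈ killed x → tag x ≠ m}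

/-- The pairs of sequences of bits for which the killed letters of the first sequence have one tag,
which differs from the tags of the killed letters of the second sequence. -/
def tagSeparating : Set Baire :=
  {f | (∀ y, f y < 2) ∧ ∀ x x', letter (evenPart f) x ∈ killed x →
    (letter (evenPart f) x' ∈ killed x' → tag x' = tag x) ∧
    (letter (oddPart f) x' ∈ killed x' → tag x' ≠ tag x)}

theorem exists_no_letter_killed : ∃ f : Baire, (∀ y, f y < 2) ∧ ∀ x, letter f x ∉ killed x := by
  choose r hr hk using exists_not_mem_killed
  exact ⟨bitSeq r, bitSeq_lt r, fun x => by rw [letter_bitSeq (hr x)]; exact hk x⟩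

theorem tagOnly_mem_pi01Sets (m : ℕ) : tagOnly m ∈ pi01Sets := by
  obtain ⟨f, hf, hk⟩ := exists_no_letter_killed
  refine ⟨⟨f, hf, fun x hx => absurd hx (hk x)⟩, ?_⟩
  have hR : IsSigma1 fun σ : List ℕ => ∃ x, Hit σ (fun y => y) x ∧ tag x ≠ m :=
    IsSigma1.exists_nat (R := fun σ x => Hit σ (fun y => y) x ∧ tag x ≠ m)
      ((isSigma1_hit Primrec.fst (φ := fun _ y => y) Primrec.snd Primrec.snd).and
        (.of_primrecPred (Primrec.eq.comp (primrec_tag.comp Primrec.snd) (Primrec.const m)).not))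
  convert isPi01Cantor_of_isSigma1 hR using 1
  ext f
  refine and_congr_right fun _ => ?_
  constructor
  · rintro h n ⟨x, hx, hm⟩
    exact hm (h x (hit_initSeg.1 hx).2)
  · intro h x hx
    by_contra hm
    obtain ⟨N, hN⟩ := exists_hit (φ := fun y => y) hx
    exact h N ⟨x, hN N le_rfl, hm⟩

theorem primrec_column_index : Primrec fun p : (ℕ × ℕ) × ℕ => Nat.pair (Nat.pair p.1.1 p.1.2) p.2 :=
  Primrec₂.natPair.comp (Primrec₂.natPair.comp (Primrec.fst.comp Primrec.fst)
    (Primrec.snd.comp Primrec.fst)) Primrec.snd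

/-- The choice of a column among finitely many does no harm: failure at m means that each of m + 1
columns has been refuted, a bounded conjunction of semidecidable conditions. -/
theorem tagAvoiding_mem_pi01Sets : tagAvoiding ∈ pi01Sets := by
  obtain ⟨f, hf, hk⟩ := exists_no_letter_killed
  refine ⟨⟨fun y => f y.unpair.2, fun y => hf _, fun m => ⟨0, Nat.zero_le _, fun x hx =>
    absurd hx ?_⟩⟩, ?_⟩
  · have : column m 0 (fun y => f y.unpair.2) = f := by
      funext y
      simp [column]
    rw [this]
    exact hk x
  have hR : IsSigma1 fun σ : List ℕ => ∃ m, ∀ l < m + 1, ∃ x,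
      Hit σ (fun y => Nat.pair (Nat.pair m l) y) x ∧ tag x = m := by
    refine IsSigma1.exists_nat (R := fun σ m => ∀ l < m + 1, ∃ x,
      Hit σ (fun y => Nat.pair (Nat.pair m l) y) x ∧ tag x = m) ?_
    refine IsSigma1.forall_lt (γ := List ℕ × ℕ) (R := fun p l => ∃ x,
      Hit p.1 (fun y => Nat.pair (Nat.pair p.2 l) y) x ∧ tag x = p.2) ?_
      (Primrec.succ.comp Primrec.snd)
    refine IsSigma1.exists_nat (γ := (List ℕ × ℕ) × ℕ) (R := fun p x =>
      Hit p.1.1 (fun y => Nat.pair (Nat.pair p.1.2 p.2) y) x ∧ tag x = p.1.2) ?_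
    have hm : Primrec fun p : ((List ℕ × ℕ) × ℕ) × ℕ => p.1.1.2 :=
      Primrec.snd.comp (Primrec.fst.comp Primrec.fst)
    refine (isSigma1_hit (Primrec.fst.comp (Primrec.fst.comp Primrec.fst)) ?_ Primrec.snd).and
      (.of_primrecPred (Primrec.eq.comp (primrec_tag.comp Primrec.snd) hm))
    exact primrec_column_index.comp (((hm.comp Primrec.fst).pair
      (Primrec.snd.comp (Primrec.fst.comp Primrec.fst))).pair Primrec.snd)
  convert isPi01Cantor_of_isSigma1 hR using 1
  ext g
  refine and_congr_right fun _ => ?_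
  constructor
  · rintro h n ⟨m, hm⟩
    obtain ⟨l, hl, H⟩ := h m
    obtain ⟨x, hx, hxm⟩ := hm l (Nat.lt_succ_of_le hl)
    exact H x (hit_initSeg.1 hx).2 hxm
  · intro h m
    by_contra! H
    choose! x hx hxm using H
    have hN : ∀ l, ∃ N, l ≤ m → ∀ n ≥ N,
        Hit (initSeg g n) (fun y => Nat.pair (Nat.pair m l) y) (x l) := by
      intro l
      by_cases hl : l ≤ m
      · obtain ⟨N, hN⟩ := exists_hit (f := g) (φ := fun y => Nat.pair (Nat.pair m l) y) (hx l hl)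
        exact ⟨N, fun _ => hN⟩
      · exact ⟨0, fun h => absurd h hl⟩
    choose N hN using hN
    exact h ((Finset.range (m + 1)).sup N) ⟨m, fun l hl => ⟨x l, hN l (by omega) _
      (Finset.le_sup (Finset.mem_range.2 hl)), hxm l (by omega)⟩⟩

theorem tagSeparating_mem_pi01Sets : tagSeparating ∈ pi01Sets := by
  obtain ⟨f, hf, hk⟩ := exists_no_letter_killed
  refine ⟨⟨joinSeq f f, fun y => ?_, fun x x' hx => absurd hx ?_⟩, ?_⟩
  · unfold joinSeq
    split_ifs
    exacts [hf _, hf _]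
  · rw [evenPart_joinSeq]
    exact hk x
  have hR : IsSigma1 fun σ : List ℕ => ∃ x x', Hit σ (fun y => 2 * y) x ∧
      (Hit σ (fun y => 2 * y) x' ∧ tag x' ≠ tag x ∨
        Hit σ (fun y => 2 * y + 1) x' ∧ tag x' = tag x) := by
    refine IsSigma1.exists_nat (R := fun σ x => ∃ x', Hit σ (fun y => 2 * y) x ∧
      (Hit σ (fun y => 2 * y) x' ∧ tag x' ≠ tag x ∨
        Hit σ (fun y => 2 * y + 1) x' ∧ tag x' = tag x)) ?_
    refine IsSigma1.exists_nat (γ := List ℕ × ℕ) (R := fun p x' => Hit p.1 (fun y => 2 * y) p.2 ∧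
      (Hit p.1 (fun y => 2 * y) x' ∧ tag x' ≠ tag p.2 ∨
        Hit p.1 (fun y => 2 * y + 1) x' ∧ tag x' = tag p.2)) ?_
    have hσ : Primrec fun p : (List ℕ × ℕ) × ℕ => p.1.1 := Primrec.fst.comp Primrec.fst
    have hx : Primrec fun p : (List ℕ × ℕ) × ℕ => p.1.2 := Primrec.snd.comp Primrec.fst
    have he : Primrec₂ fun (_ : (List ℕ × ℕ) × ℕ) (y : ℕ) => 2 * y :=
      primrec_double.comp Primrec.snd
    have ho : Primrec₂ fun (_ : (List ℕ × ℕ) × ℕ) (y : ℕ) => 2 * y + 1 :=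
      Primrec.succ.comp (primrec_double.comp Primrec.snd)
    have ht : PrimrecPred fun p : (List ℕ × ℕ) × ℕ => tag p.2 = tag p.1.2 :=
      Primrec.eq.comp (primrec_tag.comp Primrec.snd) (primrec_tag.comp hx)
    exact (isSigma1_hit hσ he hx).and
      (((isSigma1_hit hσ he Primrec.snd).and (.of_primrecPred ht.not)).or
        ((isSigma1_hit hσ ho Primrec.snd).and (.of_primrecPred ht)))
  convert isPi01Cantor_of_isSigma1 hR using 1
  ext f
  refine and_congr_right fun _ => ?_
  constructor
  · rintro h n ⟨x, x', hx, ⟨hx', ht⟩ | ⟨hx', ht⟩⟩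
    · exact ht ((h x x' (hit_initSeg.1 hx).2).1 (hit_initSeg.1 hx').2)
    · exact (h x x' (hit_initSeg.1 hx).2).2 (hit_initSeg.1 hx').2 ht
  · intro h x x' hx
    obtain ⟨N, hN⟩ := exists_hit (f := f) (φ := fun y => 2 * y) hx
    refine ⟨fun hx' => ?_, fun hx' ht => ?_⟩
    · by_contra ht
      obtain ⟨N', hN'⟩ := exists_hit (f := f) (φ := fun y => 2 * y) hx'
      exact h (max N N') ⟨x, x', hN _ (le_max_left _ _), .inl ⟨hN' _ (le_max_right _ _), ht⟩⟩
    · obtain ⟨N', hN'⟩ := exists_hit (f := f) (φ := fun y => 2 * y + 1) hx'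
      exact h (max N N') ⟨x, x', hN _ (le_max_left _ _), .inr ⟨hN' _ (le_max_right _ _), ht⟩⟩

/-! ### The upper bound -/

theorem encard_changes_le {s : ℕ → ℕ} (hs : Monotone s) {b : ℕ} (hb : ∀ n, s n ≤ b) :
    (changes s).encard ≤ b := by
  classical
  refine (encard_setOf_le_iff (p := fun n => s (n + 1) ≠ s n)).2 fun n => ?_
  refine le_trans ?_ (hb n)
  induction n with
  | zero => simp
  | succ n ih =>
    rw [List.range_succ, List.filter_append, List.length_append]
    have : s n ≤ s (n + 1) := hs (Nat.le_succ n)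
    by_cases h : s (n + 1) = s n
    · simp only [List.filter_singleton]
      simp [h] at ih ⊢
      omega
    · simp [h] at ih ⊢
      omega

/-- The output is the second argument joined with the least column (n, l) that is not refuted.
Killed letters of the former have tag n, those of the latter do not. Refutations are permanent, so l
only increases, up to n. -/
theorem tagSeparating_reduces (n : ℕ) :
    Reduces (learnable changes) tagSeparating (joinSet tagAvoiding (tagOnly n)) := by
  classical
  let φ : ℕ → ℕ → ℕ := fun l y => 2 * Nat.pair (Nat.pair n l) y
  have hφ : Primrec₂ φ := primrec_double.comp
    (primrec_column_index.comp (((Primrec.const n).pair Primrec.fst).pair Primrec.snd))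
  obtain ⟨R, hR1, hR2, hR3⟩ := IsSigma1.exists_stages
    (R := fun l σ => ∃ x, Hit σ (φ l) x ∧ tag x = n) (IsSigma1.exists_nat
      (γ := ℕ × List ℕ) (R := fun p x => Hit p.2 (φ p.1) x ∧ tag x = n)
      ((isSigma1_hit (Primrec.snd.comp Primrec.fst) (φ := fun p => φ p.1.1)
        (hφ.comp (Primrec.fst.comp (Primrec.fst.comp Primrec.fst)) Primrec.snd)
        Primrec.snd).and (.of_primrecPred (Primrec.eq.comp (primrec_tag.comp Primrec.snd)
          (Primrec.const n)))))
  -- The number of l < n such that the columns (n, 0), …, (n, l) are all refuted so far. It is the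
  -- least unrefuted column, or n if the first n columns are refuted.
  let cnt : List ℕ → ℕ := fun σ => ((List.range n).filter fun l => ∀ j < l + 1, R j σ).length
  have hcnt : Primrec cnt := by
    have h1 : PrimrecRel fun (l : ℕ) (σ : List ℕ) => ∀ j < l + 1, R j σ :=
      primrecPred_forall_lt (R := fun j (p : ℕ × List ℕ) => R j p.2)
        (PrimrecRel.comp hR1 Primrec.fst (Primrec.snd.comp Primrec.snd))
        (Primrec.succ.comp Primrec.fst)
    exact Primrec.list_length.comp (primrec_filter_range h1 (Primrec.const n))
  have hmono : ∀ F, Monotone fun k => cnt (initSeg F k) := by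
    intro F k k' hk
    refine List.Sublist.length_le (List.monotone_filter_right _ fun l hl => ?_)
    rw [decide_eq_true_eq] at hl ⊢
    exact fun j hj => hR2 j _ _ (initSeg_prefix F hk) (hl j hj)
  have hle : ∀ σ, cnt σ ≤ n := fun σ => (List.length_filter_le _ _).trans (by simp)
  have hidx : ∀ l, ∃ e, ∀ f, ComputesTo e f (joinSeq (oddPart f) (column n l (evenPart f))) := by
    intro l
    obtain ⟨e, he⟩ := exists_reindex_index (φ := fun N => if N % 2 = 0 then N + 1 else φ l (N / 2))
      (Primrec.ite (Primrec.eq.comp (Primrec.nat_mod.comp Primrec.id (Primrec.const 2))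
        (Primrec.const 0)) Primrec.succ (hφ.comp (Primrec.const l)
          (Primrec.nat_div.comp Primrec.id (Primrec.const 2)))).to_comp
    refine ⟨e, fun f => ?_⟩
    convert he f using 1
    funext N
    unfold joinSeq oddPart column evenPart
    split_ifs with h
    · congr 1; omega
    · rfl
  choose e he using hidx
  have heList : ∀ l ≤ n, (initSeg e (n + 1)).getD l 0 = e l := fun l hl => by
    rw [List.getD_eq_getElem?_getD, getElem?_initSeg_of_lt e (Nat.lt_succ_of_le hl)]; rfl
  refine reduces_learnable.2 ⟨fun σ => (initSeg e (n + 1)).getD (cnt σ) 0,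
    ((Primrec.list_getD 0).comp (Primrec.const _) hcnt).to_comp, n, fun F hF => ⟨?_, ?_⟩⟩
  · have hsub : changes (guesses (fun σ => (initSeg e (n + 1)).getD (cnt σ) 0) F) ⊆
        changes fun k => cnt (initSeg F k) := by
      refine fun k hk h => hk ?_
      exact congrArg ((initSeg e (n + 1)).getD · 0) h
    exact (Set.encard_le_encard hsub).trans (encard_changes_le (hmono F) fun k => hle _)
  · obtain ⟨⟨hg2, hg⟩, hr2, hr⟩ := hF
    obtain ⟨l, hl, hgood, hmin⟩ : ∃ l ≤ n,
        (∀ x, letter (column n l (evenPart F)) x ∈ killed x → tag x ≠ n) ∧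
        ∀ j < l, ∃ x, letter (column n j (evenPart F)) x ∈ killed x ∧ tag x = n := by
      have hex := hg n
      refine ⟨Nat.find hex, (Nat.find_spec hex).1, (Nat.find_spec hex).2, fun j hj => ?_⟩
      have := Nat.find_min hex hj
      push Not at this
      exact this (hj.le.trans (Nat.find_spec hex).1)
    have hcol : ∀ j, (fun y => F (φ j y)) = column n j (evenPart F) := fun j => rfl
    have hnot : ∀ k, ¬ R l (initSeg F k) := by
      intro k hk
      obtain ⟨m, x, hx, ht⟩ := (hR3 l F).1 ⟨k, hk⟩
      exact hgood x (hit_initSeg.1 hx).2 ht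
    have hev : ∀ j, ∃ N, j < l → ∀ k ≥ N, R j (initSeg F k) := by
      intro j
      by_cases hj : j < l
      · obtain ⟨x, hx, ht⟩ := hmin j hj
        obtain ⟨m, hm⟩ := exists_hit (f := F) (φ := φ j) hx
        obtain ⟨N, hN⟩ := (hR3 j F).2 ⟨m, x, hm m le_rfl, ht⟩
        exact ⟨N, fun _ k hk => hR2 j _ _ (initSeg_prefix F hk) hN⟩
      · exact ⟨0, fun h => absurd h hj⟩
    choose N hN using hev
    refine ⟨joinSeq (oddPart F) (column n l (evenPart F)), ⟨fun y => ?_, fun x x' hx => ?_⟩,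
      e l, ⟨(Finset.range l).sup N, fun k hk => ?_⟩, he l F⟩
    · unfold joinSeq
      split_ifs
      exacts [hr2 _, hg2 _]
    · rw [evenPart_joinSeq, oddPart_joinSeq] at *
      rw [hr x hx]
      exact ⟨fun hx' => hr x' hx', fun hx' => hgood x' hx'⟩
    · beta_reduce
      have : cnt (initSeg F k) = l := by
        have hfil : ((List.range n).filter fun i => ∀ j < i + 1, R j (initSeg F k)) =
            List.range l := by
          obtain ⟨d, rfl⟩ := Nat.exists_eq_add_of_le hl
          rw [List.range_add, List.filter_append, List.filter_eq_self.2, List.filter_eq_nil_iff.2,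
            List.append_nil]
          · intro i hi
            obtain ⟨i, -, rfl⟩ := List.mem_map.1 hi
            rw [decide_eq_true_eq]
            exact fun H => hnot k (H l (by omega))
          · intro i hi
            rw [decide_eq_true_eq]
            intro j hj
            have hjl : j < l := by have := List.mem_range.1 hi; omega
            exact hN j hjl k ((Finset.le_sup (Finset.mem_range.2 hjl)).trans hk)
        change List.length _ = l
        rw [hfil, List.length_range]
      rw [this, heList l hl]

/-! ### Mixed radix representations -/

theorem exists_mixed_digits {π ρ : ℕ → ℕ} (h0 : π 0 = 1) (hs : ∀ y, π (y + 1) = π y * ρ y)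
    {f : ℕ → ℕ} {c : ℕ} (hf : ∀ y < c, f y < ρ y) :
    ∃ z < π c, ∀ y < c, z / π y % ρ y = f y := by
  induction c with
  | zero => exact ⟨0, by omega, fun y hy => absurd hy (Nat.not_lt_zero y)⟩
  | succ c ih =>
    obtain ⟨z, hz, H⟩ := ih fun y hy => hf y (by omega)
    refine ⟨z + π c * f c, ?_, fun y hy => ?_⟩
    · have : π c * (f c + 1) ≤ π c * ρ c := Nat.mul_le_mul_left _ (hf c (by omega))
      rw [hs]
      rw [mul_add] at this
      omega
    · rcases Nat.lt_succ_iff_lt_or_eq.1 hy with hy | rfl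
      · have hdvd : π (y + 1) ∣ π c := by
          have hyc : y + 1 ≤ c := hy
          clear ih hz H hf
          induction c, hyc using Nat.le_induction with
          | base => exact dvd_rfl
          | succ m hm ih => exact (ih (by omega) (by omega)).trans (hs m ▸ dvd_mul_right _ _)
        obtain ⟨m, hm⟩ := hdvd
        have hpos : 0 < π y := by
          rcases Nat.eq_zero_or_pos (π y) with h | h
          · rw [hm, hs, h] at hz
            simp at hz
          · exact h
        rw [hm, hs, mul_assoc, mul_assoc, Nat.add_mul_div_left _ _ hpos, Nat.add_mul_mod_self_left]
        exact H y hy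
      · rw [Nat.add_mul_div_left _ _ (Nat.zero_lt_of_lt hz), Nat.div_eq_of_lt hz, zero_add,
          Nat.mod_eq_of_lt (hf y hy)]

/-- The digit of `w` with index `i` in base `M`. -/
def digit (M w i : ℕ) : ℕ := w / M ^ i % M

theorem exists_digits {M c : ℕ} {f : ℕ → ℕ} (hf : ∀ i < c, f i < M) :
    ∃ w < M ^ c, ∀ i < c, digit M w i = f i :=
  exists_mixed_digits (π := fun i => M ^ i) (ρ := fun _ => M) (pow_zero M) (fun y => pow_succ M y) hf

theorem eq_of_digits {M c u v : ℕ} (hu : u < M ^ c) (hv : v < M ^ c)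
    (h : ∀ i < c, digit M u i = digit M v i) : u = v := by
  have H : ∀ d ≤ c, u % M ^ d = v % M ^ d := by
    intro d
    induction d with
    | zero => simp [Nat.mod_one]
    | succ d ih =>
      intro hd
      rw [Nat.mod_pow_succ, Nat.mod_pow_succ, ih (by omega)]
      have := h d hd
      unfold digit at this
      rw [this]
  have := H c le_rfl
  rwa [Nat.mod_eq_of_lt hu, Nat.mod_eq_of_lt hv] at this

theorem primrec_digit : Primrec fun p : ℕ × ℕ × ℕ => digit p.1 p.2.1 p.2.2 :=
  Primrec.nat_mod.comp (Primrec.nat_div.comp (Primrec.fst.comp Primrec.snd)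
    (primrec_pow.comp Primrec.fst (Primrec.snd.comp Primrec.snd))) Primrec.fst

/-- A set of numbers all digits of which are taken from a small set is small. -/
theorem card_le_of_digits {M c N : ℕ} {K : Set ℕ}
    (hK : ∀ T : Finset ℕ, (∀ v ∈ T, v ∈ K) → T.card ≤ N) {S : Finset ℕ}
    (hS : ∀ u ∈ S, u < M ^ c ∧ ∀ i < c, digit M u i ∈ K) : S.card ≤ N ^ c := by
  classical
  let T : Finset ℕ := S.biUnion fun u => (Finset.range c).image (digit M u)
  have hT : ∀ v ∈ T, v ∈ K := by
    intro v hv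
    obtain ⟨u, hu, hv⟩ := Finset.mem_biUnion.1 hv
    obtain ⟨i, hi, rfl⟩ := Finset.mem_image.1 hv
    exact (hS u hu).2 i (Finset.mem_range.1 hi)
  have hcard : S.card ≤ (Fintype.piFinset fun _ : Fin c => T).card := by
    refine Finset.card_le_card_of_injOn (fun u (i : Fin c) => digit M u i) (fun u hu => ?_) ?_
    · refine Finset.mem_coe.2 (Fintype.mem_piFinset.2 fun i => ?_)
      exact Finset.mem_biUnion.2 ⟨u, hu, Finset.mem_image_of_mem _ (Finset.mem_range.2 i.2)⟩
    · intro u hu v hv huv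
      exact eq_of_digits (hS u hu).1 (hS v hv).1 fun i hi => congrFun huv ⟨i, hi⟩
  rw [Fintype.card_piFinset_const] at hcard
  exact hcard.trans (Nat.pow_le_pow_left (hK T hT) c)

/-! ### Functionals that combine two sequences of letters -/

/-- The value at N is computed from the first u N entries of the oracle. -/
theorem exists_local_index {Θ : ℕ → List ℕ → ℕ} {u : ℕ → ℕ} (hΘ : Primrec₂ Θ) (hu : Primrec u)
    {G : Baire → Baire} (H : ∀ f N n, u N ≤ n → Θ N (initSeg f n) = G f N) :
    ∃ e, ∀ f, ComputesTo e f (G f) := by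
  obtain ⟨e, he⟩ := exists_index_const
    (A := fun σ N => if u N ≤ σ.length then some (Θ N σ) else none)
    (Primrec.to_comp (Primrec.ite (Primrec.nat_le.comp (hu.comp Primrec.snd)
      (Primrec.list_length.comp Primrec.fst)) (Primrec.option_some.comp
        (hΘ.comp Primrec.snd Primrec.fst)) (Primrec.const none)))
  refine ⟨e, fun f => he _ _ ⟨fun k N v hv => ?_, fun N => ⟨u N, ?_⟩⟩⟩
  · rw [length_initSeg] at hv
    split_ifs at hv with h
    rw [← H f N k h]
    exact (Option.some.inj hv).symm
  · rw [length_initSeg, if_pos le_rfl, H f N _ le_rfl]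

/-- The letters of the column `(n, l)` in the sequence `mixed n k r t`. -/
def replaceDigit (k l : ℕ) (t : ℕ → ℕ) : ℕ → ℕ := fun x =>
  if x = k then digit (alphabet k) (t x) l else t x

/-- The sequence of bits whose columns `(m, l)` are given by `r` for `m ≠ n`, and for `m = n` by `t`
with the letter at `k` replaced by its digit with index `l`. -/
def mixed (n k : ℕ) (r t : ℕ → ℕ) : Baire := fun N =>
  bitSeq (if N.unpair.1.unpair.1 = n then replaceDigit k N.unpair.1.unpair.2 t else r) N.unpair.2

theorem column_mixed_self (n k l : ℕ) (r t : ℕ → ℕ) :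
    column n l (mixed n k r t) = bitSeq (replaceDigit k l t) := by
  funext y
  simp [column, mixed]

theorem column_mixed_of_ne {m n : ℕ} (h : m ≠ n) (k l : ℕ) (r t : ℕ → ℕ) :
    column m l (mixed n k r t) = bitSeq r := by
  funext y
  simp [column, mixed, h]

theorem primrec_bit : Primrec₂ fun v i : ℕ => v / 2 ^ i % 2 :=
  Primrec.nat_mod.comp (Primrec.nat_div.comp Primrec.fst (primrec_two_pow.comp Primrec.snd))
    (Primrec.const 2)

theorem getD_initSeg (f : Baire) {i n : ℕ} (h : i < n) : (initSeg f n).getD i 0 = f i := by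
  rw [List.getD_eq_getElem?_getD, getElem?_initSeg_of_lt f h]; rfl

theorem consSeq_joinSeq_odd (k : ℕ) (r t : ℕ → ℕ) (x : ℕ) :
    consSeq k (joinSeq r t) (2 * x + 1) = r x := by
  simp [consSeq, joinSeq]

theorem consSeq_joinSeq_even (k : ℕ) (r t : ℕ → ℕ) (x : ℕ) :
    consSeq k (joinSeq r t) (2 * x + 2) = t x := by
  have h1 : (2 * x + 1) % 2 ≠ 0 := by omega
  have h2 : (2 * x + 1) / 2 = x := by omega
  simp [consSeq, joinSeq, h2]

/-- One index of a functional that simulates the functionals `e` and `i`. -/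
theorem exists_simulation_index (n e i : ℕ) : ∃ e', ∀ k r t r' p, ComputesTo e (bitSeq r) r' →
    ComputesTo i (joinSeq (mixed n k r t) r') p →
    ComputesTo e' (consSeq k (joinSeq r t)) p := by
  have hx : Primrec fun q : ℕ × List ℕ => q.1.unpair.2.unpair.1 :=
    Primrec.fst.comp (Primrec.unpair.comp (Primrec.snd.comp (Primrec.unpair.comp Primrec.fst)))
  have hi : Primrec fun q : ℕ × List ℕ => q.1.unpair.2.unpair.2 :=
    Primrec.snd.comp (Primrec.unpair.comp (Primrec.snd.comp (Primrec.unpair.comp Primrec.fst)))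
  have hm : Primrec fun q : ℕ × List ℕ => q.1.unpair.1.unpair.1 :=
    Primrec.fst.comp (Primrec.unpair.comp (Primrec.fst.comp (Primrec.unpair.comp Primrec.fst)))
  have hl : Primrec fun q : ℕ × List ℕ => q.1.unpair.1.unpair.2 :=
    Primrec.snd.comp (Primrec.unpair.comp (Primrec.fst.comp (Primrec.unpair.comp Primrec.fst)))
  have hget : Primrec₂ fun (σ : List ℕ) (j : ℕ) => σ.getD j 0 := Primrec.list_getD 0
  -- Only the entries 0, 2 * x + 1 and 2 * x + 2 with x ≤ N are read, so 2 * N + 3 entries are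
  -- enough.
  have hu : Primrec fun N : ℕ => 2 * N + 3 :=
    Primrec.nat_add.comp primrec_double (Primrec.const 3)
  obtain ⟨e₁, he₁⟩ := exists_local_index (u := fun N => 2 * N + 3)
    (Θ := fun N σ => σ.getD (2 * N.unpair.1 + 1) 0 / 2 ^ N.unpair.2 % 2)
    (G := fun f N => f (2 * N.unpair.1 + 1) / 2 ^ N.unpair.2 % 2)
    (primrec_bit.comp (hget.comp Primrec.snd (Primrec.succ.comp (primrec_double.comp
      (Primrec.fst.comp (Primrec.unpair.comp Primrec.fst)))))
      (Primrec.snd.comp (Primrec.unpair.comp Primrec.fst))) hu fun f N m hm => by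
        have := Nat.unpair_left_le N
        rw [getD_initSeg f (by omega)]
  let Θ : (ℕ → ℕ) → ℕ → ℕ := fun F N => (if N.unpair.1.unpair.1 = n then
    if N.unpair.2.unpair.1 = F 0 then
      digit (alphabet (F 0)) (F (2 * N.unpair.2.unpair.1 + 2)) N.unpair.1.unpair.2
    else F (2 * N.unpair.2.unpair.1 + 2) else F (2 * N.unpair.2.unpair.1 + 1)) /
      2 ^ N.unpair.2.unpair.2 % 2
  obtain ⟨e₂, he₂⟩ := exists_local_index (u := fun N => 2 * N + 3)
    (Θ := fun N σ => Θ (fun j => σ.getD j 0) N) (G := Θ) (by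
      have h0 : Primrec fun q : ℕ × List ℕ => q.2.getD 0 0 :=
        hget.comp Primrec.snd (Primrec.const 0)
      have ho : Primrec fun q : ℕ × List ℕ => q.2.getD (2 * q.1.unpair.2.unpair.1 + 1) 0 :=
        hget.comp Primrec.snd (Primrec.succ.comp (primrec_double.comp hx))
      have hev : Primrec fun q : ℕ × List ℕ => q.2.getD (2 * q.1.unpair.2.unpair.1 + 2) 0 :=
        hget.comp Primrec.snd (Primrec.nat_add.comp (primrec_double.comp hx) (Primrec.const 2))
      refine primrec_bit.comp (Primrec.ite (Primrec.eq.comp hm (Primrec.const n))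
        (Primrec.ite (Primrec.eq.comp hx h0) ?_ hev) ho) hi
      exact primrec_digit.comp ((primrec_alphabet.comp h0).pair (hev.pair hl))) hu
    fun f N m hm => by
      have h1 := Nat.unpair_left_le N.unpair.2
      have h2 := Nat.unpair_right_le N
      simp only [Θ]
      rw [getD_initSeg f (by omega), getD_initSeg f (by omega), getD_initSeg f (by omega)]
  obtain ⟨κ, -, hκ⟩ := exists_comp_index
  obtain ⟨μ, -, hμ⟩ := exists_join_index
  refine ⟨κ i (μ e₂ (κ e e₁)), fun k r t r' p h1 h2 => ?_⟩
  have hr : (fun N : ℕ => consSeq k (joinSeq r t) (2 * N.unpair.1 + 1) / 2 ^ N.unpair.2 % 2) =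
      bitSeq r := by
    funext N
    rw [consSeq_joinSeq_odd]
    rfl
  have ht : Θ (consSeq k (joinSeq r t)) = mixed n k r t := by
    funext N
    have h0 : consSeq k (joinSeq r t) 0 = k := rfl
    simp only [Θ, consSeq_joinSeq_odd, consSeq_joinSeq_even, h0, mixed, bitSeq]
    split_ifs with h3 h4
    · rw [replaceDigit, if_pos h4]
    · rw [replaceDigit, if_neg h4]
    · rfl
  have H1 := he₁ (consSeq k (joinSeq r t))
  have H2 := he₂ (consSeq k (joinSeq r t))
  rw [hr] at H1
  rw [ht] at H2
  exact hκ _ _ _ _ _ (hμ _ _ _ _ _ H2 (hκ _ _ _ _ _ H1 h1)) h2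

/-! ### Finite information about the simulated functionals -/

/-- The part of the sequence `consSeq k (joinSeq r t)` that is determined by initial segments of `r`
and `t`. -/
def oracleString (k : ℕ) (ρ τ : List ℕ) : List ℕ :=
  initSeg (consSeq k (joinSeq (ρ.getD · 0) (τ.getD · 0))) (2 * min ρ.length τ.length + 1)

theorem oracleString_initSeg (k m m' : ℕ) (r t : Baire) :
    oracleString k (initSeg r m) (initSeg t m') =
      initSeg (consSeq k (joinSeq r t)) (2 * min m m' + 1) := by
  unfold oracleString
  rw [length_initSeg, length_initSeg]
  refine initSeg_congr fun y hy => ?_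
  unfold consSeq joinSeq
  split_ifs
  · rfl
  · exact getD_initSeg r (by omega)
  · exact getD_initSeg t (by omega)

theorem primrec_oracleString :
    Primrec fun p : ℕ × List ℕ × List ℕ => oracleString p.1 p.2.1 p.2.2 := by
  have hy : Primrec fun q : (ℕ × List ℕ × List ℕ) × ℕ => (q.2 - 1) / 2 :=
    Primrec.nat_div.comp (Primrec.pred.comp Primrec.snd) (Primrec.const 2)
  have hρ : Primrec fun q : (ℕ × List ℕ × List ℕ) × ℕ => q.1.2.1 :=
    Primrec.fst.comp (Primrec.snd.comp Primrec.fst)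
  have hτ : Primrec fun q : (ℕ × List ℕ × List ℕ) × ℕ => q.1.2.2 :=
    Primrec.snd.comp (Primrec.snd.comp Primrec.fst)
  refine Primrec.list_map (Primrec.list_range.comp (Primrec.succ.comp (primrec_double.comp
    (Primrec.nat_min.comp (Primrec.list_length.comp (Primrec.fst.comp Primrec.snd))
      (Primrec.list_length.comp (Primrec.snd.comp Primrec.snd)))))) (Primrec.ite
    (Primrec.eq.comp Primrec.snd (Primrec.const 0)) (Primrec.fst.comp Primrec.fst) (Primrec.ite
      (Primrec.eq.comp (Primrec.nat_mod.comp (Primrec.pred.comp Primrec.snd) (Primrec.const 2))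
        (Primrec.const 0)) ((Primrec.list_getD 0).comp hρ hy) ((Primrec.list_getD 0).comp hτ hy)))

/-- The functional with index `e` gives the bits of `V` as the parities of its values at the
positions of the two letters at `k`, when its oracle is `oracleString k ρ τ`. -/
def GivesBits (e k : ℕ) (ρ τ : List ℕ) (V : ℕ) : Prop :=
  ∀ y < 2 * width k, (approx e (2 * Nat.pair k (y / 2) + y % 2) (oracleString k ρ τ)).map (· % 2) =
    some (V / 2 ^ y % 2)

theorem primrec_approx_comp {γ : Type*} [Primcodable γ] {e n : γ → ℕ} {σ : γ → List ℕ}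
    (he : Primrec e) (hn : Primrec n) (hσ : Primrec σ) :
    Primrec fun x => approx (e x) (n x) (σ x) :=
  primrec_approx.comp (he.pair (hn.pair hσ))

theorem primrecPred_givesBits : PrimrecPred fun p : ℕ × ℕ × List ℕ × List ℕ × ℕ =>
    GivesBits p.1 p.2.1 p.2.2.1 p.2.2.2.1 p.2.2.2.2 := by
  have hy : Primrec fun q : ℕ × ℕ × ℕ × List ℕ × List ℕ × ℕ => q.1 := Primrec.fst
  have he : Primrec fun q : ℕ × ℕ × ℕ × List ℕ × List ℕ × ℕ => q.2.1 := Primrec.fst.comp Primrec.snd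
  have hk : Primrec fun q : ℕ × ℕ × ℕ × List ℕ × List ℕ × ℕ => q.2.2.1 := Primrec.fst.comp (Primrec.snd.comp Primrec.snd)
  have hV : Primrec fun q : ℕ × ℕ × ℕ × List ℕ × List ℕ × ℕ => q.2.2.2.2.2 := Primrec.snd.comp (Primrec.snd.comp
    (Primrec.snd.comp (Primrec.snd.comp Primrec.snd)))
  have hO : Primrec fun q : ℕ × ℕ × ℕ × List ℕ × List ℕ × ℕ => oracleString q.2.2.1 q.2.2.2.1 q.2.2.2.2.1 :=
    primrec_oracleString.comp (hk.pair ((Primrec.fst.comp (Primrec.snd.comp (Primrec.snd.comp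
      Primrec.snd))).pair (Primrec.fst.comp (Primrec.snd.comp (Primrec.snd.comp
        (Primrec.snd.comp Primrec.snd))))))
  have hpos : Primrec fun q : ℕ × ℕ × ℕ × List ℕ × List ℕ × ℕ => 2 * Nat.pair q.2.2.1 (q.1 / 2) + q.1 % 2 :=
    Primrec.nat_add.comp (primrec_double.comp (Primrec₂.natPair.comp hk
      (Primrec.nat_div.comp hy (Primrec.const 2)))) (Primrec.nat_mod.comp hy (Primrec.const 2))
  have hL : Primrec fun q : ℕ × ℕ × ℕ × List ℕ × List ℕ × ℕ =>
      approx q.2.1 (2 * Nat.pair q.2.2.1 (q.1 / 2) + q.1 % 2)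
        (oracleString q.2.2.1 q.2.2.2.1 q.2.2.2.2.1) :=
    primrec_approx_comp he hpos hO
  have hL' : Primrec fun q : ℕ × ℕ × ℕ × List ℕ × List ℕ × ℕ =>
      (approx q.2.1 (2 * Nat.pair q.2.2.1 (q.1 / 2) + q.1 % 2)
        (oracleString q.2.2.1 q.2.2.2.1 q.2.2.2.2.1)).map (· % 2) :=
    Primrec.option_map hL (Primrec.nat_mod.comp Primrec.snd (Primrec.const 2)).to₂
  have hR : PrimrecRel fun (y : ℕ) (p : ℕ × ℕ × List ℕ × List ℕ × ℕ) =>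
      (approx p.1 (2 * Nat.pair p.2.1 (y / 2) + y % 2)
        (oracleString p.2.1 p.2.2.1 p.2.2.2.1)).map (· % 2) = some (p.2.2.2.2 / 2 ^ y % 2) :=
    Primrec.eq.comp hL' (Primrec.option_some.comp (primrec_bit.comp hV hy))
  exact primrecPred_forall_lt hR
    (primrec_double.comp (primrec_width.comp (Primrec.fst.comp Primrec.snd)))

theorem GivesBits.mono {e k V m m' : ℕ} {r : Baire} {τ τ' : List ℕ}
    (h : GivesBits e k (initSeg r m) τ V) (hm : m ≤ m') (hτ : τ <+: τ') :
    GivesBits e k (initSeg r m') τ' V := by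
  have hτ1 : τ' = initSeg (τ'.getD · 0) τ'.length := by
    refine List.ext_getElem? fun i => ?_
    rw [getElem?_initSeg]
    split_ifs with hi
    · rw [List.getD_eq_getElem?_getD, List.getElem?_eq_getElem hi]; rfl
    · exact List.getElem?_eq_none (by omega)
  have hτ2 : τ = initSeg (τ'.getD · 0) τ.length := eq_initSeg_of_prefix (hτ1 ▸ hτ)
  intro y hy
  have := h y hy
  rw [Option.map_eq_some_iff] at this ⊢
  obtain ⟨v, hv, hvV⟩ := this
  refine ⟨v, approx_mono ?_ hv, hvV⟩
  have hle := hτ.length_le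
  rw [hτ1, hτ2, oracleString_initSeg, oracleString_initSeg]
  exact initSeg_prefix _ (by omega)

/-- The letter of the first (`b = 0`) or of the second (`b = 1`) of two sequences, the bits of which
are interleaved in `V`. -/
def letterPart (k V b : ℕ) : ℕ := bitSum (fun i => V / 2 ^ (2 * i + b)) (width k)

theorem GivesBits.letterPart_eq {e k V m m' b : ℕ} {r t p : Baire}
    (h : GivesBits e k (initSeg r m) (initSeg t m') V)
    (hp : ComputesTo e (consSeq k (joinSeq r t)) p) (hb : b < 2) :
    letterPart k V b = letter (fun y => p (2 * y + b)) k := by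
  refine bitSum_congr fun i hi => ?_
  have h1 := h (2 * i + b) (by omega)
  have h2 : (2 * i + b) / 2 = i := by omega
  have h3 : (2 * i + b) % 2 = b := by omega
  rw [h2, h3, oracleString_initSeg, Option.map_eq_some_iff] at h1
  obtain ⟨v, hv, hvV⟩ := h1
  rw [← hvV, hp.eq_of_approx hv]

theorem div_bitSum_mod (φ : ℕ → ℕ) {y L : ℕ} (h : y < L) :
    bitSum φ L / 2 ^ y % 2 = φ y % 2 := by
  induction L with
  | zero => omega
  | succ L ih =>
    rw [bitSum]
    rcases Nat.lt_succ_iff_lt_or_eq.1 h with h | rfl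
    · obtain ⟨d, rfl⟩ := Nat.exists_eq_add_of_lt h
      have : φ (y + d + 1) % 2 * 2 ^ (y + d + 1) =
          2 ^ y * (2 * (φ (y + d + 1) % 2 * 2 ^ d)) := by ring
      rw [this, Nat.add_mul_div_left _ _ (by positivity), Nat.add_mul_mod_self_left, ih h]
    · rw [Nat.add_mul_div_right _ _ (by positivity), Nat.div_eq_of_lt (bitSum_lt _ _), zero_add,
        Nat.mod_mod]

/-- As only parities are recorded, every total output provides a number V with 2 * `width k` bits,
even if it is not a sequence of bits. -/
theorem exists_givesBits {e k : ℕ} {r t p : Baire}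
    (hp : ComputesTo e (consSeq k (joinSeq r t)) p) :
    ∃ V < alphabet k ^ 2, ∃ N, ∀ m ≥ N, GivesBits e k (initSeg r m) (initSeg t m) V := by
  refine ⟨bitSum (fun y => p (2 * Nat.pair k (y / 2) + y % 2)) (2 * width k), ?_, ?_⟩
  · rw [alphabet, ← pow_mul, mul_comm]
    exact bitSum_lt _ _
  · choose N hN using fun y => hp.exists_approx (2 * Nat.pair k (y / 2) + y % 2)
    refine ⟨(Finset.range (2 * width k)).sup N, fun m hm y hy => ?_⟩
    have h1 : N y ≤ m := (Finset.le_sup (Finset.mem_range.2 hy)).trans hm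
    rw [oracleString_initSeg, min_self, hN y _ (by omega)]
    rw [Option.map_some, div_bitSum_mod _ hy]

/-! ### Searching for a bushy set of agreeing computations -/

/-- A guess about a functional in the block `k` is `0` (no guess) or `V + 1`, where `V` is a number
with `2 * width k` bits. -/
def guessBase (k : ℕ) : ℕ := alphabet k ^ 2 + 1

theorem primrec_guessBase : Primrec guessBase :=
  Primrec.succ.comp (primrec_pow.comp primrec_alphabet (Primrec.const 2))

/-- The guesses that are the digits of `w` are correct for the oracle strings `ρ` and `τ`. -/
def Compatible (c : ℕ) (E : List ℕ) (k w : ℕ) (ρ τ : List ℕ) : Prop :=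
  ∀ i < c, digit (guessBase k) w i ≠ 0 →
    GivesBits (E.getD i 0) k ρ τ (digit (guessBase k) w i - 1)

/-- The number of guesses that are made by `w`. -/
def guessCount (c k w : ℕ) : ℕ :=
  ((List.range c).filter fun i => digit (guessBase k) w i ≠ 0).length

/-- The number of letters at `x` in the tree in which the letters with tag `n` are trivial. -/
def outerLetters (n x : ℕ) : ℕ := if tag x = n then 1 else alphabet x

/-- The branching at `x` that makes a subset of the outer tree large. -/
def outerThreshold (n s x : ℕ) : ℕ := if tag x = n then 1 else budget x ^ s

/-- The number of letters at `x` in the tree in which the letter at `k` stands for `n + 1` letters. -/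
def innerLetters (n k x : ℕ) : ℕ := if x = k then alphabet k ^ (n + 1) else alphabet x

/-- The branching at `x` that makes a subset of the inner tree large. -/
def innerThreshold (k t x : ℕ) : ℕ := if x = k then alphabet k ^ t else budget x ^ t

/-- The guesses `w` are correct for large sets of oracle strings `ρ'` and `τ` above `ρ` and `τ₀`. -/
def Agreeing (c : ℕ) (E : List ℕ) (n k s t w : ℕ) (τ₀ ρ : List ℕ) : Prop :=
  Big (outerLetters n) (outerThreshold n s)
    {ρ' | Big (innerLetters n k) (innerThreshold k t) {τ | Compatible c E k w ρ' τ} τ₀} ρ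

theorem primrec_digit_guess : Primrec fun p : ℕ × ℕ × ℕ => digit (guessBase p.1) p.2.1 p.2.2 :=
  primrec_digit.comp ((primrec_guessBase.comp Primrec.fst).pair Primrec.snd)

theorem primrec_digit_guess_comp {γ : Type*} [Primcodable γ] {k w i : γ → ℕ} (hk : Primrec k)
    (hw : Primrec w) (hi : Primrec i) : Primrec fun x => digit (guessBase (k x)) (w x) (i x) :=
  primrec_digit_guess.comp (hk.pair (hw.pair hi))

theorem primrec_guessCount (c : ℕ) : Primrec₂ (guessCount c) := by
  have hR : PrimrecRel fun (i : ℕ) (p : ℕ × ℕ) => digit (guessBase p.1) p.2 i ≠ 0 :=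
    PrimrecPred.not (Primrec.eq.comp (primrec_digit_guess.comp ((Primrec.fst.comp Primrec.snd).pair
      ((Primrec.snd.comp Primrec.snd).pair Primrec.fst))) (Primrec.const 0))
  exact Primrec.list_length.comp (primrec_filter_range hR (Primrec.const c))

theorem primrecPred_givesBits_comp {γ : Type*} [Primcodable γ] {e k V : γ → ℕ}
    {ρ τ : γ → List ℕ} (he : Primrec e) (hk : Primrec k) (hρ : Primrec ρ) (hτ : Primrec τ)
    (hV : Primrec V) : PrimrecPred fun x => GivesBits (e x) (k x) (ρ x) (τ x) (V x) :=
  primrecPred_givesBits.comp (he.pair (hk.pair (hρ.pair (hτ.pair hV))))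

theorem primrecPred_compatible (c : ℕ) (E : List ℕ) :
    PrimrecPred fun p : ℕ × ℕ × List ℕ × List ℕ => Compatible c E p.1 p.2.1 p.2.2.1 p.2.2.2 := by
  have hk : Primrec fun q : ℕ × ℕ × ℕ × List ℕ × List ℕ => q.2.1 := Primrec.fst.comp Primrec.snd
  have hd : Primrec fun q : ℕ × ℕ × ℕ × List ℕ × List ℕ =>
      digit (guessBase q.2.1) q.2.2.1 q.1 :=
    primrec_digit_guess_comp hk (Primrec.fst.comp (Primrec.snd.comp Primrec.snd)) Primrec.fst
  have hE : Primrec fun q : ℕ × ℕ × ℕ × List ℕ × List ℕ => E.getD q.1 0 :=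
    (Primrec.list_getD 0).comp (Primrec.const E) Primrec.fst
  have hρ : Primrec fun q : ℕ × ℕ × ℕ × List ℕ × List ℕ => q.2.2.2.1 :=
    Primrec.fst.comp (Primrec.snd.comp (Primrec.snd.comp Primrec.snd))
  have hτ : Primrec fun q : ℕ × ℕ × ℕ × List ℕ × List ℕ => q.2.2.2.2 :=
    Primrec.snd.comp (Primrec.snd.comp (Primrec.snd.comp Primrec.snd))
  have hG : PrimrecPred fun q : ℕ × ℕ × ℕ × List ℕ × List ℕ => GivesBits (E.getD q.1 0) q.2.1
      q.2.2.2.1 q.2.2.2.2 (digit (guessBase q.2.1) q.2.2.1 q.1 - 1) :=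
    primrecPred_givesBits_comp hE hk hρ hτ (Primrec.pred.comp hd)
  have hR : PrimrecRel fun (i : ℕ) (p : ℕ × ℕ × List ℕ × List ℕ) =>
      digit (guessBase p.1) p.2.1 i = 0 ∨ GivesBits (E.getD i 0) p.1 p.2.2.1 p.2.2.2
        (digit (guessBase p.1) p.2.1 i - 1) :=
    PrimrecPred.or (Primrec.eq.comp hd (Primrec.const 0)) hG
  refine (primrecPred_forall_lt hR (Primrec.const c)).of_eq fun p => ?_
  exact forall₂_congr fun i _ => or_iff_not_imp_left

theorem primrec_outerLetters (n : ℕ) : Primrec (outerLetters n) :=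
  Primrec.ite (Primrec.eq.comp primrec_tag (Primrec.const n)) (Primrec.const 1) primrec_alphabet

theorem primrec_outerThreshold (n : ℕ) : Primrec₂ (outerThreshold n) :=
  Primrec.ite (Primrec.eq.comp (primrec_tag.comp Primrec.snd) (Primrec.const n)) (Primrec.const 1)
    (primrec_pow.comp (primrec_budget.comp Primrec.snd) Primrec.fst)

theorem primrec_innerLetters (n : ℕ) : Primrec₂ (innerLetters n) :=
  Primrec.ite (Primrec.eq.comp Primrec.snd Primrec.fst)
    (primrec_pow.comp (primrec_alphabet.comp Primrec.fst) (Primrec.const (n + 1)))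
    (primrec_alphabet.comp Primrec.snd)

theorem primrec_innerThreshold :
    Primrec fun p : (ℕ × ℕ) × ℕ => innerThreshold p.1.1 p.1.2 p.2 :=
  Primrec.ite (Primrec.eq.comp Primrec.snd (Primrec.fst.comp Primrec.fst))
    (primrec_pow.comp (primrec_alphabet.comp (Primrec.fst.comp Primrec.fst))
      (Primrec.snd.comp Primrec.fst))
    (primrec_pow.comp (primrec_budget.comp Primrec.snd) (Primrec.snd.comp Primrec.fst))

/-- Compatibility is decidable, and forming the big sets preserves semidecidability, first for the
inner tree and then for the outer one. This is why a program can search for agreement. -/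
theorem isSigma1_agreeing (c : ℕ) (E : List ℕ) (n : ℕ) :
    IsSigma1 fun p : (ℕ × ℕ × ℕ × ℕ × List ℕ) × List ℕ =>
      Agreeing c E n p.1.1 p.1.2.1 p.1.2.2.1 p.1.2.2.2.1 p.1.2.2.2.2 p.2 := by
  have hinner := IsSigma1.big (γ := (ℕ × ℕ) × ℕ × List ℕ)
    (α := fun p x => innerLetters n p.1.1 x) (β := fun p x => innerThreshold p.1.1 p.1.2 x)
    (R := fun p τ => Compatible c E p.1.1 p.2.1 p.2.2 τ)
    ((primrec_innerLetters n).comp (Primrec.fst.comp (Primrec.fst.comp Primrec.fst)) Primrec.snd)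
    (primrec_innerThreshold.comp ((Primrec.fst.comp Primrec.fst).pair Primrec.snd))
    (.of_primrecPred ((primrecPred_compatible c E).comp
      ((Primrec.fst.comp (Primrec.fst.comp Primrec.fst)).pair
        ((Primrec.fst.comp (Primrec.snd.comp Primrec.fst)).pair
          ((Primrec.snd.comp (Primrec.snd.comp Primrec.fst)).pair Primrec.snd)))))
  have h1 : Primrec fun q : (ℕ × ℕ × ℕ × ℕ × List ℕ) × List ℕ => q.1.1 :=
    Primrec.fst.comp Primrec.fst
  have h2 : Primrec fun q : (ℕ × ℕ × ℕ × ℕ × List ℕ) × List ℕ => q.1.2.2 :=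
    Primrec.snd.comp (Primrec.snd.comp Primrec.fst)
  exact IsSigma1.big (γ := ℕ × ℕ × ℕ × ℕ × List ℕ)
    (α := fun _ x => outerLetters n x) (β := fun p x => outerThreshold n p.2.1 x)
    (R := fun p ρ' => Big (innerLetters n p.1) (innerThreshold p.1 p.2.2.1)
      {τ | Compatible c E p.1 p.2.2.2.1 ρ' τ} p.2.2.2.2)
    ((primrec_outerLetters n).comp Primrec.snd)
    ((primrec_outerThreshold n).comp (Primrec.fst.comp (Primrec.snd.comp Primrec.fst)) Primrec.snd)
    (hinner.comp (f := fun q : (ℕ × ℕ × ℕ × ℕ × List ℕ) × List ℕ =>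
      (((q.1.1, q.1.2.2.1), q.1.2.2.2.1, q.2), q.1.2.2.2.2))
      (((h1.pair (Primrec.fst.comp h2)).pair
        ((Primrec.fst.comp (Primrec.snd.comp h2)).pair Primrec.snd)).pair
        (Primrec.snd.comp (Primrec.snd.comp h2))))

/-- The string of length `m` of the letters that are coded by `z`. -/
def decodeLetters (z m : ℕ) : List ℕ := initSeg (fun x => z / 2 ^ offset x % alphabet x) m

theorem primrec_decodeLetters : Primrec₂ decodeLetters :=
  Primrec.list_map (Primrec.list_range.comp Primrec.snd) (Primrec.nat_mod.comp
    (Primrec.nat_div.comp (Primrec.fst.comp Primrec.fst)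
      (primrec_two_pow.comp (primrec_offset.comp Primrec.snd)))
    (primrec_alphabet.comp Primrec.snd))

/-- The code is below 2 ^ `offset k`, so its digit at k is 0. The same code therefore serves for k +
1 letters when the last one is 0. -/
theorem exists_decodeLetters {r : Baire} {k : ℕ} (hr : ∀ x < k, r x < alphabet x) :
    ∃ z < 2 ^ offset k, decodeLetters z k = initSeg r k ∧
      (r k = 0 → decodeLetters z (k + 1) = initSeg r (k + 1)) := by
  obtain ⟨z, hz, H⟩ := exists_mixed_digits (π := fun x => 2 ^ offset x) (ρ := alphabet) rfl
    (fun y => by rw [offset_succ, pow_add, alphabet]) hr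
  refine ⟨z, hz, initSeg_congr H, fun h0 => initSeg_congr fun x hx => ?_⟩
  rcases Nat.lt_succ_iff_lt_or_eq.1 hx with hx | rfl
  · exact H x hx
  · rw [h0, Nat.div_eq_of_lt hz, Nat.zero_mod]

theorem pair_lt_sq {a b m : ℕ} (ha : a < m) (hb : b < m) : Nat.pair a b < m ^ 2 :=
  (Nat.pair_lt_max_add_one_sq a b).trans_le (Nat.pow_le_pow_left (by omega) 2)

theorem primrec_letterPart : Primrec fun p : ℕ × ℕ × ℕ => letterPart p.1 p.2.1 p.2.2 := by
  have hi : Primrec₂ fun (p : ℕ × ℕ × ℕ) (i : ℕ) => p.2.1 / 2 ^ (2 * i + p.2.2) :=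
    Primrec.nat_div.comp (Primrec.fst.comp (Primrec.snd.comp Primrec.fst))
      (primrec_two_pow.comp (Primrec.nat_add.comp (primrec_double.comp Primrec.snd)
        (Primrec.snd.comp (Primrec.snd.comp Primrec.fst))))
  exact primrec_bitSum hi (primrec_width.comp Primrec.fst)

/-- A program that searches for agreeing computations, and the values of which in the block `k` are
the letters that are guessed. -/
theorem exists_search (c : ℕ) (E : List ℕ) (n : ℕ) {s t : ℕ → ℕ} (hs : Primrec s) (ht : Primrec t) :
    ∃ q, ∀ k, k.unpair.1 = q → (∀ j ≤ c, ∀ i < c, ∀ b < 2, Nat.pair (Nat.pair j i) b ≤ k) →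
      ∀ r u : Baire, (∀ x < k, r x < alphabet x) → r k = 0 → (∀ x < k, u x < alphabet x) →
      ∀ j ≤ c, (∃ w, guessCount c k w = j ∧
        Agreeing c E n k (s j) (t j) w (initSeg u k) (initSeg r (k + 1))) →
      ∃ w, (guessCount c k w = j ∧
        Agreeing c E n k (s j) (t j) w (initSeg u k) (initSeg r (k + 1))) ∧
        ∀ i < c, ∀ b < 2, letterPart k (digit (guessBase k) w i - 1) b ∈ killed k := by
  let R : ℕ × List ℕ × List ℕ × ℕ → ℕ → Prop := fun x w =>
    guessCount c x.1 w = x.2.2.2 ∧ Agreeing c E n x.1 (s x.2.2.2) (t x.2.2.2) w x.2.1 x.2.2.1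
  have hR : IsSigma1 fun p : (ℕ × List ℕ × List ℕ × ℕ) × ℕ => R p.1 p.2 := by
    have hk : Primrec fun p : (ℕ × List ℕ × List ℕ × ℕ) × ℕ => p.1.1 :=
      Primrec.fst.comp Primrec.fst
    have hτ : Primrec fun p : (ℕ × List ℕ × List ℕ × ℕ) × ℕ => p.1.2.1 :=
      Primrec.fst.comp (Primrec.snd.comp Primrec.fst)
    have hρ : Primrec fun p : (ℕ × List ℕ × List ℕ × ℕ) × ℕ => p.1.2.2.1 :=
      Primrec.fst.comp (Primrec.snd.comp (Primrec.snd.comp Primrec.fst))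
    have hj : Primrec fun p : (ℕ × List ℕ × List ℕ × ℕ) × ℕ => p.1.2.2.2 :=
      Primrec.snd.comp (Primrec.snd.comp (Primrec.snd.comp Primrec.fst))
    refine (IsSigma1.of_primrecPred (Primrec.eq.comp
      ((primrec_guessCount c).comp hk Primrec.snd) hj)).and ?_
    exact (isSigma1_agreeing c E n).comp (f := fun p : (ℕ × List ℕ × List ℕ × ℕ) × ℕ =>
      ((p.1.1, s p.1.2.2.2, t p.1.2.2.2, p.2, p.1.2.1), p.1.2.2.1))
      ((hk.pair ((hs.comp hj).pair ((ht.comp hj).pair (Primrec.snd.pair hτ)))).pair hρ)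
  obtain ⟨f, hf, H⟩ := IsSigma1.exists_partrec hR
  -- The argument codes k, the two strings, j, i and b. The block number supplies k to the program,
  -- so no recursion theorem is needed. The input of the search ignores i and b, so all guessed
  -- letters come from the same w.
  let inp : ℕ → ℕ × List ℕ × List ℕ × ℕ := fun m => (m.unpair.1,
    decodeLetters m.unpair.2.unpair.1.unpair.2 m.unpair.1,
    decodeLetters m.unpair.2.unpair.1.unpair.1 (m.unpair.1 + 1),
    m.unpair.2.unpair.2.unpair.1.unpair.1)
  have hk : Primrec fun m : ℕ => m.unpair.1 := Primrec.fst.comp Primrec.unpair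
  have hz : Primrec fun m : ℕ => m.unpair.2.unpair := Primrec.unpair.comp
    (Primrec.snd.comp Primrec.unpair)
  have hst : Primrec fun m : ℕ => m.unpair.2.unpair.1.unpair :=
    Primrec.unpair.comp (Primrec.fst.comp hz)
  have hmisc : Primrec fun m : ℕ => m.unpair.2.unpair.2.unpair :=
    Primrec.unpair.comp (Primrec.snd.comp hz)
  have hji : Primrec fun m : ℕ => m.unpair.2.unpair.2.unpair.1.unpair :=
    Primrec.unpair.comp (Primrec.fst.comp hmisc)
  have hinp : Primrec inp := hk.pair
    ((primrec_decodeLetters.comp (Primrec.snd.comp hst) hk).pair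
      ((primrec_decodeLetters.comp (Primrec.fst.comp hst) (Primrec.succ.comp hk)).pair
        (Primrec.fst.comp hji)))
  let out : ℕ → ℕ → ℕ := fun m w => letterPart m.unpair.1
    (digit (guessBase m.unpair.1) w m.unpair.2.unpair.2.unpair.1.unpair.2 - 1)
    m.unpair.2.unpair.2.unpair.2
  have hout : Primrec₂ out := primrec_letterPart.comp ((hk.comp Primrec.fst).pair
    ((Primrec.pred.comp (primrec_digit_guess.comp ((hk.comp Primrec.fst).pair
      (Primrec.snd.pair ((Primrec.snd.comp hji).comp Primrec.fst))))).pair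
      ((Primrec.snd.comp hmisc).comp Primrec.fst)))
  have hpart : Partrec fun m => (f (inp m)).map (out m) :=
    (hf.comp hinp.to_comp).map hout.to_comp
  obtain ⟨C, hC⟩ := Code.exists_code.1 (Partrec.nat_iff.1 hpart)
  refine ⟨Encodable.encode C, fun k hkq hmis r u hr hr0 hu j hj hex => ?_⟩
  obtain ⟨w, hw, hwf⟩ := H (k, initSeg u k, initSeg r (k + 1), j) hex
  refine ⟨w, hw, fun i hi b hb => ?_⟩
  obtain ⟨zr, hzr, -, hzr'⟩ := exists_decodeLetters hr
  obtain ⟨zu, hzu, hzu', -⟩ := exists_decodeLetters hu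
  refine ⟨Nat.pair (Nat.pair zr zu) (Nat.pair (Nat.pair j i) b), ?_, ?_⟩
  -- This is where `budgetLog` comes from: the two codes below 2 ^ `offset k` and the triple below 2
  -- ^ k pair to a number below 2 ^ (4 * `offset k` + 2 * k), and the last factor 2 makes the bound
  -- strict.
  · have h1 : Nat.pair zr zu < 2 ^ (2 * offset k + k) := by
      refine (pair_lt_sq hzr hzu).trans_le ?_
      rw [← pow_mul]
      exact Nat.pow_le_pow_right two_pos (by omega)
    have h2 : Nat.pair (Nat.pair j i) b < 2 ^ (2 * offset k + k) := by
      refine (hmis j hj i hi b hb).trans_lt (Nat.lt_two_pow_self.trans_le ?_)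
      exact Nat.pow_le_pow_right two_pos (by omega)
    have h3 := pair_lt_sq h1 h2
    rw [← pow_mul] at h3
    have h4 : budget k = 2 ^ ((2 * offset k + k) * 2) * 2 := by
      rw [budget, budgetLog, ← pow_succ]
      congr 1
      ring
    omega
  · rw [hkq, Denumerable.ofNat_encode, hC]
    have hi' : inp (Nat.pair k (Nat.pair (Nat.pair zr zu) (Nat.pair (Nat.pair j i) b))) =
        (k, initSeg u k, initSeg r (k + 1), j) := by
      simp only [inp, Nat.unpair_pair, hzu', hzr' hr0]
    refine (Part.mem_map_iff _).2 ⟨w, hi' ▸ hwf, ?_⟩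
    simp only [out, Nat.unpair_pair]

/-! ### The lower bound -/

theorem mul_pow_sub_one_lt {N M a t : ℕ} (hN : N ≤ M ^ a) (hM : 0 < M) :
    N * (M ^ t - 1) < M ^ (t + a) := by
  have h1 : 0 < M ^ t := Nat.pow_pos hM
  have h2 : 0 < M ^ a := Nat.pow_pos hM
  calc N * (M ^ t - 1) ≤ M ^ a * (M ^ t - 1) := Nat.mul_le_mul_right _ hN
    _ < M ^ a * M ^ t := Nat.mul_lt_mul_of_pos_left (by omega) h2
    _ = M ^ (t + a) := by rw [← pow_add, add_comm]

theorem two_le_alphabet (x : ℕ) : 2 ≤ alphabet x := (two_le_budget x).trans (budget_le_alphabet x)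

theorem guessBase_pow_le (k c : ℕ) : guessBase k ^ c ≤ alphabet k ^ (3 * c) := by
  rw [pow_mul]
  refine Nat.pow_le_pow_left ?_ c
  have := two_le_alphabet k
  unfold guessBase
  nlinarith [sq_nonneg (alphabet k)]

/-- Pigeonholing over `alphabet k ^ a` cases lowers the exponent by a, at k because the base there
is `alphabet k`, and later because budgets exceed `alphabet k`. -/
theorem innerThreshold_of_le {k x N a t : ℕ} (hx : k ≤ x) (hN : N ≤ alphabet k ^ a) :
    N * (innerThreshold k t x - 1) < innerThreshold k (t + a) x := by
  unfold innerThreshold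
  split_ifs with h
  · exact mul_pow_sub_one_lt hN (Nat.zero_lt_of_lt (two_le_alphabet k))
  · exact mul_pow_sub_one_lt (hN.trans (Nat.pow_le_pow_left (alphabet_le_budget (by omega)) a))
      (Nat.zero_lt_of_lt (two_le_budget x))

/-- The base is a budget, which dominates `alphabet k` only beyond k. At positions with tag n the
only letter is forced and nothing is lost. -/
theorem outerThreshold_of_lt {n k x N a s : ℕ} (hx : k < x) (hN : N ≤ alphabet k ^ a) :
    N * (outerThreshold n s x - 1) < outerThreshold n (s + a) x := by
  unfold outerThreshold
  split_ifs
  · simp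
  · exact mul_pow_sub_one_lt (hN.trans (Nat.pow_le_pow_left (alphabet_le_budget hx) a))
      (Nat.zero_lt_of_lt (two_le_budget x))

theorem outerThreshold_mono {n s s' : ℕ} (h : s ≤ s') (x : ℕ) :
    outerThreshold n s x ≤ outerThreshold n s' x := by
  unfold outerThreshold
  split_ifs
  · exact le_rfl
  · exact Nat.pow_le_pow_right (Nat.zero_lt_of_lt (two_le_budget x)) h

theorem outerThreshold_le_outerLetters {n s x : ℕ} (h : s ≤ x + 1) :
    outerThreshold n s x ≤ outerLetters n x := by
  unfold outerThreshold outerLetters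
  split_ifs
  · exact le_rfl
  · rw [alphabet_eq]
    exact Nat.pow_le_pow_right (Nat.zero_lt_of_lt (two_le_budget x)) h

theorem innerThreshold_le_innerLetters {n k t x : ℕ} (h : t ≤ n + 1) (h' : t ≤ x + 1) :
    innerThreshold k t x ≤ innerLetters n k x := by
  unfold innerThreshold innerLetters
  split_ifs
  · exact Nat.pow_le_pow_right (Nat.zero_lt_of_lt (two_le_alphabet k)) h
  · rw [alphabet_eq]
    exact Nat.pow_le_pow_right (Nat.zero_lt_of_lt (two_le_budget x)) h'

theorem outerThreshold_pos (n s x : ℕ) : 0 < outerThreshold n s x := by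
  unfold outerThreshold
  split_ifs
  · exact one_pos
  · exact Nat.pow_pos (Nat.zero_lt_of_lt (two_le_budget x))

theorem innerThreshold_pos (k t x : ℕ) : 0 < innerThreshold k t x := by
  unfold innerThreshold
  split_ifs
  · exact Nat.pow_pos (Nat.zero_lt_of_lt (two_le_alphabet k))
  · exact Nat.pow_pos (Nat.zero_lt_of_lt (two_le_budget x))

theorem outerLetters_le_alphabet (n x : ℕ) : outerLetters n x ≤ alphabet x := by
  unfold outerLetters
  split_ifs
  · exact one_le_two.trans (two_le_alphabet x)
  · exact le_rfl

theorem alphabet_le_innerLetters (n k x : ℕ) : alphabet x ≤ innerLetters n k x := by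
  unfold innerLetters
  split_ifs with h
  · rw [h]
    exact Nat.le_self_pow (by omega) _
  · exact le_rfl

/-- The letters that are not allowed in a sequence in `tagOnly n`. -/
def outerDead (n x v : ℕ) : Prop := tag x ≠ n ∧ v ∈ killed x

/-- The letters that are not allowed in the second argument of `mixed n k`. -/
def innerDead (n k x v : ℕ) : Prop :=
  if x = k then ∀ l < n + 1, digit (alphabet k) v l ∈ killed k else tag x = n ∧ v ∈ killed x

theorem not_big_outerDead (n : ℕ) :
    ¬ Big (outerLetters n) (outerThreshold n 1) (Big.deadStrings (outerDead n)) [] := by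
  intro h
  obtain ⟨x, v, hx, -⟩ := Big.mem_deadStrings h fun x _ S hS => by
    unfold outerThreshold
    split_ifs with ht
    · rw [Finset.card_eq_zero.2]
      · exact one_pos
      · exact Finset.eq_empty_of_forall_notMem fun v hv => (hS v hv).2.1 ht
    · rw [pow_one]
      exact card_lt_budget fun v hv => (hS v hv).2.2
  simp at hx

theorem not_big_innerDead {n k t : ℕ} {u : Baire} (hn : n ≤ k) (ht : 1 ≤ t)
    (hu : ∀ x, u x ∉ killed x) :
    ¬ Big (innerLetters n k) (innerThreshold k t) (Big.deadStrings (innerDead n k))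
      (initSeg u k) := by
  intro h
  obtain ⟨x, v, hx, hd⟩ := Big.mem_deadStrings h fun x _ S hS => by
    unfold innerThreshold innerDead innerLetters at *
    -- At k a letter is dead only if all its n + 1 digits are killed, which leaves at most (`budget
    -- k` - 1) ^ (n + 1) dead letters. As n ≤ k, this is less than `alphabet k`.
    split_ifs at * with hxk
    · have h2 := two_le_budget k
      have h1 : S.card ≤ (budget k - 1) ^ (n + 1) := card_le_of_digits (K := killed k)
        (fun T hT => Nat.le_sub_one_of_lt (card_lt_budget hT)) hS
      calc S.card ≤ (budget k - 1) ^ (n + 1) := h1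
        _ < budget k ^ (n + 1) := Nat.pow_lt_pow_left (by omega) (Nat.succ_ne_zero n)
        _ ≤ budget k ^ (k + 1) := Nat.pow_le_pow_right (by omega) (by omega)
        _ = alphabet k := (alphabet_eq k).symm
        _ ≤ alphabet k ^ t := Nat.le_self_pow (by omega) _
    · exact (card_lt_budget fun v hv => (hS v hv).2.2).trans_le
        (Nat.le_self_pow (show t ≠ 0 by omega) _)
  rw [getElem?_initSeg] at hx
  split_ifs at hx with hxk
  obtain rfl := Option.some.inj hx
  rw [innerDead, if_neg hxk.ne] at hd
  exact hu x hd.2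

/-- The functional with index `e` does not map `r` to a sequence that together with all elements of
`tagAvoiding` is mapped into `tagSeparating` by one of the first `c` functionals. -/
def Escapes (c e : ℕ) (r : ℕ → ℕ) : Prop :=
  ∀ r', ComputesTo e (bitSeq r) r' → ∃ g ∈ tagAvoiding, ∀ i < c, ∀ p,
    ComputesTo i (joinSeq g r') p → p ∉ tagSeparating

/-- For m ≠ n all columns (m, l) are r, whose killed letters have tag n. For m = n, choose l so that
the digit of t at k with index l is not killed; elsewhere the letters of t with tag n are not
killed. -/
theorem mixed_mem_tagAvoiding {n k : ℕ} {r t : Baire} (hr : ∀ x, r x < alphabet x)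
    (hrd : ∀ x, ¬ outerDead n x (r x)) (ht : ∀ x, t x < innerLetters n k x)
    (htd : ∀ x, ¬ innerDead n k x (t x)) : mixed n k r t ∈ tagAvoiding := by
  refine ⟨fun y => bitSeq_lt _ _, fun m => ?_⟩
  by_cases hm : m = n
  · subst hm
    obtain ⟨l, hl, hlk⟩ : ∃ l < m + 1, digit (alphabet k) (t k) l ∉ killed k := by
      have := htd k
      rw [innerDead, if_pos rfl] at this
      push Not at this
      exact this
    refine ⟨l, Nat.le_of_lt_succ hl, fun x hx htag => ?_⟩
    rw [column_mixed_self] at hx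
    by_cases hxk : x = k
    · subst hxk
      have hv : replaceDigit x l t x = digit (alphabet x) (t x) l := if_pos rfl
      rw [letter_bitSeq, hv] at hx
      · exact hlk hx
      · rw [hv]
        exact Nat.mod_lt _ (Nat.zero_lt_of_lt (two_le_alphabet x))
    · have hv : replaceDigit k l t x = t x := if_neg hxk
      have h1 := ht x
      have h2 := htd x
      rw [innerLetters, if_neg hxk] at h1
      rw [innerDead, if_neg hxk] at h2
      rw [letter_bitSeq (hv ▸ h1), hv] at hx
      exact h2 ⟨htag, hx⟩
  · refine ⟨0, Nat.zero_le _, fun x hx htag => ?_⟩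
    rw [column_mixed_of_ne hm, letter_bitSeq (hr x)] at hx
    exact hrd x ⟨htag ▸ hm, hx⟩

theorem exists_add_guess {c k w i V : ℕ} (hi : i < c) (hw : digit (guessBase k) w i = 0)
    (hV : V < alphabet k ^ 2) : ∃ w' < guessBase k ^ c, guessCount c k w' = guessCount c k w + 1 ∧
      digit (guessBase k) w' i = V + 1 ∧
      ∀ i' < c, i' ≠ i → digit (guessBase k) w' i' = digit (guessBase k) w i' := by
  have hpos : 0 < guessBase k := Nat.succ_pos _
  obtain ⟨w', hw', H⟩ := exists_digits (M := guessBase k) (c := c)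
    (f := fun i' => if i' = i then V + 1 else digit (guessBase k) w i') fun i' _ => by
      split_ifs
      · exact Nat.succ_lt_succ hV
      · exact Nat.mod_lt _ hpos
  refine ⟨w', hw', ?_, by simpa using H i hi, fun i' hi' hne => by simpa [hne] using H i' hi'⟩
  have hcount : ∀ w, guessCount c k w =
      ((Finset.range c).filter fun i => digit (guessBase k) w i ≠ 0).card := fun w => rfl
  have hins : ((Finset.range c).filter fun i => digit (guessBase k) w' i ≠ 0) =
      insert i ((Finset.range c).filter fun i => digit (guessBase k) w i ≠ 0) := by
    ext i'
    simp only [Finset.mem_filter, Finset.mem_insert, Finset.mem_range]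
    by_cases h : i' = i
    · subst h
      simp [hi, H i' hi]
    · by_cases h' : i' < c
      · simp [h, h', H i' h']
      · simp [h, h']
  rw [hcount, hcount, hins, Finset.card_insert_of_notMem (by simp [hw])]

/-- The guesses of some `w` with `j` guesses are correct for `ρ` and the elements of this set. -/
def compatibleSet (c : ℕ) (E : List ℕ) (k j : ℕ) (ρ : List ℕ) : Set (List ℕ) :=
  {τ | ∃ w < guessBase k ^ c, guessCount c k w = j ∧ Compatible c E k w ρ τ}

theorem Compatible.mono {c k w m m' : ℕ} {E : List ℕ} {r : Baire} {τ τ' : List ℕ}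
    (h : Compatible c E k w (initSeg r m) τ) (hm : m ≤ m') (hτ : τ <+: τ') :
    Compatible c E k w (initSeg r m') τ' :=
  fun i hi h0 => (h i hi h0).mono hm hτ

/-- The inner part of a stage. Choose a path q compatible with the guesses w that avoids dead
letters and any compatibility with j + 1 guesses; then g is `mixed n k r q`. The union over m turns
all future information about r into one set to avoid. -/
theorem exists_escape {c n e k j t w : ℕ} {e' : ℕ → ℕ}
    (he' : ∀ i k r t r' p, ComputesTo e (bitSeq r) r' →
      ComputesTo i (joinSeq (mixed n k r t) r') p → ComputesTo (e' i) (consSeq k (joinSeq r t)) p)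
    (hnk : n ≤ k) (htag : tag k = n) (ht : 1 ≤ t) (htn : t ≤ n) {u : Baire}
    (hu : ∀ x, u x < alphabet x) (huk : ∀ x, u x ∉ killed x)
    (hcount : guessCount c k w = j)
    (hkill : ∀ i < c, ∀ b < 2, letterPart k (digit (guessBase k) w i - 1) b ∈ killed k)
    {r : Baire} (hr : ∀ x, r x < alphabet x) (hrd : ∀ x, ¬ outerDead n x (r x)) {m₁ : ℕ}
    (hbig : Big (innerLetters n k) (innerThreshold k (t + 1))
      {τ | Compatible c (initSeg e' c) k w (initSeg r m₁) τ} (initSeg u k))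
    (hnot : ∀ m, ¬ Big (innerLetters n k) (innerThreshold k t)
      (compatibleSet c (initSeg e' c) k (j + 1) (initSeg r m)) (initSeg u k)) :
    Escapes c e r := by
  intro r' hr'
  have hX : ¬ Big (innerLetters n k) (innerThreshold k t)
      (⋃ m, compatibleSet c (initSeg e' c) k (j + 1) (initSeg r m)) (initSeg u k) := by
    intro h
    obtain ⟨m, hm⟩ := Big.exists_of_iUnion (fun m m' hm τ => by
      rintro ⟨w, hw, hwj, hc⟩
      exact ⟨w, hw, hwj, hc.mono hm List.prefix_rfl⟩) h
    exact hnot m hm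
  have hU : ¬ Big (innerLetters n k) (innerThreshold k (t + 1))
      (Big.deadStrings (innerDead n k) ∪
        ⋃ m, compatibleSet c (initSeg e' c) k (j + 1) (initSeg r m)) (initSeg u k) := by
    intro h
    rcases h.or_of_union (β' := innerThreshold k t) (fun x hx => innerThreshold_of_le
      (by rwa [length_initSeg] at hx) (by simpa using two_le_alphabet k)) with h | h
    · exact not_big_innerDead hnk ht huk h
    · exact hX h
  obtain ⟨τ₁, hτ₁, hpre, hlet, hτ₁U⟩ := hbig.exists_mem_not hU
    (lettersBelow_initSeg (fun x => (hu x).trans_le (alphabet_le_innerLetters n k x)) k)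
  have hlen : k ≤ τ₁.length := by simpa [length_initSeg] using hpre.length_le
  obtain ⟨q, hq, hqlet, hqU⟩ := Big.exists_path hτ₁U hlet fun x hx =>
    innerThreshold_le_innerLetters (by omega) (by omega)
  have hqd : ∀ x, ¬ innerDead n k x (q x) := fun x hx =>
    hqU (max τ₁.length (x + 1)) (le_max_left _ _) (.base (.inl ⟨x, q x,
      getElem?_initSeg_of_lt q ((Nat.lt_succ_self x).trans_le (le_max_right _ _)), hx⟩))
  refine ⟨mixed n k r q, mixed_mem_tagAvoiding hr hrd hqlet hqd, fun i hi p hp hsep => ?_⟩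
  have H := he' i k r q r' p hr' hp
  have hE : (initSeg e' c).getD i 0 = e' i := getD_initSeg e' hi
  -- Without a guess for i, totality would give a correct V; adding it to w would make some initial
  -- segment of q compatible with j + 1 guesses.
  by_cases h0 : digit (guessBase k) w i = 0
  · obtain ⟨V, hV, N, hN⟩ := exists_givesBits H
    obtain ⟨w', hw', hcount', hi', hne⟩ := exists_add_guess hi h0 hV
    set m := max N (max m₁ τ₁.length)
    have hm1 : m₁ ≤ m := (le_max_left _ _).trans (le_max_right _ _)
    have hm2 : τ₁.length ≤ m := (le_max_right _ _).trans (le_max_right _ _)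
    refine hqU m hm2 (.base (.inr (Set.mem_iUnion.2 ⟨m, w', hw', by rw [hcount', hcount], ?_⟩)))
    intro i₂ hi₂ hd
    by_cases h : i₂ = i
    · subst h
      rw [hi', hE]
      exact hN m (le_max_left _ _)
    · rw [hne i₂ hi₂ h] at hd ⊢
      exact (hτ₁ i₂ hi₂ hd).mono hm1 (hq ▸ initSeg_prefix q hm2)
  -- With a guess for i, the output has the guessed letters at k. Both were killed, and they share
  -- the tag of k.
  · have hG := hτ₁ i hi h0
    rw [hE, ← hq] at hG
    have h1 : letter (evenPart p) k ∈ killed k := by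
      have := hkill i hi 0 two_pos
      rwa [hG.letterPart_eq H two_pos] at this
    have h2 : letter (oddPart p) k ∈ killed k := by
      have := hkill i hi 1 one_lt_two
      rwa [hG.letterPart_eq H one_lt_two] at this
    exact (hsep.2 k k h1).2 h2 rfl

theorem exists_last {P : ℕ → Prop} {c : ℕ} (h0 : P 0) (hc : ¬ P (c + 1)) :
    ∃ j ≤ c, P j ∧ ¬ P (j + 1) := by
  by_contra! H
  have : ∀ j ≤ c + 1, P j := by
    intro j
    induction j with
    | zero => exact fun _ => h0
    | succ j ih => exact fun hj => H j (by omega) (ih (by omega))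
  exact hc (this _ le_rfl)

/-- Handles one index e. Every continuation of the new string that eventually stays outside the
larger set A' escapes e; A ⊆ A' preserves what earlier stages achieved. -/
theorem exists_stage {c n p : ℕ} (e : ℕ) (hn : (c + 1) * (3 * c + 1) ≤ n) {ρ : List ℕ}
    {A : Set (List ℕ)} (hρ : LettersBelow (outerLetters n) ρ)
    (hA : ¬ Big (outerLetters n) (outerThreshold n p) A ρ) (hp : p ≤ ρ.length + 1)
    (hdead : Big.deadStrings (outerDead n) ⊆ A) :
    ∃ ρ' A' p', ρ <+: ρ' ∧ LettersBelow (outerLetters n) ρ' ∧ A ⊆ A' ∧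
      ¬ Big (outerLetters n) (outerThreshold n p') A' ρ' ∧ p' ≤ ρ'.length + 1 ∧
      ∀ r : Baire, (∀ x, r x < outerLetters n x) → initSeg r ρ'.length = ρ' →
        (∃ m₀, ∀ m ≥ m₀, initSeg r m ∉ A') → Escapes c e r := by
  classical
  choose e' he' using exists_simulation_index n e
  -- Exponents for the outer and the inner tree. Passing from j to j + 1 uses 3 * c to pigeonhole
  -- over the at most `alphabet k ^ (3 * c)` guesses and 1 to split a union of two sets; j runs up
  -- to c + 1.
  let s : ℕ → ℕ := fun j => p + (c + 1 - j) * (3 * c + 1)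
  let t : ℕ → ℕ := fun j => (c + 1 - j) * (3 * c + 1) + 1
  have hst : ∀ j ≤ c, s j = s (j + 1) + 1 + 3 * c ∧ t j = t (j + 1) + 1 + 3 * c := by
    intro j hj
    have : c + 1 - j = (c + 1 - (j + 1)) + 1 := by omega
    simp only [s, t]
    rw [this, add_mul]
    omega
  have hs0 : ∀ j, s j ≤ s 0 := fun j =>
    Nat.add_le_add_left (Nat.mul_le_mul_right _ (by omega)) _
  have ht0 : ∀ j, t j ≤ t 0 := fun j =>
    Nat.add_le_add_right (Nat.mul_le_mul_right _ (by omega)) _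
  have hmul : Primrec fun j : ℕ => (c + 1 - (j + 1)) * (3 * c + 1) :=
    Primrec.nat_mul.comp (Primrec.nat_sub.comp (Primrec.const _) Primrec.succ) (Primrec.const _)
  obtain ⟨q, hq⟩ := exists_search c (initSeg e' c) n (s := fun j => s (j + 1) + 1)
    (t := fun j => t (j + 1) + 1)
    (Primrec.succ.comp (Primrec.nat_add.comp (Primrec.const p) hmul))
    (Primrec.succ.comp (Primrec.succ.comp hmul))
  obtain ⟨M, hM⟩ : ∃ M, ∀ j ≤ c, ∀ i < c, ∀ b < 2, Nat.pair (Nat.pair j i) b ≤ M :=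
    ⟨((c + 1) ^ 2 + 2) ^ 2, fun j hj i hi b hb => (pair_lt_sq
      ((pair_lt_sq (m := c + 1) (by omega) (by omega)).trans_le (Nat.le_add_right _ 2))
      (by omega)).le⟩
  -- The program q is fixed before k, which is possible because the simulation indices do not depend
  -- on k. The size of k leaves room for the exponent s 0 and for the arguments of the search.
  obtain ⟨k, hkq, hktag, hk⟩ : ∃ k : ℕ, k.unpair.1 = q ∧ tag k = n ∧
      ρ.length + s 0 + n + M ≤ k :=
    ⟨Nat.pair q (Nat.pair n (ρ.length + s 0 + n + M)), by simp, by simp [tag],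
      (Nat.right_le_pair _ _).trans (Nat.right_le_pair _ _)⟩
  obtain ⟨r₀, hr₀, hr₀let, hr₀A⟩ := Big.exists_path hA hρ fun x hx =>
    outerThreshold_le_outerLetters (by omega)
  -- The tag of k is n, so the outer tree has one letter there: the search can know it, and no
  -- branching is needed at k.
  have hr₀k : r₀ k = 0 := by
    have := hr₀let k
    rw [outerLetters, if_pos hktag] at this
    omega
  choose u hu huk using exists_not_mem_killed
  let X : ℕ → Set (List ℕ) := fun j => {ρ' | Big (innerLetters n k) (innerThreshold k (t j))
    (compatibleSet c (initSeg e' c) k j ρ') (initSeg u k)}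
  have hX0 : Big (outerLetters n) (outerThreshold n (s 0)) (X 0) (initSeg r₀ (k + 1)) := by
    have hd : ∀ i, digit (guessBase k) 0 i = 0 := fun i => by simp [digit]
    refine .base (.base ⟨0, Nat.pow_pos (Nat.succ_pos _), ?_, fun i _ h => absurd (hd i) h⟩)
    simp [guessCount, hd]
  have hXc : ¬ Big (outerLetters n) (outerThreshold n (s (c + 1))) (X (c + 1))
      (initSeg r₀ (k + 1)) := by
    intro h
    have hempty : X (c + 1) = ∅ := by
      refine Set.eq_empty_of_forall_notMem fun ρ' hρ' => ?_
      have : compatibleSet c (initSeg e' c) k (c + 1) ρ' = ∅ := by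
        refine Set.eq_empty_of_forall_notMem fun τ => ?_
        rintro ⟨w, -, hw, -⟩
        have : guessCount c k w ≤ c := (List.length_filter_le _ _).trans (by simp)
        omega
      have hρ'' : Big (innerLetters n k) (innerThreshold k (t (c + 1))) _ _ := hρ'
      rw [this] at hρ''
      exact Big.not_empty (innerThreshold_pos k _) hρ''
    rw [hempty] at h
    exact Big.not_empty (outerThreshold_pos n _) h
  -- Making no guess is always possible and c + 1 guesses never are, so there is a last j for which
  -- j guesses are correct on a big set.
  obtain ⟨j, hj, hXj, hXj'⟩ := exists_last (P := fun j => Big (outerLetters n)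
    (outerThreshold n (s j)) (X j) (initSeg r₀ (k + 1))) hX0 hXc
  let W := (Finset.range (guessBase k ^ c)).filter fun w => guessCount c k w = j
  have hW : W.card ≤ alphabet k ^ (3 * c) :=
    (Finset.card_filter_le _ _).trans ((Finset.card_range _).trans_le (guessBase_pow_le k c))
  have hsub : X j ⊆ ⋃ w ∈ W, {ρ' | Big (innerLetters n k) (innerThreshold k (t (j + 1) + 1))
      {τ | Compatible c (initSeg e' c) k w ρ' τ} (initSeg u k)} := by
    intro ρ' hρ'
    have h1 : Big (innerLetters n k) (innerThreshold k (t j))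
        (⋃ w ∈ W, {τ | Compatible c (initSeg e' c) k w ρ' τ}) (initSeg u k) := by
      refine Big.mono hρ' ?_ fun _ _ => le_rfl
      rintro τ ⟨w, hw, hwj, hc⟩
      exact Set.mem_iUnion₂.2 ⟨w, Finset.mem_filter.2 ⟨Finset.mem_range.2 hw, hwj⟩, hc⟩
    obtain ⟨w, hw, h2⟩ := h1.exists_of_biUnion (β' := innerThreshold k (t (j + 1) + 1))
      fun x hx => by
        rw [(hst j hj).2]
        exact innerThreshold_of_le (by rwa [length_initSeg] at hx) hW
    exact Set.mem_iUnion₂.2 ⟨w, hw, h2⟩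
  have hbig := hXj.mono hsub fun _ _ => le_rfl
  obtain ⟨w₀, hw₀, hw₀big⟩ := hbig.exists_of_biUnion (β' := outerThreshold n (s (j + 1) + 1))
    fun x hx => by
      rw [(hst j hj).1]
      rw [length_initSeg] at hx
      exact outerThreshold_of_lt hx hW
  -- Pigeonholing in both trees gave some agreeing w₀. The search may find a different w, and it is
  -- the letters of w that are killed; from here on w is used.
  obtain ⟨w, ⟨hwj, hwbig⟩, hkill⟩ := hq k hkq
    (fun j hj i hi b hb => (hM j hj i hi b hb).trans (by omega)) r₀ u
    (fun x _ => (hr₀let x).trans_le (outerLetters_le_alphabet n x)) hr₀k (fun x _ => hu x) j hj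
    ⟨w₀, (Finset.mem_filter.1 hw₀).2, hw₀big⟩
  have hA' : ¬ Big (outerLetters n) (outerThreshold n (s (j + 1) + 1)) (A ∪ X (j + 1))
      (initSeg r₀ (k + 1)) := by
    intro h
    rcases h.or_of_union (β' := outerThreshold n (s (j + 1))) (fun x hx => by
      rw [length_initSeg] at hx
      exact outerThreshold_of_lt hx (by simpa using two_le_alphabet k)) with h | h
    · refine hr₀A (k + 1) (by omega) (h.mono subset_rfl fun x _ => outerThreshold_mono ?_ x)
      exact Nat.le_add_right _ _
    · exact hXj' h
  obtain ⟨ρ₁, hρ₁, hpre, hlet, hρ₁A⟩ := Big.exists_mem_not hwbig hA' (lettersBelow_initSeg hr₀let _)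
  have hlen : k + 1 ≤ ρ₁.length := by simpa [length_initSeg] using hpre.length_le
  refine ⟨ρ₁, A ∪ X (j + 1), s (j + 1) + 1, ?_, hlet, Set.subset_union_left, hρ₁A, ?_, ?_⟩
  · rw [← hr₀]
    exact (initSeg_prefix r₀ (by omega)).trans hpre
  · have := hs0 (j + 1)
    omega
  -- The inner exponent t (j + 1) + 1 is at most n + 1 because t 0 = (c + 1) * (3 * c + 1) + 1; this
  -- determines how large n must be.
  · rintro r hr hrρ ⟨m₀, hm₀⟩
    have ht1 := ht0 j
    have ht2 := (hst j hj).2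
    have ht3 : t 0 = (c + 1) * (3 * c + 1) + 1 := rfl
    refine exists_escape (m₁ := ρ₁.length) (t := t (j + 1)) he' (by omega) hktag (Nat.le_add_left 1 _)
      (by omega) hu huk hwj hkill (fun x => (hr x).trans_le (outerLetters_le_alphabet n x)) ?_
      (by rw [hrρ]; exact hρ₁) ?_
    · intro x hx
      refine hm₀ (max m₀ (x + 1)) (le_max_left _ _) (.inl (hdead ⟨x, r x, ?_, hx⟩))
      exact getElem?_initSeg_of_lt r ((Nat.lt_succ_self x).trans_le (le_max_right _ _))
    · intro m hm
      refine hm₀ (max m₀ m) (le_max_left _ _) (.inr (Big.mono hm ?_ fun _ _ => le_rfl))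
      rintro τ ⟨w, hw, hwj, hc⟩
      exact ⟨w, hw, hwj, hc.mono (le_max_right _ _) List.prefix_rfl⟩

/-- The outer exponent p grows with each stage but stays within the length of the string plus one,
so d can be arbitrary while n stays fixed. -/
theorem exists_iterated_stages {c n : ℕ} (hn : (c + 1) * (3 * c + 1) ≤ n) (d : ℕ) :
    ∃ ρ A p, LettersBelow (outerLetters n) ρ ∧ Big.deadStrings (outerDead n) ⊆ A ∧
      ¬ Big (outerLetters n) (outerThreshold n p) A ρ ∧ p ≤ ρ.length + 1 ∧
      ∀ r : Baire, (∀ x, r x < outerLetters n x) → initSeg r ρ.length = ρ →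
        (∃ m₀, ∀ m ≥ m₀, initSeg r m ∉ A) → ∀ e < d, Escapes c e r := by
  induction d with
  | zero =>
    refine ⟨[], _, 1, fun i v h => ?_, subset_rfl, not_big_outerDead n, le_rfl,
      fun _ _ _ _ e he => absurd he (Nat.not_lt_zero e)⟩
    simp at h
  | succ d ih =>
    obtain ⟨ρ, A, p, h1, h2, h3, h4, h5⟩ := ih
    obtain ⟨ρ', A', p', h6, h7, h8, h9, h10, h11⟩ := exists_stage d hn h1 h3 h4 h2
    refine ⟨ρ', A', p', h7, h2.trans h8, h9, h10, fun r hr hrρ hav e he => ?_⟩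
    rcases Nat.lt_succ_iff_lt_or_eq.1 he with he | rfl
    · obtain ⟨m₀, hm₀⟩ := hav
      exact h5 r hr (eq_initSeg_of_prefix (hrρ.symm ▸ h6)).symm
        ⟨m₀, fun m hm hmA => hm₀ m hm (h8 hmA)⟩ e he
    · exact h11 r hr hrρ hav

/-- The order of quantifiers is the point: n depends only on c, so the number d of functionals that
reduce R to `tagOnly n` may be chosen afterwards. -/
theorem exists_forall_escapes (c : ℕ) : ∃ n, ∀ d, ∃ r : Baire, bitSeq r ∈ tagOnly n ∧
    ∀ e < d, Escapes c e r := by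
  refine ⟨(c + 1) * (3 * c + 1), fun d => ?_⟩
  obtain ⟨ρ, A, p, h1, h2, h3, h4, h5⟩ := exists_iterated_stages (c := c) le_rfl d
  obtain ⟨r, hr, hlet, hrA⟩ := Big.exists_path h3 h1 fun x hx =>
    outerThreshold_le_outerLetters (by omega)
  refine ⟨r, ⟨bitSeq_lt r, fun x hx => ?_⟩, h5 r hlet hr ⟨ρ.length, fun m hm hmA =>
    hrA m hm (.base hmA)⟩⟩
  rw [letter_bitSeq ((hlet x).trans_le (outerLetters_le_alphabet _ x))] at hx
  by_contra htag
  refine hrA (max ρ.length (x + 1)) (le_max_left _ _) (.base (h2 ⟨x, r x, ?_, htag, hx⟩))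
  exact getElem?_initSeg_of_lt r ((Nat.lt_succ_self x).trans_le (le_max_right _ _))

/-! ### The main theorem -/

/-- `hlow` turns the learner of the upper bound into a reduction in 𝓕, and `hup` turns reductions in
𝓕 into finitely many functionals. All competitors are Π⁰₁ classes, so the argument is the same for
both collections S. -/
theorem not_isBrouwerian_degrees {𝓕 : Set (Baire →. Baire)} {S : Set (Set Baire)}
    (h𝓕 : IsReducibility 𝓕) (hS : ∀ Q ∈ S, ∀ R ∈ S, joinSet Q R ∈ S) (hpi : pi01Sets ⊆ S)
    (hlow : ∀ {P Q}, Reduces (learnable changes) P Q → Reduces 𝓕 P Q)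
    (hup : ∀ {P Q}, Reduces 𝓕 P Q → Reduces finitelyComputable P Q) :
    ¬ IsBrouwerian (Degrees 𝓕 S) := by
  intro h
  obtain ⟨R, -, hR, hmin⟩ := (isBrouwerian_degrees_iff h𝓕 hS).1 h _
    (hpi tagSeparating_mem_pi01Sets) _ (hpi tagAvoiding_mem_pi01Sets)
  obtain ⟨c, hc⟩ := reduces_finitelyComputable.1 (hup hR)
  obtain ⟨n, hn⟩ := exists_forall_escapes c
  obtain ⟨d, hd⟩ := reduces_finitelyComputable.1
    (hup (hmin _ (hpi (tagOnly_mem_pi01Sets n)) (hlow (tagSeparating_reduces n))))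
  obtain ⟨r, hr, hesc⟩ := hn d
  obtain ⟨r', hr', e, he, her⟩ := hd _ hr
  obtain ⟨g, hg, H⟩ := hesc e he r' her
  obtain ⟨p, hp, i, hi, hip⟩ := hc _ (joinSeq_mem_joinSet.2 ⟨hg, hr'⟩)
  exact H i hi p hip hp

theorem not_isBrouwerian_of_mem {𝓕 : Set (Baire →. Baire)}
    (h : 𝓕 ∈ ({boundedMindChanges, boundedErrors, finitelyComputable} : Set (Set (Baire →. Baire))))
    {S : Set (Set Baire)} (hS : ∀ Q ∈ S, ∀ R ∈ S, joinSet Q R ∈ S) (hpi : pi01Sets ⊆ S) :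
    ¬ IsBrouwerian (Degrees 𝓕 S) := by
  rcases h with rfl | rfl | rfl
  · exact not_isBrouwerian_degrees isLearningCost_changes.isReducibility hS hpi id
      fun h => h.changes_to_range.range_to_finitely
  · exact not_isBrouwerian_degrees isLearningCost_range.isReducibility hS hpi
      Reduces.changes_to_range Reduces.range_to_finitely
  · exact not_isBrouwerian_degrees isReducibility_finitelyComputable hS hpi
      (fun h => h.changes_to_range.range_to_finitely) id

end PiecewiseDegrees

open PiecewiseDegrees FirstOrder in
theorem mainTheorem6 :
    (∀ 𝓕 ∈ ({boundedMindChanges, boundedErrors, finitelyComputable} : Set (Set (Baire →. Baire))),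
      ¬ IsBrouwerian (AllDegrees 𝓕) ∧ ¬ IsBrouwerian (Pi01Degrees 𝓕)) ∧
    (∀ 𝓕 ∈ ({boundedMindChanges, boundedErrors, finitelyComputable} : Set (Set (Baire →. Baire))),
      ¬ (AllDegrees 𝓕 ≅[Language.order] MedvedevDegrees) ∧
      ¬ (AllDegrees 𝓕 ≅[Language.order] MuchnikDegrees) ∧
      ¬ (Pi01Degrees 𝓕 ≅[Language.order] MedvedevDegrees) ∧
      ¬ (Pi01Degrees 𝓕 ≅[Language.order] MuchnikDegrees)) := by
  have hall : ∀ 𝓕 ∈ ({boundedMindChanges, boundedErrors, finitelyComputable} :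
      Set (Set (Baire →. Baire))), ¬ IsBrouwerian (AllDegrees 𝓕) := fun 𝓕 h =>
    not_isBrouwerian_of_mem h (fun _ _ _ _ => trivial) (Set.subset_univ _)
  have hpi : ∀ 𝓕 ∈ ({boundedMindChanges, boundedErrors, finitelyComputable} :
      Set (Set (Baire →. Baire))), ¬ IsBrouwerian (Pi01Degrees 𝓕) := fun 𝓕 h =>
    not_isBrouwerian_of_mem h joinSet_mem_pi01Sets subset_rfl
  refine ⟨fun 𝓕 h => ⟨hall 𝓕 h, hpi 𝓕 h⟩, fun 𝓕 h => ⟨fun H => hall 𝓕 h ?_,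
    fun H => hall 𝓕 h ?_, fun H => hpi 𝓕 h ?_, fun H => hpi 𝓕 h ?_⟩⟩
  · exact IsBrouwerian.of_elementarilyEquivalent H isBrouwerian_medvedevDegrees
  · exact IsBrouwerian.of_elementarilyEquivalent H isBrouwerian_muchnikDegrees
  · exact IsBrouwerian.of_elementarilyEquivalent H isBrouwerian_medvedevDegrees
  · exact IsBrouwerian.of_elementarilyEquivalent H isBrouwerian_muchnikDegrees
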